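/- Let $G=G_1\times\cdots\times G_n$ be a product of locally compact ($=$ Hausdorff locally compact) $\sigma$-compact topological groups and let $\Gamma<G$ be an irreducible uniform lattice, i.e. a discrete subgroup such that $G/\Gamma$ is compact and the projection of $\Gamma$ to each factor $G_i$ is dense. Let $X$ be a proper CAT(0) space, endow its isometry group $\mathrm{Is}(X)$ with the compact-open topology and its boundary at infinity $\partial X$ (the set of asymptoty classes of geodesic rays) with the cone topology and the natural action of $\mathrm{Is}(X)$. Call a subgroup $L<\mathrm{Is}(X)$ *unbounded* if $Lx$ is unbounded in $X$ for some (equivalently, every) $x\in X$, and *indecomposable* if for every non-empty closed $L$-invariant subset $\mathscr C\subseteq\partial X$ the closure $\overline L$ of $L$ in $\mathrm{Is}(X)$ acts faithfully on $\mathscr C$ and the image of $\overline L$ in $\mathrm{Homeo}(\mathscr C)$ is closed for the topology of uniform convergence. Let $H<\mathrm{Is}(X)$ be a closed subgroup and let $\tau:\Gamma\to H$ be a homomorphism whose image is indecomposable and unbounded. Then $\tau$ extends to a continuous homomorphism $\widetilde\tau:G\to H$. Moreover, $\widetilde\tau$ factors through some $G_i$: there are an index $i$ and a continuous homomorphism $\sigma:G_i\to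 H$ such that $\widetilde\tau(g)=\sigma(g_i)$ for all $g=(g_1,\dots,g_n)\in G$. -/

import Mathlib

open scoped NNReal

namespace SplitRigidity

/-! ### CAT(0) spaces -/

/-- `σ`, restricted to `[0, dist x y]`, is a geodesic segment from `x` to `y`. -/
def IsGeodesicSegment {X : Type*} [MetricSpace X] (σ : ℝ → X) (x y : X) : Prop :=
  σ 0 = x ∧ σ (dist x y) = y ∧
    ∀ s ∈ Set.Icc 0 (dist x y), ∀ t ∈ Set.Icc 0 (dist x y), dist (σ s) (σ t) = |s - t|

/-- A CAT(0) space: a geodesic metric space in which the midpoint of any geodesic segment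
satisfies the Bruhat–Tits `CN` inequality. -/
structure IsCAT0 (X : Type*) [MetricSpace X] : Prop where
  exists_geodesic : ∀ x y : X, ∃ σ : ℝ → X, IsGeodesicSegment σ x y
  cn : ∀ (x c c' : X) (σ : ℝ → X), IsGeodesicSegment σ c c' →
    2 * dist (σ (dist c c' / 2)) x ^ 2 ≤
      dist c' x ^ 2 + dist c x ^ 2 - 1 / 2 * dist c' c ^ 2

/-! ### The isometry group -/

/-- `Is(X)` carries the compact-open topology. -/
instance isometryTopology (X : Type*) [MetricSpace X] : TopologicalSpace (X ≃ᵢ X) :=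
  TopologicalSpace.induced (fun g => (⟨g, g.continuous⟩ : C(X, X))) inferInstance

/-- A set of isometries is unbounded if it has an unbounded orbit. -/
def IsUnbounded {X : Type*} [MetricSpace X] (L : Set (X ≃ᵢ X)) : Prop :=
  ∃ x : X, ¬ Bornology.IsBounded ((fun g : X ≃ᵢ X => g x) '' L)

/-! ### The boundary at infinity -/

/-- Geodesic rays: isometric maps `[0, ∞) → X`. -/
structure GeodesicRay (X : Type*) [MetricSpace X] where
  toFun : ℝ≥0 → X
  isometry : Isometry toFun

/-- Two rays are asymptotic if they stay at bounded distance from each other. -/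
instance asymptotic (X : Type*) [MetricSpace X] : Setoid (GeodesicRay X) where
  r c c' := ∃ K : ℝ, ∀ t, dist (c.toFun t) (c'.toFun t) ≤ K
  iseqv :=
    { refl := fun _ => ⟨0, fun _ => by simp⟩
      symm := fun ⟨K, h⟩ => ⟨K, fun t => by rw [dist_comm]; exact h t⟩
      trans := fun ⟨K, h⟩ ⟨K', h'⟩ =>
        ⟨K + K', fun t => (dist_triangle _ _ _).trans (add_le_add (h t) (h' t))⟩ }

/-- The boundary at infinity `∂X`. -/
def Boundary (X : Type*) [MetricSpace X] : Type _ :=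
  Quotient (asymptotic X)

/-- The boundary point represented by a ray. -/
def GeodesicRay.endpoint {X : Type*} [MetricSpace X] (c : GeodesicRay X) : Boundary X :=
  Quotient.mk (asymptotic X) c

/-- The basic set `U(c, r, ε)` of the cone topology: the endpoints of the rays which issue from
the origin of `c` and pass at distance less than `ε` from `c(r)` at time `r`. -/
def coneNhd {X : Type*} [MetricSpace X] (c : GeodesicRay X) (r : ℝ≥0) (ε : ℝ) :
    Set (Boundary X) :=
  {ξ | ∃ c' : GeodesicRay X, c'.endpoint = ξ ∧ c'.toFun 0 = c.toFun 0 ∧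
    dist (c'.toFun r) (c.toFun r) < ε}

/-- The cone topology on `∂X`. For a complete CAT(0) space, the sets `U(c, r, ε)` with `c` issuing
from a fixed basepoint form a basis of a topology which does not depend on the basepoint; it is
therefore the topology generated by all the sets `U(c, r, ε)`. -/
instance coneTopology (X : Type*) [MetricSpace X] : TopologicalSpace (Boundary X) :=
  TopologicalSpace.generateFrom
    {U | ∃ (c : GeodesicRay X) (r : ℝ≥0) (ε : ℝ), 0 < ε ∧ U = coneNhd c r ε}

/-- The image of a ray under an isometry. -/
def GeodesicRay.translate {X : Type*} [MetricSpace X] (g : X ≃ᵢ X) (c : GeodesicRay X) :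
    GeodesicRay X :=
  ⟨g ∘ c.toFun, g.isometry.comp c.isometry⟩

/-- The action of `Is(X)` on `∂X`. -/
instance boundaryAction (X : Type*) [MetricSpace X] : MulAction (X ≃ᵢ X) (Boundary X) where
  smul g := Quotient.map (GeodesicRay.translate g) (by
    rintro c c' ⟨K, h⟩
    exact ⟨K, fun t => (g.dist_eq _ _).trans_le (h t)⟩)
  one_smul ξ := by
    induction ξ using Quotient.inductionOn
    rfl
  mul_smul g h ξ := by
    induction ξ using Quotient.inductionOn
    rfl

/-! ### Indecomposable groups of isometries -/

/-- The topology of uniform convergence on `Homeo(K)`. It is used for compact Hausdorff `K`, where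
it is the compact-open topology. -/
instance homeoTopology (K : Type*) [TopologicalSpace K] : TopologicalSpace (K ≃ₜ K) :=
  TopologicalSpace.induced (fun φ => (⟨φ, φ.continuous⟩ : C(K, K))) inferInstance

/-- The image in `Homeo(C)` of a set `L` of isometries of `X`, where `C ⊆ ∂X`. -/
def imageInHomeo {X : Type*} [MetricSpace X] (L : Set (X ≃ᵢ X)) (C : Set (Boundary X)) :
    Set (C ≃ₜ C) :=
  {φ | ∃ g ∈ L, ∀ ξ : C, (φ ξ : Boundary X) = g • (ξ : Boundary X)}

/-- `L` is indecomposable if for every non-empty `L`-invariant closed `C ⊆ ∂X`, the closure of `L`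
acts faithfully on `C` and has closed image in `Homeo(C)`. -/
def IsIndecomposable {X : Type*} [MetricSpace X] (L : Subgroup (X ≃ᵢ X)) : Prop :=
  ∀ C : Set (Boundary X), C.Nonempty → IsClosed C → (∀ g ∈ L, ∀ ξ ∈ C, g • ξ ∈ C) →
    (∀ g ∈ closure (L : Set (X ≃ᵢ X)), (∀ ξ ∈ C, g • ξ = ξ) → g = 1) ∧
    IsClosed (imageInHomeo (closure (L : Set (X ≃ᵢ X))) C)

/-! ### Lattices -/

/-- A uniform lattice: a discrete cocompact subgroup. -/
structure IsUniformLattice {G : Type*} [Group G] [TopologicalSpace G] (Γ : Subgroup G) :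
    Prop where
  discrete : DiscreteTopology Γ
  cocompact : CompactSpace (G ⧸ Γ)

/-- A subgroup of a product is irreducible if its projection to each factor is dense. -/
def IsIrreducible {n : ℕ} {G : Fin n → Type*} [∀ i, Group (G i)] [∀ i, TopologicalSpace (G i)]
    (Γ : Subgroup (∀ i, G i)) : Prop :=
  ∀ i, Dense ((fun g : ∀ j, G j => g i) '' (Γ : Set (∀ j, G j)))

end SplitRigidity

/-! The group `G` acts by right translations on the space `L2Map` of `Γ`-equivariant maps `G → X`
that are square-integrable on a fundamental domain `D`. This space is complete and inherits
midpoints and the `CN` inequality from `X`, so nearest points, circumcentres and minimisation of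
convex functions are available there. A map fixed by all of `G` is almost everywhere constant with a
value fixed by `Γ`, which is impossible when the image of `Γ` is unbounded.

Write `G = A × B` with `B` one of the factors, and let `S` be a non-empty closed convex
`B`-invariant set of maps. Minimise over `S` the mean square displacement by `A` (`energy`). If the
minimum were not attained, a sequence in `S` would escape to infinity while its displacements stay
bounded over compact subsets of `G`. It would then stay close to maps constant on `D`, whose values
are an unbounded sequence in `X` moved boundedly by each element of `Γ`
(`bounded_of_lintegral_displacement`). So `Γ` would fix a point of `∂X`, and indecomposability
applied to that single point would make the image of `Γ` trivial. Hence minimisers exist. Equality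
in the convexity of the energy makes the pointwise distance of two minimisers `A`-invariant; it is
also `Γ`-invariant and `Γ` projects densely to `B`, so it is constant (`ae_dist_eq_const`).

If `B` has a bounded orbit of minimisers, a circumcentre is a map in `S` fixed by `B`. Otherwise
evaluation at one generic point sends countably many minimisers, isometrically up to scale, onto an
unbounded midpoint-closed subset of `X` on which `Γ` acts, up to bounded error, through its
projection to `B`. The points at infinity of its closure form a closed `Γ`-invariant set, on which
`γ` tends uniformly to the identity as its projection to `B` tends to `1`. Indecomposability and
Baire's theorem upgrade this to convergence in the isometry group (`IsIndecomposable.tendsto_one`),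
and density of the projection extends `τ` through `B` (`exists_extension`).

The maps fixed by the factors already treated form a closed convex set that the next factor
preserves. So if no factor gave continuity, some map would be fixed by all of `G`. The second
countability needed for the measure theory is obtained by dividing each factor by a small compact
normal subgroup. -/

namespace SplitRigidity

open scoped NNReal ENNReal Topology Pointwise
open Filter Topology MeasureTheory

set_option linter.unusedSectionVars false

/-! ### Midpoint maps satisfying the `CN` inequality -/

/-- `mid` is a midpoint map for which the Bruhat–Tits `CN` inequality holds. -/
structure IsMidpointMap {Y : Type*} [PseudoMetricSpace Y] (mid : Y → Y → Y) : Prop where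
  cn : ∀ x y z, 2 * dist (mid x y) z ^ 2 + 1 / 2 * dist x y ^ 2 ≤ dist x z ^ 2 + dist y z ^ 2

namespace IsMidpointMap

variable {Y : Type*} [PseudoMetricSpace Y] {mid : Y → Y → Y}

/-- `CN` at each of the two points bounds both halves by `dist x y / 2`, and the triangle inequality
leaves no slack. -/
theorem dist_left (h : IsMidpointMap mid) (x y : Y) : dist (mid x y) x = dist x y / 2 := by
  have h1 := h.cn x y x
  have h2 := h.cn x y y
  rw [dist_self, dist_comm y x] at h1
  rw [dist_self] at h2
  have a1 : dist (mid x y) x ≤ dist x y / 2 :=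
    abs_le_of_sq_le_sq' (by nlinarith) (by positivity) |>.2
  have a2 : dist (mid x y) y ≤ dist x y / 2 :=
    abs_le_of_sq_le_sq' (by nlinarith) (by positivity) |>.2
  have := dist_triangle_left x y (mid x y)
  linarith

theorem dist_right (h : IsMidpointMap mid) (x y : Y) : dist (mid x y) y = dist x y / 2 := by
  have h1 := h.dist_left x y
  have h2 := h.cn x y y
  rw [dist_self] at h2
  have a2 : dist (mid x y) y ≤ dist x y / 2 :=
    abs_le_of_sq_le_sq' (by nlinarith) (by positivity) |>.2
  have := dist_triangle_left x y (mid x y)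
  linarith

/-- The sum of the squares of the diagonals of a quadrilateral is at most the sum of the squares
of its sides. -/
theorem quadrilateral (h : IsMidpointMap mid) (p q r s : Y) :
    dist p r ^ 2 + dist q s ^ 2 ≤ dist p q ^ 2 + dist q r ^ 2 + dist r s ^ 2 + dist s p ^ 2 := by
  have h1 := h.cn p r q
  have h2 := h.cn p r s
  have h3 := dist_triangle_left q s (mid p r)
  have h4 : dist q s ^ 2 ≤ 2 * dist (mid p r) q ^ 2 + 2 * dist (mid p r) s ^ 2 := by
    have := pow_le_pow_left₀ dist_nonneg h3 2
    nlinarith [sq_nonneg (dist (mid p r) q - dist (mid p r) s)]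
  rw [dist_comm r q] at h1
  rw [dist_comm p s] at h2
  linarith

theorem dist_mid_mid_sq (h : IsMidpointMap mid) (p p' q q' : Y) :
    dist (mid p p') (mid q q') ^ 2 + 1 / 4 * dist p p' ^ 2 + 1 / 4 * dist q q' ^ 2 ≤
      1 / 4 * (dist p q ^ 2 + dist p q' ^ 2 + dist p' q ^ 2 + dist p' q' ^ 2) := by
  have h1 := h.cn p p' (mid q q')
  have h2 := h.cn q q' p
  have h3 := h.cn q q' p'
  rw [dist_comm _ p, dist_comm q p, dist_comm q' p] at h2
  rw [dist_comm _ p', dist_comm q p', dist_comm q' p'] at h3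
  linarith

/-- The comparison passes through `mid q p'`, which reduces it to two triangles, each with a
degenerate side in `dist_mid_mid_sq`. -/
theorem dist_mid_mid (h : IsMidpointMap mid) (p p' q q' : Y) :
    dist (mid p p') (mid q q') ≤ (dist p q + dist p' q') / 2 := by
  have h1 := h.dist_mid_mid_sq p p' q p'
  have h2 := h.dist_mid_mid_sq q p' q q'
  have a1 : dist (mid p p') (mid q p') ≤ dist p q / 2 :=
    abs_le_of_sq_le_sq' (by rw [dist_self, dist_comm p' q] at h1; nlinarith) (by positivity) |>.2
  have a2 : dist (mid q p') (mid q q') ≤ dist p' q' / 2 :=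
    abs_le_of_sq_le_sq' (by rw [dist_self, dist_comm p' q] at h2; nlinarith) (by positivity) |>.2
  have := dist_triangle (mid p p') (mid q p') (mid q q')
  linarith

theorem continuous_uncurry (h : IsMidpointMap mid) :
    Continuous fun p : Y × Y => mid p.1 p.2 := by
  have : LipschitzWith 1 fun p : Y × Y => mid p.1 p.2 := by
    refine LipschitzWith.of_dist_le_mul fun p q => ?_
    have h1 := h.dist_mid_mid p.1 p.2 q.1 q.2
    have h2 : dist p.1 q.1 ≤ dist p q := le_max_left _ _
    have h3 : dist p.2 q.2 ≤ dist p q := le_max_right _ _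
    simp only [NNReal.coe_one, one_mul]
    linarith
  exact this.continuous

/-- A continuous uniformly convex functional that is bounded below attains its minimum on a
closed convex set of a complete space. -/
theorem exists_minimizer [CompleteSpace Y] {S : Set Y} (hne : S.Nonempty)
    (hcl : IsClosed S) (hmid : ∀ x ∈ S, ∀ y ∈ S, mid x y ∈ S) (Φ : Y → ℝ) (hΦ : Continuous Φ)
    (hpos : ∀ y, 0 ≤ Φ y)
    (hconv : ∀ x y, Φ (mid x y) + 1 / 4 * dist x y ^ 2 ≤ 1 / 2 * Φ x + 1 / 2 * Φ y) :
    ∃ m ∈ S, ∀ s ∈ S, Φ m + 1 / 2 * dist m s ^ 2 ≤ Φ s := by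
  have hbdd : BddBelow (Φ '' S) := ⟨0, by rintro _ ⟨y, -, rfl⟩; exact hpos y⟩
  set e := sInf (Φ '' S) with he
  have hle : ∀ s ∈ S, e ≤ Φ s := fun s hs => csInf_le hbdd ⟨s, hs, rfl⟩
  have hex : ∀ k : ℕ, ∃ s ∈ S, Φ s < e + 1 / ((k : ℝ) + 1) := fun k => by
    obtain ⟨_, ⟨s, hs, rfl⟩, hlt⟩ :=
      exists_lt_of_csInf_lt (hne.image Φ) (lt_add_of_pos_right e (Nat.one_div_pos_of_nat (n := k)))
    exact ⟨s, hs, hlt⟩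
  choose s hs hlt using hex
  -- The midpoint of two near-minimisers cannot go below the infimum, so uniform convexity forces
  -- them to be close.
  have hd : ∀ k l, dist (s k) (s l) ^ 2 ≤ 2 * (1 / ((k : ℝ) + 1) + 1 / ((l : ℝ) + 1)) := by
    intro k l
    have h1 := hconv (s k) (s l)
    have h2 := hle _ (hmid _ (hs k) _ (hs l))
    have h3 := hlt k
    have h4 := hlt l
    linarith
  have hcau : CauchySeq s := by
    rw [Metric.cauchySeq_iff']
    intro ε hε
    obtain ⟨N, hN⟩ := exists_nat_one_div_lt (show (0 : ℝ) < ε ^ 2 / 4 by positivity)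
    refine ⟨N, fun n hn => ?_⟩
    have h1 := hd n N
    have h2 : 1 / ((n : ℝ) + 1) ≤ 1 / ((N : ℝ) + 1) := Nat.one_div_le_one_div hn
    exact abs_lt_of_sq_lt_sq' (by linarith) hε.le |>.2
  obtain ⟨m, hm⟩ := cauchySeq_tendsto_of_complete hcau
  have hmS : m ∈ S := hcl.mem_of_tendsto hm (Filter.Eventually.of_forall hs)
  have hΦm : Φ m ≤ e := by
    have h1 : Filter.Tendsto (fun k => Φ (s k)) Filter.atTop (nhds (Φ m)) :=
      (hΦ.tendsto m).comp hm
    have h2 : Filter.Tendsto (fun k : ℕ => e + 1 / ((k : ℝ) + 1)) Filter.atTop (nhds (e + 0)) :=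
      tendsto_const_nhds.add tendsto_one_div_add_atTop_nhds_zero_nat
    simpa using le_of_tendsto_of_tendsto' h1 h2 fun k => (hlt k).le
  refine ⟨m, hmS, fun x hx => ?_⟩
  have h1 := hconv m x
  have h2 := hle _ (hmid _ hmS _ hx)
  linarith

/-- Nearest points on closed convex sets. -/
theorem exists_projection [CompleteSpace Y] (h : IsMidpointMap mid) {S : Set Y}
    (hne : S.Nonempty) (hcl : IsClosed S) (hmid : ∀ x ∈ S, ∀ y ∈ S, mid x y ∈ S) (p : Y) :
    ∃ m ∈ S, ∀ s ∈ S, dist p m ^ 2 + 3 / 4 * dist m s ^ 2 ≤ dist p s ^ 2 := by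
  obtain ⟨m, hm, hmin⟩ := exists_minimizer (mid := mid) hne hcl hmid (fun y => dist p y ^ 2)
    (by fun_prop) (fun y => by positivity) (fun x y => by
      have := h.cn x y p
      simp only [dist_comm p]
      linarith)
  refine ⟨m, hm, fun s hs => ?_⟩
  -- Testing minimality at the midpoint instead of at `s` improves the constant from `1/2` to `3/4`;
  -- the Lipschitz estimate for projections needs a constant above `1/2`.
  have h1 := hmin _ (hmid m hm s hs)
  have h2 := h.cn m s p
  have h3 := h.dist_left m s
  simp only [dist_comm p] at *
  rw [dist_comm m (mid m s), h3] at h1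
  nlinarith

/-- Nearest point projections are Lipschitz. -/
theorem projection_lipschitz (h : IsMidpointMap mid) {S : Set Y} {p q m n : Y}
    (hm : m ∈ S) (hn : n ∈ S)
    (hpm : ∀ s ∈ S, dist p m ^ 2 + 3 / 4 * dist m s ^ 2 ≤ dist p s ^ 2)
    (hqn : ∀ s ∈ S, dist q n ^ 2 + 3 / 4 * dist n s ^ 2 ≤ dist q s ^ 2) :
    dist m n ^ 2 ≤ 2 * dist p q ^ 2 := by
  have h1 := hpm n hn
  have h2 := hqn m hm
  have h3 := h.quadrilateral p m n q
  rw [dist_comm q m] at h2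
  rw [dist_comm n m] at h2
  rw [dist_comm n q, dist_comm q p] at h3
  linarith

/-- A decreasing sequence of closed convex sets has a common point as soon as the distances of
its members to some point are bounded. -/
theorem exists_mem_iInter [CompleteSpace Y] {S : ℕ → Set Y} (hanti : Antitone S)
    (hcl : ∀ k, IsClosed (S k)) {p : Y} {m : ℕ → Y} (hmS : ∀ k, m k ∈ S k)
    (hm : ∀ k, ∀ s ∈ S k, dist p (m k) ^ 2 + 3 / 4 * dist (m k) s ^ 2 ≤ dist p s ^ 2)
    {R : ℝ} (hR : ∀ k, dist p (m k) ≤ R) : ∃ y, ∀ k, y ∈ S k := by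
  -- The distances to the projections increase and are bounded, hence converge; the projection
  -- inequality then makes the projections Cauchy.
  have hinc : Monotone fun k => dist p (m k) ^ 2 := fun k l hkl => by
    have := hm k (m l) (hanti hkl (hmS l))
    have h0 : 0 ≤ 3 / 4 * dist (m k) (m l) ^ 2 := by positivity
    simp only
    linarith
  have hbdd : BddAbove (Set.range fun k => dist p (m k) ^ 2) :=
    ⟨R ^ 2, by rintro _ ⟨k, rfl⟩; exact pow_le_pow_left₀ dist_nonneg (hR k) 2⟩
  have hlim := tendsto_atTop_ciSup hinc hbdd
  have hcau : CauchySeq m := by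
    rw [Metric.cauchySeq_iff']
    intro ε hε
    obtain ⟨N, hN⟩ := Metric.cauchySeq_iff'.1 hlim.cauchySeq (ε ^ 2 / 2) (by positivity)
    refine ⟨N, fun n hn => ?_⟩
    have h1 := hm N (m n) (hanti hn (hmS n))
    have h2 := (abs_lt.1 (Real.dist_eq _ _ ▸ hN n hn)).2
    rw [dist_comm]
    exact abs_lt_of_sq_lt_sq' (by nlinarith) hε.le |>.2
  obtain ⟨y, hy⟩ := cauchySeq_tendsto_of_complete hcau
  exact ⟨y, fun k => (hcl k).mem_of_tendsto hy <|
    Filter.eventually_atTop.2 ⟨k, fun l hl => hanti hl (hmS l)⟩⟩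

/-- A bounded orbit of a group of isometries in a closed convex set yields a fixed point, in the
pseudo-metric sense. -/
theorem exists_fixed_of_bounded_orbit [CompleteSpace Y] (h : IsMidpointMap mid) {B : Type*}
    [Group B] [MulAction B Y] (hiso : ∀ (b : B) (x y : Y), dist (b • x) (b • y) = dist x y)
    {S : Set Y} (hcl : IsClosed S) (hmid : ∀ x ∈ S, ∀ y ∈ S, mid x y ∈ S)
    (hinv : ∀ (b : B), ∀ x ∈ S, b • x ∈ S) {v : Y} (hv : v ∈ S) {R : ℝ}
    (hR : ∀ b : B, dist v (b • v) ≤ R) : ∃ y ∈ S, ∀ b : B, dist y (b • y) = 0 := by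
  have hbd : ∀ y, BddAbove (Set.range fun b : B => dist y (b • v)) := fun y =>
    ⟨dist y v + R, by
      rintro _ ⟨b, rfl⟩
      exact (dist_triangle _ v _).trans (by linarith [hR b])⟩
  -- `r y` is the radius about `y` of the orbit of `v`. Its square is uniformly convex and invariant
  -- under the group, so its minimiser on `S`, the circumcentre, is fixed.
  set r : Y → ℝ := fun y => ⨆ b : B, dist y (b • v) with hr
  have hle : ∀ y b, dist y (b • v) ≤ r y := fun y b => le_ciSup (hbd y) b
  have hr0 : ∀ y, 0 ≤ r y := fun y => dist_nonneg.trans (hle y 1)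
  have hrlip : LipschitzWith 1 r := by
    refine LipschitzWith.of_le_add fun x y => ciSup_le fun b => ?_
    have := hle y b
    have := dist_triangle x y (b • v)
    linarith
  have hsq : ∀ y c, 0 ≤ c → (∀ b : B, dist y (b • v) ^ 2 ≤ c) → r y ^ 2 ≤ c := by
    intro y c hc hb
    have : r y ≤ √c := ciSup_le fun b => Real.le_sqrt_of_sq_le (hb b)
    calc r y ^ 2 ≤ √c ^ 2 := pow_le_pow_left₀ (hr0 y) this 2
      _ = c := Real.sq_sqrt hc
  have hconv : ∀ x y, r (mid x y) ^ 2 + 1 / 4 * dist x y ^ 2 ≤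
      1 / 2 * r x ^ 2 + 1 / 2 * r y ^ 2 := by
    intro x y
    have key : ∀ b : B, dist (mid x y) (b • v) ^ 2 ≤
        1 / 2 * r x ^ 2 + 1 / 2 * r y ^ 2 - 1 / 4 * dist x y ^ 2 := fun b => by
      have h1 := h.cn x y (b • v)
      have h2 := pow_le_pow_left₀ dist_nonneg (hle x b) 2
      have h3 := pow_le_pow_left₀ dist_nonneg (hle y b) 2
      linarith
    have := hsq _ _ ((sq_nonneg _).trans (key 1)) key
    linarith
  obtain ⟨m, hm, hmin⟩ := exists_minimizer ⟨v, hv⟩ hcl hmid (fun y => r y ^ 2)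
    (hrlip.continuous.pow 2) (fun y => sq_nonneg _) hconv
  refine ⟨m, hm, fun b => ?_⟩
  have h1 := hmin _ (hinv b m hm)
  have h2 : r (b • m) ≤ r m := ciSup_le fun c => by
    have : dist (b • m) (c • v) = dist m ((b⁻¹ * c) • v) := by
      rw [← hiso b m, smul_smul, mul_inv_cancel_left]
    rw [this]
    exact hle _ _
  have h3 := pow_le_pow_left₀ (hr0 _) h2 2
  have h4 : dist m (b • m) ^ 2 ≤ 0 := by linarith
  exact pow_eq_zero_iff two_ne_zero |>.1 (le_antisymm h4 (sq_nonneg _))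

end IsMidpointMap

/-! ### Convexity of the metric of a CAT(0) space -/

namespace IsCAT0

variable {X : Type*} [MetricSpace X]

/-- The midpoint of two points. -/
noncomputable def mid (hX : IsCAT0 X) (x y : X) : X :=
  (hX.exists_geodesic x y).choose (dist x y / 2)

theorem isMidpointMap (hX : IsCAT0 X) : IsMidpointMap hX.mid where
  cn x y z := by
    have := hX.cn z x y _ (hX.exists_geodesic x y).choose_spec
    rw [dist_comm y x] at this
    unfold mid
    linarith

theorem eq_mid (hX : IsCAT0 X) {x y m : X} (h1 : dist x m ≤ dist x y / 2)
    (h2 : dist y m ≤ dist x y / 2) : m = hX.mid x y := by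
  have h := hX.isMidpointMap.cn x y m
  have a1 := pow_le_pow_left₀ dist_nonneg h1 2
  have a2 := pow_le_pow_left₀ dist_nonneg h2 2
  have : dist (hX.mid x y) m ^ 2 ≤ 0 := by nlinarith
  exact (dist_eq_zero.1 (pow_eq_zero_iff two_ne_zero |>.1 (le_antisymm this (sq_nonneg _)))).symm

theorem map_mid (hX : IsCAT0 X) (g : X ≃ᵢ X) (x y : X) :
    g (hX.mid x y) = hX.mid (g x) (g y) := by
  refine hX.eq_mid ?_ ?_
  · rw [g.dist_eq, g.dist_eq, dist_comm, hX.isMidpointMap.dist_left]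
  · rw [g.dist_eq, g.dist_eq, dist_comm, hX.isMidpointMap.dist_right]

end IsCAT0

/-- `σ` is a linearly reparametrized geodesic segment on `[0, 1]`. -/
def IsUnitGeodesic {X : Type*} [MetricSpace X] (σ : ℝ → X) : Prop :=
  ∀ s ∈ Set.Icc (0 : ℝ) 1, ∀ t ∈ Set.Icc (0 : ℝ) 1,
    dist (σ s) (σ t) = |s - t| * dist (σ 0) (σ 1)

/-! ### Comparison inequalities along geodesic segments -/

namespace IsCAT0

variable {X : Type*} [MetricSpace X]

theorem exists_unitGeodesic (hX : IsCAT0 X) (x y : X) :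
    ∃ σ : ℝ → X, σ 0 = x ∧ σ 1 = y ∧ IsUnitGeodesic σ := by
  obtain ⟨σ, h0, h1, h⟩ := hX.exists_geodesic x y
  refine ⟨fun s => σ (s * dist x y), by simpa using h0, by simpa using h1, ?_⟩
  intro s hs t ht
  have aux : ∀ u ∈ Set.Icc (0 : ℝ) 1, u * dist x y ∈ Set.Icc 0 (dist x y) := fun u hu =>
    ⟨mul_nonneg hu.1 dist_nonneg, mul_le_of_le_one_left dist_nonneg hu.2⟩
  simp only [zero_mul, one_mul, h0, h1]
  rw [h _ (aux s hs) _ (aux t ht), ← sub_mul, abs_mul, abs_of_nonneg (dist_nonneg (x := x))]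

/-- The `CN` inequality at an arbitrary point of a geodesic segment. -/
theorem cn_unitGeodesic (hX : IsCAT0 X) {σ : ℝ → X} (hσ : IsUnitGeodesic σ) (z : X) {s : ℝ}
    (hs : s ∈ Set.Icc (0 : ℝ) 1) :
    dist (σ s) z ^ 2 ≤ (1 - s) * dist (σ 0) z ^ 2 + s * dist (σ 1) z ^ 2
      - s * (1 - s) * dist (σ 0) (σ 1) ^ 2 := by
  set L := dist (σ 0) (σ 1) with hL
  have hL0 : 0 ≤ L := dist_nonneg
  set f : ℝ → ℝ := fun s => dist (σ s) z ^ 2 - ((1 - s) * dist (σ 0) z ^ 2 + s * dist (σ 1) z ^ 2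
      - s * (1 - s) * L ^ 2) with hf
  have hσc : ContinuousOn σ (Set.Icc 0 1) := by
    have : LipschitzOnWith ⟨L, hL0⟩ σ (Set.Icc 0 1) :=
      LipschitzOnWith.of_dist_le_mul fun s hs t ht => by
        rw [hσ s hs t ht, mul_comm, Real.dist_eq]; rfl
    exact this.continuousOn
  have hfc : ContinuousOn f (Set.Icc 0 1) := by
    refine ContinuousOn.sub (((continuous_id.dist continuous_const).comp_continuousOn hσc).pow 2) ?_
    exact Continuous.continuousOn (by fun_prop)
  have hmid : ∀ s ∈ Set.Icc (0 : ℝ) 1, ∀ t ∈ Set.Icc (0 : ℝ) 1,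
      f ((s + t) / 2) ≤ (f s + f t) / 2 := by
    intro s hs t ht
    have hm : (s + t) / 2 ∈ Set.Icc (0 : ℝ) 1 :=
      ⟨by linarith [hs.1, ht.1], by linarith [hs.2, ht.2]⟩
    have e1 : dist (σ s) (σ t) = |s - t| * L := hσ s hs t ht
    have e2 : dist (σ s) (σ ((s + t) / 2)) = |s - t| * L / 2 := by
      rw [hσ s hs _ hm, show s - (s + t) / 2 = (s - t) / 2 by ring, abs_div, abs_two]; ring
    have e3 : dist (σ t) (σ ((s + t) / 2)) = |s - t| * L / 2 := by
      rw [hσ t ht _ hm, show t - (s + t) / 2 = -((s - t) / 2) by ring, abs_neg, abs_div, abs_two]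
      ring
    have e4 : σ ((s + t) / 2) = hX.mid (σ s) (σ t) :=
      hX.eq_mid (by rw [e1, e2]) (by rw [e1, e3])
    have h1 := hX.isMidpointMap.cn (σ s) (σ t) z
    rw [← e4, e1, mul_pow, sq_abs] at h1
    simp only [hf]
    nlinarith
  obtain ⟨m, hm, hmax⟩ := isCompact_Icc.exists_isMaxOn (Set.nonempty_Icc.2 zero_le_one) hfc
  have hf0 : f 0 = 0 := by simp [hf]
  have hf1 : f 1 = 0 := by simp [hf]
  -- The maximum point `m` is the midpoint of an endpoint, where `f` vanishes, and another point of
  -- the interval, so `f m ≤ f m / 2`.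
  have hm0 : f m ≤ 0 := by
    rcases le_total m (1 / 2) with h | h
    · have h2 : 2 * m ∈ Set.Icc (0 : ℝ) 1 := ⟨by linarith [hm.1], by linarith⟩
      have h3 := hmid 0 ⟨le_rfl, zero_le_one⟩ _ h2
      have h4 : f (2 * m) ≤ f m := hmax h2
      rw [show (0 + 2 * m) / 2 = m by ring] at h3
      linarith
    · have h2 : 2 * m - 1 ∈ Set.Icc (0 : ℝ) 1 := ⟨by linarith, by linarith [hm.2]⟩
      have h3 := hmid _ h2 1 ⟨zero_le_one, le_rfl⟩
      have h4 : f (2 * m - 1) ≤ f m := hmax h2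
      rw [show (2 * m - 1 + 1) / 2 = m by ring] at h3
      linarith
  have : f s ≤ 0 := (hmax hs).trans hm0
  simp only [hf] at this
  linarith

/-- Reshetnyak's quadrilateral inequality. -/
theorem reshetnyak (hX : IsCAT0 X) (p p' q q' : X) :
    dist p q' ^ 2 + dist p' q ^ 2 ≤
      dist p q ^ 2 + dist p' q' ^ 2 + 2 * dist p p' * dist q q' := by
  set s := dist p p' with hs
  set t := dist q q' with ht
  have hs0 : 0 ≤ s := dist_nonneg
  have ht0 : 0 ≤ t := dist_nonneg
  set br : X → X → X → X → ℝ := fun a a' c c' =>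
    dist a c' ^ 2 + dist a' c ^ 2 - dist a c ^ 2 - dist a' c' ^ 2 with hbr
  have hweak : ∀ a a' c c', br a a' c c' ≤ dist a a' ^ 2 + dist c c' ^ 2 := fun a a' c c' => by
    have := hX.isMidpointMap.quadrilateral a a' c' c
    simp only [hbr]
    rw [dist_comm c' c, dist_comm c a] at this
    linarith
  -- `br` is additive under subdivision of either segment. Cutting into `N` and `M` pieces and
  -- applying `hweak` to each cell gives the bound for `r = M / N`; continuity extends it to real
  -- `r`, and `r` close to `t / s` produces `2 * s * t`.
  suffices hr : ∀ r : ℝ, 0 < r → br p p' q q' ≤ s ^ 2 * r + t ^ 2 / r by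
    have hgoal : br p p' q q' ≤ 2 * s * t := by
      refine le_of_forall_pos_le_add fun ε hε => ?_
      have hden : 0 < s + ε := by linarith
      -- Adding `η` to both lengths keeps the ratio meaningful when `s` or `t` vanishes.
      set η := min 1 (ε / (s + t + 2)) with hη
      have hη0 : 0 < η := lt_min one_pos (by positivity)
      have hη1 : η ≤ 1 := min_le_left _ _
      have hη2 : η * (s + t + 2) ≤ ε := by
        have := min_le_right 1 (ε / (s + t + 2))
        rwa [← hη, le_div_iff₀ (by positivity)] at this
      have h1 := hr ((t + η) / (s + η)) (by positivity)
      have h2 : s ^ 2 * ((t + η) / (s + η)) ≤ s * (t + η) := by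
        rw [← mul_div_assoc, div_le_iff₀ (by positivity)]
        nlinarith [mul_nonneg (mul_nonneg hs0 hη0.le) (add_nonneg ht0 hη0.le)]
      have h3 : t ^ 2 / ((t + η) / (s + η)) ≤ t * (s + η) := by
        rw [div_div_eq_mul_div, div_le_iff₀ (by positivity)]
        nlinarith [mul_nonneg (mul_nonneg ht0 hη0.le) (add_nonneg hs0 hη0.le)]
      nlinarith
    simp only [hbr] at hgoal
    linarith
  have hrat : ∀ N M : ℕ, 0 < N → 0 < M →
      br p p' q q' ≤ s ^ 2 * ((M : ℝ) / N) + t ^ 2 / ((M : ℝ) / N) := by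
    intro N M hN hM
    have hN' : (0 : ℝ) < N := by exact_mod_cast hN
    have hM' : (0 : ℝ) < M := by exact_mod_cast hM
    obtain ⟨σ, hσ0, hσ1, hσ⟩ := hX.exists_unitGeodesic p p'
    obtain ⟨ρ, hρ0, hρ1, hρ⟩ := hX.exists_unitGeodesic q q'
    have hin : ∀ (K i : ℕ), 0 < K → i ≤ K → (i : ℝ) / K ∈ Set.Icc (0 : ℝ) 1 := fun K i hK hi =>
      ⟨by positivity, div_le_one_of_le₀ (by exact_mod_cast hi) (by positivity)⟩
    have hstep : ∀ (K i : ℕ), 0 < K → |(i : ℝ) / K - ((i + 1 : ℕ) : ℝ) / K| = 1 / K := by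
      intro K i hK
      rw [← sub_div]
      push_cast
      rw [show (i : ℝ) - (i + 1) = -1 by ring, abs_div, abs_neg, abs_one, abs_of_nonneg (by positivity)]
    have hsum : br p p' q q' = ∑ i ∈ Finset.range N, ∑ j ∈ Finset.range M,
        br (σ ((i : ℝ) / N)) (σ (((i + 1 : ℕ) : ℝ) / N))
          (ρ ((j : ℝ) / M)) (ρ (((j + 1 : ℕ) : ℝ) / M)) := by
      have inner : ∀ a a', ∑ j ∈ Finset.range M, br a a' (ρ ((j : ℝ) / M))
          (ρ (((j + 1 : ℕ) : ℝ) / M)) = br a a' q q' := by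
        intro a a'
        have := Finset.sum_range_sub
          (fun j : ℕ => dist a (ρ ((j : ℝ) / M)) ^ 2 - dist a' (ρ ((j : ℝ) / M)) ^ 2) M
        rw [div_self hM'.ne', hρ1, Nat.cast_zero, zero_div, hρ0] at this
        simp only [hbr]
        rw [Finset.sum_congr rfl (g := fun j : ℕ =>
          (dist a (ρ (((j + 1 : ℕ) : ℝ) / M)) ^ 2 - dist a' (ρ (((j + 1 : ℕ) : ℝ) / M)) ^ 2) -
          (dist a (ρ ((j : ℝ) / M)) ^ 2 - dist a' (ρ ((j : ℝ) / M)) ^ 2))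
          (fun j _ => by ring), this]
        ring
      simp only [inner]
      have := Finset.sum_range_sub
        (fun i : ℕ => dist (σ ((i : ℝ) / N)) q ^ 2 - dist (σ ((i : ℝ) / N)) q' ^ 2) N
      rw [div_self hN'.ne', hσ1, Nat.cast_zero, zero_div, hσ0] at this
      simp only [hbr]
      rw [Finset.sum_congr rfl (g := fun i : ℕ =>
          (dist (σ (((i + 1 : ℕ) : ℝ) / N)) q ^ 2 - dist (σ (((i + 1 : ℕ) : ℝ) / N)) q' ^ 2) -
          (dist (σ ((i : ℝ) / N)) q ^ 2 - dist (σ ((i : ℝ) / N)) q' ^ 2))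
          (fun j _ => by ring), this]
      ring
    rw [hsum]
    calc _ ≤ ∑ i ∈ Finset.range N, ∑ j ∈ Finset.range M, ((s / N) ^ 2 + (t / M) ^ 2) := by
          refine Finset.sum_le_sum fun i hi => Finset.sum_le_sum fun j hj => ?_
          refine (hweak _ _ _ _).trans (le_of_eq ?_)
          have hi' := Finset.mem_range.1 hi
          have hj' := Finset.mem_range.1 hj
          rw [hσ _ (hin N i hN hi'.le) _ (hin N (i + 1) hN hi'),
            hρ _ (hin M j hM hj'.le) _ (hin M (j + 1) hM hj'), hstep N i hN, hstep M j hM,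
            hσ0, hσ1, hρ0, hρ1]
          ring
      _ = _ := by
          simp only [Finset.sum_const, Finset.card_range, nsmul_eq_mul]
          field_simp
  intro r hr
  by_contra! hlt
  have hcont : ContinuousAt (fun r : ℝ => s ^ 2 * r + t ^ 2 / r) r :=
    (continuousAt_const.mul continuousAt_id).add (continuousAt_const.div continuousAt_id hr.ne')
  have hev := (hcont.eventually_lt continuousAt_const hlt).and (eventually_gt_nhds hr)
  obtain ⟨l, u, hlu, hsub⟩ := mem_nhds_iff_exists_Ioo_subset.1 hev
  obtain ⟨a, ha1, ha2⟩ := exists_rat_btwn (hlu.1.trans hlu.2)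
  obtain ⟨h1, h2⟩ := hsub ⟨ha1, ha2⟩
  have ha0 : (0 : ℚ) < a := by exact_mod_cast h2
  have := hrat a.den a.num.toNat a.den_pos (by simpa using ha0)
  have e : ((a.num.toNat : ℕ) : ℝ) / a.den = (a : ℝ) := by
    have h3 : ((a.num.toNat : ℕ) : ℤ) = a.num := Int.toNat_of_nonneg (Rat.num_nonneg.2 ha0.le)
    have h4 : ((a.num.toNat : ℕ) : ℝ) = (a.num : ℝ) := by exact_mod_cast h3
    rw [h4]
    exact (Rat.cast_def a).symm
  rw [e] at this
  linarith

/-- Comparison of two geodesic segments. -/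
theorem dist_unitGeodesic_sq (hX : IsCAT0 X) {σ ρ : ℝ → X} (hσ : IsUnitGeodesic σ)
    (hρ : IsUnitGeodesic ρ) {s : ℝ} (hs : s ∈ Set.Icc (0 : ℝ) 1) :
    dist (σ s) (ρ s) ^ 2 ≤ (1 - s) * dist (σ 0) (ρ 0) ^ 2 + s * dist (σ 1) (ρ 1) ^ 2
      - s * (1 - s) * (dist (σ 0) (σ 1) - dist (ρ 0) (ρ 1)) ^ 2 := by
  -- `CN` along `σ`, then along `ρ` as seen from both ends of `σ`, leaves the two diagonals with the
  -- common weight `s * (1 - s)`; Reshetnyak's inequality removes them.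
  have h1 := hX.cn_unitGeodesic hσ (ρ s) hs
  have h2 := hX.cn_unitGeodesic hρ (σ 0) hs
  have h3 := hX.cn_unitGeodesic hρ (σ 1) hs
  have h4 := hX.reshetnyak (σ 0) (σ 1) (ρ 0) (ρ 1)
  rw [dist_comm _ (σ 0), dist_comm _ (σ 0), dist_comm _ (σ 0)] at h2
  rw [dist_comm _ (σ 1), dist_comm _ (σ 1), dist_comm _ (σ 1)] at h3
  have hs0 := hs.1
  have hs1 : 0 ≤ 1 - s := by linarith [hs.2]
  have a2 := mul_le_mul_of_nonneg_left h2 hs1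
  have a3 := mul_le_mul_of_nonneg_left h3 hs0
  have a4 := mul_le_mul_of_nonneg_left h4 (mul_nonneg hs0 hs1)
  nlinarith

/-- Reshetnyak's inequality adds a defect term to the convexity of the squared distance: equality in
the latter forces the two segments to have the same length. -/
theorem dist_mid_mid_sq_add_le (hX : IsCAT0 X) (p p' q q' : X) :
    dist (hX.mid p p') (hX.mid q q') ^ 2 + 1 / 4 * (dist p p' - dist q q') ^ 2 ≤
      1 / 2 * dist p q ^ 2 + 1 / 2 * dist p' q' ^ 2 := by
  have h1 := hX.isMidpointMap.dist_mid_mid_sq p p' q q'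
  have h2 := hX.reshetnyak p p' q q'
  nlinarith

/-- The defect here is that between the square of a mean and the mean of the squares: equality
forces the endpoints of the two segments to be equally far apart. -/
theorem dist_mid_mid_sq_add_le' (hX : IsCAT0 X) (p p' q q' : X) :
    dist (hX.mid p p') (hX.mid q q') ^ 2 + 1 / 4 * (dist p q - dist p' q') ^ 2 ≤
      1 / 2 * dist p q ^ 2 + 1 / 2 * dist p' q' ^ 2 := by
  have h1 := hX.isMidpointMap.dist_mid_mid p p' q q'
  have h2 := pow_le_pow_left₀ dist_nonneg h1 2
  nlinarith

end IsCAT0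

/-! ### Geodesic rays and the cone topology -/

section Rays

variable {X : Type*} [MetricSpace X]

theorem GeodesicRay.ext {c c' : GeodesicRay X} (h : ∀ t, c.toFun t = c'.toFun t) : c = c' := by
  cases c; cases c'; congr; exact funext h

theorem GeodesicRay.dist_eq (c : GeodesicRay X) (s t : ℝ≥0) :
    dist (c.toFun s) (c.toFun t) = |(s : ℝ) - t| := by
  rw [c.isometry.dist_eq, NNReal.dist_eq]

theorem GeodesicRay.endpoint_eq_iff {c c' : GeodesicRay X} :
    c.endpoint = c'.endpoint ↔ ∃ K : ℝ, ∀ t, dist (c.toFun t) (c'.toFun t) ≤ K :=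
  Quotient.eq (r := asymptotic X)

theorem GeodesicRay.smul_endpoint (g : X ≃ᵢ X) (c : GeodesicRay X) :
    g • c.endpoint = (c.translate g).endpoint := rfl

theorem GeodesicRay.isUnitGeodesic (c : GeodesicRay X) {t : ℝ} (ht : 0 ≤ t) :
    IsUnitGeodesic fun u : ℝ => c.toFun (u * t).toNNReal := by
  intro s hs u hu
  rw [c.dist_eq, c.dist_eq, Real.coe_toNNReal _ (mul_nonneg hs.1 ht),
    Real.coe_toNNReal _ (mul_nonneg hu.1 ht)]
  simp only [zero_mul, one_mul, Real.toNNReal_zero, NNReal.coe_zero, Real.coe_toNNReal t ht]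
  rw [← sub_mul, abs_mul, zero_sub, abs_neg]

/-- The distance between asymptotic rays is at most the distance between their origins. -/
theorem GeodesicRay.dist_le_of_asymptotic (hX : IsCAT0 X) {c c' : GeodesicRay X}
    (h : c.endpoint = c'.endpoint) (s : ℝ≥0) :
    dist (c.toFun s) (c'.toFun s) ≤ dist (c.toFun 0) (c'.toFun 0) := by
  obtain ⟨K, hK⟩ := GeodesicRay.endpoint_eq_iff.1 h
  set d0 := dist (c.toFun 0) (c'.toFun 0) with hd0
  -- Comparing the rays on `[0, t]` gives the far end, at distance at most `K`, only the weight `s /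
  -- t`, which vanishes as `t` grows.
  have key : ∀ t : ℝ, 0 < t → (s : ℝ) ≤ t →
      dist (c.toFun s) (c'.toFun s) ^ 2 ≤ d0 ^ 2 + (s / t) * K ^ 2 := by
    intro t ht hst
    have h1 := hX.dist_unitGeodesic_sq (c.isUnitGeodesic ht.le) (c'.isUnitGeodesic ht.le)
      (s := (s : ℝ) / t) ⟨by positivity, div_le_one_of_le₀ hst ht.le⟩
    simp only [div_mul_cancel₀ _ ht.ne', zero_mul, one_mul, Real.toNNReal_zero,
      Real.toNNReal_coe] at h1
    rw [c.dist_eq, c'.dist_eq, sub_self, zero_pow two_ne_zero, mul_zero, sub_zero] at h1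
    have h2 := pow_le_pow_left₀ dist_nonneg (hK t.toNNReal) 2
    have h3 : 0 ≤ (s : ℝ) / t := by positivity
    have h4 := mul_le_mul_of_nonneg_left h2 h3
    have h5 := mul_nonneg h3 (sq_nonneg d0)
    rw [← hd0] at h1
    linarith
  have hlim : Tendsto (fun t : ℝ => d0 ^ 2 + (s / t) * K ^ 2) atTop (𝓝 (d0 ^ 2 + 0 * K ^ 2)) :=
    tendsto_const_nhds.add ((tendsto_const_nhds.div_atTop tendsto_id).mul_const _)
  have hle : dist (c.toFun s) (c'.toFun s) ^ 2 ≤ d0 ^ 2 + 0 * K ^ 2 :=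
    ge_of_tendsto hlim <| (eventually_gt_atTop 0).and (eventually_ge_atTop (s : ℝ)) |>.mono
      fun t ht => key t ht.1 ht.2
  exact abs_le_of_sq_le_sq' (by linarith) dist_nonneg |>.2

theorem GeodesicRay.eq_of_asymptotic (hX : IsCAT0 X) {c c' : GeodesicRay X}
    (h : c.endpoint = c'.endpoint) (h0 : c.toFun 0 = c'.toFun 0) : c = c' :=
  GeodesicRay.ext fun t => dist_le_zero.1 <|
    (GeodesicRay.dist_le_of_asymptotic hX h t).trans (by rw [h0, dist_self])

variable [ProperSpace X]

/-- Pointwise limits of almost geodesic rays along an ultrafilter. -/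
theorem exists_ray_tendsto {κ : Type*} (𝓤 : Ultrafilter κ) (f : κ → ℝ≥0 → X) (x : X)
    (h0 : ∀ᶠ k in (𝓤 : Filter κ), f k 0 = x)
    (hf : ∀ s t, ∀ᶠ k in (𝓤 : Filter κ), dist (f k s) (f k t) = dist s t) :
    ∃ c : GeodesicRay X, c.toFun 0 = x ∧
      ∀ t, Tendsto (fun k => f k t) 𝓤 (𝓝 (c.toFun t)) := by
  have hlim : ∀ t, ∃ y, Tendsto (fun k => f k t) 𝓤 (𝓝 y) := fun t => by
    have hmem : ∀ᶠ k in (𝓤 : Filter κ), f k t ∈ Metric.closedBall x t := by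
      filter_upwards [h0, hf t 0] with k hk hk'
      rw [Metric.mem_closedBall, ← hk, hk', NNReal.dist_eq]
      simp
    obtain ⟨y, -, hy⟩ := (isCompact_closedBall x (t : ℝ)).ultrafilter_le_nhds (𝓤.map (f · t))
      (le_principal_iff.2 hmem)
    exact ⟨y, hy⟩
  choose c hc using hlim
  refine ⟨⟨c, Isometry.of_dist_eq fun s t => ?_⟩, ?_, hc⟩
  · refine tendsto_nhds_unique ((hc s).dist (hc t)) ?_
    exact tendsto_const_nhds.congr' ((hf s t).mono fun k hk => hk.symm)
  · exact tendsto_nhds_unique (hc 0) (tendsto_const_nhds.congr' (h0.mono fun k hk => hk.symm))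

/-- Geodesic segments from `x` to points that escape to infinity converge to a ray. -/
theorem exists_ray_of_segments {κ : Type*} (𝓤 : Ultrafilter κ) (x : X) (σ : κ → ℝ → X)
    (h0 : ∀ k, σ k 0 = x) (hσ : ∀ k, IsUnitGeodesic (σ k))
    (hlen : Tendsto (fun k => dist x (σ k 1)) 𝓤 atTop) :
    ∃ c : GeodesicRay X, c.toFun 0 = x ∧
      ∀ t : ℝ≥0, Tendsto (fun k => σ k (t / dist x (σ k 1))) 𝓤 (𝓝 (c.toFun t)) := by
  refine exists_ray_tendsto 𝓤 (fun k (t : ℝ≥0) => σ k (t / dist x (σ k 1))) x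
    (Eventually.of_forall fun k => by simp [h0]) fun s t => ?_
  filter_upwards [hlen.eventually_ge_atTop (s : ℝ), hlen.eventually_ge_atTop (t : ℝ),
    hlen.eventually_gt_atTop 0] with k hs ht hpos
  rw [hσ k _ ⟨by positivity, div_le_one_of_le₀ hs hpos.le⟩ _
    ⟨by positivity, div_le_one_of_le₀ ht hpos.le⟩, h0, ← sub_div, abs_div, abs_of_pos hpos,
    div_mul_cancel₀ _ hpos.ne', NNReal.dist_eq]

/-! ### Rays from a basepoint and the topology of the boundary -/

namespace IsCAT0

/-- For a ray `c'` and segments from `x` to `c' (k)`, the limit ray is asymptotic to `c'`. -/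
theorem exists_ray_segments_asymptotic (hX : IsCAT0 X) (x : X) (c' : GeodesicRay X)
    (σ : ℕ → ℝ → X) (h0 : ∀ k, σ k 0 = x) (h1 : ∀ k : ℕ, σ k 1 = c'.toFun k)
    (hσ : ∀ k, IsUnitGeodesic (σ k)) :
    ∃ c : GeodesicRay X, c.toFun 0 = x ∧ c.endpoint = c'.endpoint ∧
      ∀ t : ℝ≥0, Tendsto (fun k => σ k (t / dist x (σ k 1))) (hyperfilter ℕ) (𝓝 (c.toFun t)) := by
  set D := dist x (c'.toFun 0) with hD
  have hbd : ∀ k : ℕ, |(k : ℝ) - dist x (σ k 1)| ≤ D := fun k => by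
    have e : dist (c'.toFun 0) (c'.toFun k) = k := by rw [c'.dist_eq]; simp
    rw [h1, abs_le]
    have a1 := dist_triangle x (c'.toFun 0) (c'.toFun k)
    have a2 := dist_triangle_left (c'.toFun 0) (c'.toFun k) x
    constructor <;> linarith
  have hlen : Tendsto (fun k => dist x (σ k 1)) (hyperfilter ℕ) atTop := by
    refine tendsto_atTop_mono (f := fun k : ℕ => (k : ℝ) - D) (fun k => ?_) ?_
    · linarith [(abs_le.1 (hbd k)).2]
    · exact (tendsto_atTop_add_const_right _ (-D) tendsto_natCast_atTop_atTop).mono_left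
        (by simpa [Nat.cofinite_eq_atTop] using (hyperfilter_le_cofinite (α := ℕ)))
  obtain ⟨c, hc0, hc⟩ := exists_ray_of_segments (hyperfilter ℕ) x σ h0 hσ hlen
  refine ⟨c, hc0, GeodesicRay.endpoint_eq_iff.2 ⟨D + 1, fun t => ?_⟩, hc⟩
  refine le_of_tendsto ((hc t).dist tendsto_const_nhds) ?_
  filter_upwards [hlen.eventually_ge_atTop (t : ℝ), hlen.eventually_ge_atTop (t * D : ℝ),
    hlen.eventually_gt_atTop 0] with k ht htD hpos
  set L := dist x (σ k 1) with hL
  have hs : (t : ℝ) / L ∈ Set.Icc (0 : ℝ) 1 := ⟨by positivity, div_le_one_of_le₀ ht hpos.le⟩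
  have a1 := hX.dist_unitGeodesic_sq (hσ k) (c'.isUnitGeodesic (Nat.cast_nonneg k)) hs
  simp only [zero_mul, one_mul, Real.toNNReal_zero, Real.toNNReal_natCast, h0, h1, dist_self] at a1
  have a2 : dist (σ k (t / L)) (c'.toFun ((t : ℝ) / L * k).toNNReal) ≤ D := by
    refine abs_le_of_sq_le_sq' ?_ dist_nonneg |>.2
    have b1 := mul_nonneg hs.1 (sq_nonneg D)
    have b2 := mul_nonneg (mul_nonneg hs.1 (sub_nonneg.2 hs.2))
      (sq_nonneg (dist x (c'.toFun k) - dist (c'.toFun 0) (c'.toFun k)))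
    rw [← hD] at a1
    nlinarith
  -- The segment is parametrised by its length `L` and `c'` by `k`, which differ by at most `D`; the
  -- resulting time shift `t * D / L` is at most `1` once `L` is large.
  have a3 : dist (c'.toFun ((t : ℝ) / L * k).toNNReal) (c'.toFun t) ≤ 1 := by
    rw [c'.dist_eq, Real.coe_toNNReal _ (mul_nonneg hs.1 (Nat.cast_nonneg k)),
      show (t : ℝ) / L * k - t = t * (k - L) / L by field_simp, abs_div, abs_of_pos hpos,
      div_le_one hpos, abs_mul, abs_of_nonneg t.coe_nonneg]
    exact (mul_le_mul_of_nonneg_left (hbd k) t.coe_nonneg).trans htD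
  have := dist_triangle (σ k (t / L)) (c'.toFun ((t : ℝ) / L * k).toNNReal) (c'.toFun t)
  linarith

theorem exists_ray (hX : IsCAT0 X) (x : X) (ξ : Boundary X) :
    ∃ c : GeodesicRay X, c.toFun 0 = x ∧ c.endpoint = ξ := by
  induction ξ using Quotient.inductionOn with
  | h c' =>
    choose σ h0 h1 hσ using fun k : ℕ => hX.exists_unitGeodesic x (c'.toFun k)
    obtain ⟨c, hc0, hc, -⟩ := hX.exists_ray_segments_asymptotic x c' σ h0 h1 hσ
    exact ⟨c, hc0, hc⟩

/-- The ray from `x` to the boundary point `ξ`. -/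
noncomputable def ray (hX : IsCAT0 X) (x : X) (ξ : Boundary X) : GeodesicRay X :=
  (hX.exists_ray x ξ).choose

@[simp]
theorem ray_zero (hX : IsCAT0 X) (x : X) (ξ : Boundary X) : (hX.ray x ξ).toFun 0 = x :=
  (hX.exists_ray x ξ).choose_spec.1

@[simp]
theorem ray_endpoint (hX : IsCAT0 X) (x : X) (ξ : Boundary X) : (hX.ray x ξ).endpoint = ξ :=
  (hX.exists_ray x ξ).choose_spec.2

theorem eq_ray (hX : IsCAT0 X) {x : X} {ξ : Boundary X} {c : GeodesicRay X}
    (h0 : c.toFun 0 = x) (h : c.endpoint = ξ) : c = hX.ray x ξ :=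
  GeodesicRay.eq_of_asymptotic hX (by rw [h, ray_endpoint]) (by rw [h0, ray_zero])

theorem dist_ray_le (hX : IsCAT0 X) {ξ : Boundary X} {c : GeodesicRay X} (h : c.endpoint = ξ)
    (x : X) (t : ℝ≥0) : dist ((hX.ray x ξ).toFun t) (c.toFun t) ≤ dist x (c.toFun 0) := by
  simpa using GeodesicRay.dist_le_of_asymptotic hX (c := hX.ray x ξ) (c' := c) (by simp [h]) t

/-- An ultralimit of the rays from `y` stays within `dist y x` of the limit ray from `x`, so it is
the ray from `y` to the same endpoint. Convergence at infinity thus does not depend on the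
basepoint. -/
theorem tendsto_ray_of_tendsto_ray (hX : IsCAT0 X) {x : X} (y : X) {κ : Type*} (𝓤 : Ultrafilter κ)
    {η : κ → Boundary X} {ξ : Boundary X}
    (h : ∀ t, Tendsto (fun k => (hX.ray x (η k)).toFun t) 𝓤 (𝓝 ((hX.ray x ξ).toFun t))) (t : ℝ≥0) :
    Tendsto (fun k => (hX.ray y (η k)).toFun t) 𝓤 (𝓝 ((hX.ray y ξ).toFun t)) := by
  obtain ⟨c, hc0, hc⟩ := exists_ray_tendsto 𝓤 (fun k => (hX.ray y (η k)).toFun) y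
    (Eventually.of_forall fun k => hX.ray_zero _ _)
    (fun s t => Eventually.of_forall fun k => (hX.ray y (η k)).isometry.dist_eq s t)
  have : c = hX.ray y ξ := by
    refine hX.eq_ray hc0 ?_
    rw [← hX.ray_endpoint x ξ, GeodesicRay.endpoint_eq_iff]
    refine ⟨dist y x, fun t => le_of_tendsto ((hc t).dist (h t)) (Eventually.of_forall fun k => ?_)⟩
    simpa using hX.dist_ray_le (hX.ray_endpoint x (η k)) y t
  rw [← this]
  exact hc t

/-- A set `coneNhd c r ε` constrains only the point at time `r` of the unique ray from the origin of
`c`, and the basepoint may be changed. The topology of `∂X` is thereby reduced to pointwise limits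
of rays from one point. -/
theorem isInducing_ray (hX : IsCAT0 X) (x : X) :
    IsInducing fun (ξ : Boundary X) (t : ℝ≥0) => (hX.ray x ξ).toFun t := by
  have hcone : ∀ (c : GeodesicRay X) (r : ℝ≥0) (ε : ℝ), coneNhd c r ε =
      (fun ξ => (hX.ray (c.toFun 0) ξ).toFun r) ⁻¹' Metric.ball (c.toFun r) ε := by
    intro c r ε
    ext ξ
    constructor
    · rintro ⟨c', h1, h2, h3⟩
      rw [hX.eq_ray h2 h1] at h3
      exact h3
    · intro h
      exact ⟨hX.ray (c.toFun 0) ξ, by simp, by simp, h⟩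
  refine ⟨le_antisymm ?_ ?_⟩
  · rw [← continuous_iff_le_induced]
    refine continuous_pi fun t => continuous_iff_continuousAt.2 fun ξ => ?_
    rw [ContinuousAt, Metric.nhds_basis_ball.tendsto_right_iff]
    intro ε hε
    have hopen : IsOpen (coneNhd (hX.ray x ξ) t ε) :=
      TopologicalSpace.isOpen_generateFrom_of_mem ⟨_, _, _, hε, rfl⟩
    have hmem : ξ ∈ coneNhd (hX.ray x ξ) t ε := ⟨hX.ray x ξ, by simp, rfl, by simpa using hε⟩
    filter_upwards [hopen.mem_nhds hmem] with η hη
    rw [hcone, ray_zero] at hη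
    exact hη
  · refine le_generateFrom ?_
    rintro _ ⟨c, r, ε, hε, rfl⟩
    rw [hcone]
    let := TopologicalSpace.induced (fun (ξ : Boundary X) (t : ℝ≥0) => (hX.ray x ξ).toFun t)
      inferInstance
    have hc : Continuous fun ξ => (hX.ray (c.toFun 0) ξ).toFun r := by
      rw [continuous_iff_ultrafilter]
      intro ξ 𝓤 hU
      refine hX.tendsto_ray_of_tendsto_ray (x := x) _ 𝓤 (fun t => ?_) r
      have : Continuous fun ξ => (hX.ray x ξ).toFun t :=
        (continuous_apply t).comp continuous_induced_dom
      exact (this.tendsto ξ).mono_left hU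
    exact hc.isOpen_preimage _ Metric.isOpen_ball

theorem tendsto_boundary_iff (hX : IsCAT0 X) (x : X) {κ : Type*} {l : Filter κ}
    {η : κ → Boundary X} {ξ : Boundary X} :
    Tendsto η l (𝓝 ξ) ↔
      ∀ t, Tendsto (fun k => (hX.ray x (η k)).toFun t) l (𝓝 ((hX.ray x ξ).toFun t)) := by
  rw [(hX.isInducing_ray x).tendsto_nhds_iff, tendsto_pi_nhds]
  rfl

theorem continuous_ray (hX : IsCAT0 X) (x : X) (t : ℝ≥0) :
    Continuous fun ξ : Boundary X => (hX.ray x ξ).toFun t :=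
  (continuous_apply t).comp (hX.isInducing_ray x).continuous

theorem injective_ray (hX : IsCAT0 X) (x : X) :
    Function.Injective fun (ξ : Boundary X) (t : ℝ≥0) => (hX.ray x ξ).toFun t := fun ξ η h => by
  rw [← hX.ray_endpoint x ξ, ← hX.ray_endpoint x η, GeodesicRay.ext (congrFun h)]

theorem t2Space_boundary (hX : IsCAT0 X) (x : X) : T2Space (Boundary X) :=
  (IsEmbedding.mk (hX.isInducing_ray x) (hX.injective_ray x)).t2Space

theorem compactSpace_boundary (hX : IsCAT0 X) (x : X) : CompactSpace (Boundary X) := by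
  refine ⟨isCompact_iff_ultrafilter_le_nhds.2 fun 𝓤 _ => ?_⟩
  obtain ⟨c, hc0, hc⟩ := exists_ray_tendsto 𝓤 (fun ξ => (hX.ray x ξ).toFun) x
    (Eventually.of_forall fun k => hX.ray_zero _ _)
    (fun s t => Eventually.of_forall fun ξ => (hX.ray x ξ).isometry.dist_eq s t)
  refine ⟨c.endpoint, trivial, ?_⟩
  have : Tendsto id (𝓤 : Filter (Boundary X)) (𝓝 c.endpoint) := by
    rw [hX.tendsto_boundary_iff x, ← hX.eq_ray hc0 rfl]
    exact hc
  exact this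

/-- A ray is determined by its values at rational times, so the compact boundary embeds in a
countable power of `X`. -/
theorem metrizableSpace_boundary (hX : IsCAT0 X) (x : X) :
    TopologicalSpace.MetrizableSpace (Boundary X) := by
  have := hX.compactSpace_boundary x
  have : T2Space (Boundary X) := hX.t2Space_boundary x
  set f : Boundary X → ℚ → X := fun ξ q => (hX.ray x ξ).toFun (q : ℝ).toNNReal with hf
  have hfc : Continuous f := continuous_pi fun q => hX.continuous_ray x _
  have hfi : Function.Injective f := by
    intro ξ η h
    refine hX.injective_ray x (funext fun t => ?_)
    have h1 : Continuous fun s : ℝ => (hX.ray x ξ).toFun s.toNNReal :=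
      (hX.ray x ξ).isometry.continuous.comp continuous_real_toNNReal
    have h2 : Continuous fun s : ℝ => (hX.ray x η).toFun s.toNNReal :=
      (hX.ray x η).isometry.continuous.comp continuous_real_toNNReal
    have := Rat.denseRange_cast.equalizer h1 h2 h
    simpa using congrFun this (t : ℝ)
  exact (hfc.isClosedEmbedding hfi).isEmbedding.metrizableSpace

theorem smul_ray (hX : IsCAT0 X) (g : X ≃ᵢ X) (x : X) (ξ : Boundary X) :
    hX.ray (g x) (g • ξ) = (hX.ray x ξ).translate g :=
  (hX.eq_ray (by simp [GeodesicRay.translate])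
    (by rw [← GeodesicRay.smul_endpoint, ray_endpoint])).symm

/-- A family of isometries with bounded displacement on an unbounded set fixes a boundary
point. -/
theorem exists_fixed_boundary (hX : IsCAT0 X) {L : Set (X ≃ᵢ X)} {T : Set X}
    (hT : ¬ Bornology.IsBounded T) (hL : ∀ g ∈ L, ∃ K : ℝ, ∀ p ∈ T, dist (g p) p ≤ K) :
    ∃ ξ : Boundary X, ∀ g ∈ L, g • ξ = ξ := by
  have hne : T.Nonempty := by
    by_contra h
    rw [Set.not_nonempty_iff_eq_empty] at h
    exact hT (h ▸ Bornology.isBounded_empty)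
  obtain ⟨x, -⟩ := hne
  have hex : ∀ k : ℕ, ∃ p ∈ T, (k : ℝ) < dist x p := by
    by_contra! h
    obtain ⟨k, hk⟩ := h
    exact hT ((Metric.isBounded_iff_subset_closedBall x).2 ⟨k, fun p hp => by
      rw [Metric.mem_closedBall, dist_comm]; exact hk p hp⟩)
  choose p hpT hp using hex
  choose σ h0 h1 hσ using fun k : ℕ => hX.exists_unitGeodesic x (p k)
  have hlen : Tendsto (fun k => dist x (σ k 1)) (hyperfilter ℕ) atTop := by
    refine tendsto_atTop_mono (f := fun k : ℕ => (k : ℝ)) (fun k => ?_) ?_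
    · rw [h1]; exact (hp k).le
    · exact tendsto_natCast_atTop_atTop.mono_left
        (by simpa [Nat.cofinite_eq_atTop] using (hyperfilter_le_cofinite (α := ℕ)))
  obtain ⟨c, hc0, hc⟩ := exists_ray_of_segments (hyperfilter ℕ) x σ h0 hσ hlen
  refine ⟨c.endpoint, fun g hg => ?_⟩
  obtain ⟨K, hK⟩ := hL g hg
  rw [GeodesicRay.smul_endpoint, GeodesicRay.endpoint_eq_iff]
  refine ⟨dist (g x) x + |K|, fun t => ?_⟩
  refine le_of_tendsto (((g.continuous.tendsto _).comp (hc t)).dist (hc t)) ?_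
  filter_upwards [hlen.eventually_ge_atTop (t : ℝ), hlen.eventually_gt_atTop 0] with k ht hpos
  have hs : (t : ℝ) / dist x (σ k 1) ∈ Set.Icc (0 : ℝ) 1 :=
    ⟨by positivity, div_le_one_of_le₀ ht hpos.le⟩
  have hg : IsUnitGeodesic (g ∘ σ k) := fun s hs t ht => by
    simp only [Function.comp, g.dist_eq]
    exact hσ k s hs t ht
  -- The displacement by `g` along the segment is controlled by its values at the ends `x` and `p
  -- k`, hence uniformly in `k`.
  have a1 := hX.dist_unitGeodesic_sq hg (hσ k) hs
  simp only [Function.comp, g.dist_eq, sub_self, h0, h1] at a1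
  have a2 := pow_le_pow_left₀ dist_nonneg ((hK _ (hpT k)).trans (le_abs_self K)) 2
  rw [h1] at hs
  have a3 := mul_le_mul_of_nonneg_left a2 hs.1
  have a4 : 0 ≤ dist (g x) x := dist_nonneg
  refine abs_le_of_sq_le_sq' ?_ (by positivity) |>.2
  simp only [Function.comp, h1]
  have a5 := mul_nonneg hs.1 (sq_nonneg (dist (g x) x))
  have a6 := mul_nonneg (sub_nonneg.2 hs.2) (sq_nonneg |K|)
  nlinarith [mul_nonneg a4 (abs_nonneg K)]

end IsCAT0

end Rays

/-! ### The isometry group of a proper space -/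

section IsometryGroup

variable {X : Type*} [MetricSpace X] [ProperSpace X]

/-- Convergence in the isometry group is pointwise convergence. -/
theorem tendsto_isometry_iff {κ : Type*} {l : Filter κ} {F : κ → X ≃ᵢ X} {g : X ≃ᵢ X} :
    Tendsto F l (𝓝 g) ↔ ∀ x, Tendsto (fun k => F k x) l (𝓝 (g x)) := by
  have hind : IsInducing (fun g : X ≃ᵢ X => (⟨g, g.continuous⟩ : C(X, X))) := ⟨rfl⟩
  rw [hind.tendsto_nhds_iff, ContinuousMap.tendsto_iff_tendstoLocallyUniformly]
  constructor
  · intro h x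
    exact (tendstoLocallyUniformlyOn_univ.2 h).tendsto_at (Set.mem_univ x)
  · intro h
    rw [tendstoLocallyUniformly_iff_forall_tendsto]
    intro x
    rw [Metric.uniformity_eq_comap_nhds_zero, tendsto_comap_iff]
    have h1 : Tendsto (fun y : κ × X => dist (g y.2) (g x) + dist (g x) (F y.1 x) + dist x y.2)
        (l ×ˢ 𝓝 x) (𝓝 (dist (g x) (g x) + dist (g x) (g x) + dist x x)) := by
      refine (Tendsto.add (Tendsto.add ?_ ?_) ?_)
      · exact ((g.continuous.tendsto x).comp tendsto_snd).dist tendsto_const_nhds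
      · exact tendsto_const_nhds.dist ((h x).comp tendsto_fst)
      · exact tendsto_const_nhds.dist tendsto_snd
    simp only [dist_self, add_zero] at h1
    refine squeeze_zero (fun _ => dist_nonneg) (fun y => ?_) h1
    have a := dist_triangle4 (g y.2) (g x) (F y.1 x) (F y.1 y.2)
    rw [(F y.1).dist_eq] at a
    exact a

instance isTopologicalGroup_isometry : IsTopologicalGroup (X ≃ᵢ X) where
  continuous_mul := by
    refine continuous_iff_continuousAt.2 fun p => tendsto_isometry_iff.2 fun x => ?_
    have h1 := tendsto_isometry_iff.1 (continuous_fst.tendsto p)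
    have h2 := tendsto_isometry_iff.1 (continuous_snd.tendsto p) x
    rw [tendsto_iff_dist_tendsto_zero] at h2 ⊢
    have h3 := tendsto_iff_dist_tendsto_zero.1 (h1 (p.2 x))
    refine squeeze_zero (fun _ => dist_nonneg) (fun q => ?_) (by simpa using h2.add h3)
    have := dist_triangle ((q.1 * q.2) x) (q.1 (p.2 x)) ((p.1 * p.2) x)
    rwa [IsometryEquiv.mul_apply, q.1.dist_eq] at this
  continuous_inv := by
    refine continuous_iff_continuousAt.2 fun g => tendsto_isometry_iff.2 fun x => ?_
    have h1 := tendsto_isometry_iff.1 (continuous_id.tendsto g) (g⁻¹ x)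
    rw [tendsto_iff_dist_tendsto_zero] at h1 ⊢
    refine h1.congr fun f => ?_
    rw [id, id, IsometryEquiv.apply_inv_self, dist_comm, ← f.dist_eq (f⁻¹ x),
      IsometryEquiv.apply_inv_self]

theorem continuous_isometry_apply (x : X) : Continuous fun g : X ≃ᵢ X => g x :=
  continuous_iff_continuousAt.2 fun g => tendsto_isometry_iff.1 (continuous_id.tendsto g) x

instance t2Space_isometry : T2Space (X ≃ᵢ X) :=
  T2Space.of_injective_continuous (f := fun (g : X ≃ᵢ X) (x : X) => g x)
    (fun _ _ hgh => IsometryEquiv.ext (congrFun hgh))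
    (continuous_pi continuous_isometry_apply)

/-- This is the Arzelà–Ascoli argument. The bound at `o` confines every `g x` and `g⁻¹ x` to compact
balls, and the two pointwise ultralimits are inverse to each other. -/
theorem isCompact_isometry_dist_le (o : X) (m : ℝ) :
    IsCompact {g : X ≃ᵢ X | dist (g o) o ≤ m} := by
  refine isCompact_iff_ultrafilter_le_nhds.2 fun 𝓤 hU => ?_
  have hU' : ∀ᶠ g in (𝓤 : Filter (X ≃ᵢ X)), dist (g o) o ≤ m := le_principal_iff.1 hU
  have hlim : ∀ x, ∃ y, Tendsto (fun g : X ≃ᵢ X => g x) 𝓤 (𝓝 y) := fun x => by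
    have hmem : ∀ᶠ g in (𝓤 : Filter (X ≃ᵢ X)), g x ∈ Metric.closedBall o (dist x o + m) := by
      filter_upwards [hU'] with g hg
      have := dist_triangle (g x) (g o) o
      rw [g.dist_eq] at this
      rw [Metric.mem_closedBall]
      linarith
    obtain ⟨y, -, hy⟩ := (isCompact_closedBall o (dist x o + m)).ultrafilter_le_nhds
      (𝓤.map (fun g : X ≃ᵢ X => g x)) (le_principal_iff.2 hmem)
    exact ⟨y, hy⟩
  have hlim' : ∀ x, ∃ y, Tendsto (fun g : X ≃ᵢ X => g⁻¹ x) 𝓤 (𝓝 y) := fun x => by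
    have hmem : ∀ᶠ g in (𝓤 : Filter (X ≃ᵢ X)), g⁻¹ x ∈ Metric.closedBall o (dist x o + m) := by
      filter_upwards [hU'] with g hg
      have := dist_triangle x o (g o)
      rw [Metric.mem_closedBall, ← g.dist_eq, IsometryEquiv.apply_inv_self]
      rw [dist_comm] at hg
      linarith
    obtain ⟨y, -, hy⟩ := (isCompact_closedBall o (dist x o + m)).ultrafilter_le_nhds
      (𝓤.map (fun g : X ≃ᵢ X => g⁻¹ x)) (le_principal_iff.2 hmem)
    exact ⟨y, hy⟩
  choose f hf using hlim
  choose f' hf' using hlim'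
  have hiso : Isometry f := Isometry.of_dist_eq fun x y =>
    tendsto_nhds_unique ((hf x).dist (hf y))
      (tendsto_const_nhds.congr fun g => (g.dist_eq x y).symm)
  have hright : ∀ x, f (f' x) = x := fun x => by
    refine dist_eq_zero.1 (tendsto_nhds_unique ((hf (f' x)).dist tendsto_const_nhds) ?_)
    refine (tendsto_iff_dist_tendsto_zero.1 (hf' x)).congr fun g => ?_
    rw [← g.dist_eq, IsometryEquiv.apply_inv_self, dist_comm]
  let g₀ : X ≃ᵢ X := IsometryEquiv.mk' f f' hright hiso
  have hg₀ : Tendsto id (𝓤 : Filter (X ≃ᵢ X)) (𝓝 g₀) := tendsto_isometry_iff.2 hf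
  refine ⟨g₀, ?_, hg₀⟩
  exact le_of_tendsto ((hf o).dist tendsto_const_nhds) hU'

theorem locallyCompactSpace_isometry (o : X) : LocallyCompactSpace (X ≃ᵢ X) := by
  refine (isCompact_isometry_dist_le o 1).locallyCompactSpace_of_mem_nhds_of_group (x := 1) ?_
  have : Continuous fun g : X ≃ᵢ X => dist (g o) o := (continuous_isometry_apply o).dist
    continuous_const
  filter_upwards [this.isOpen_preimage _ (isOpen_Iio (a := (1 : ℝ))) |>.mem_nhds
    (show (1 : X ≃ᵢ X) ∈ _ by simp)] with g hg
  exact le_of_lt hg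

/-- Rays to `F k • η k` from `F k x` and from `g x` stay within the distance of these origins, so
joint continuity reduces to pointwise convergence of isometries and rays. -/
theorem tendsto_smul_boundary (hX : IsCAT0 X) {κ : Type*} {l : Filter κ} {F : κ → X ≃ᵢ X}
    {g : X ≃ᵢ X} {η : κ → Boundary X} {ξ : Boundary X} (hF : Tendsto F l (𝓝 g))
    (hη : Tendsto η l (𝓝 ξ)) : Tendsto (fun k => F k • η k) l (𝓝 (g • ξ)) := by
  obtain ⟨x⟩ : Nonempty X := by
    obtain ⟨c⟩ := ξ
    exact ⟨c.toFun 0⟩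
  rw [hX.tendsto_boundary_iff (g x)]
  intro t
  rw [tendsto_isometry_iff] at hF
  rw [hX.tendsto_boundary_iff x] at hη
  have h1 := tendsto_iff_dist_tendsto_zero.1 (hF x)
  have h2 := tendsto_iff_dist_tendsto_zero.1 (hη t)
  have h3 := tendsto_iff_dist_tendsto_zero.1 (hF ((hX.ray x ξ).toFun t))
  rw [tendsto_iff_dist_tendsto_zero]
  refine squeeze_zero (fun _ => dist_nonneg) (fun k => ?_) (by simpa using (h1.add h2).add h3)
  have e : (hX.ray (F k x) (F k • η k)).toFun t = F k ((hX.ray x (η k)).toFun t) := by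
    rw [hX.smul_ray]; rfl
  have e' : (hX.ray (g x) (g • ξ)).toFun t = g ((hX.ray x ξ).toFun t) := by
    rw [hX.smul_ray]; rfl
  have a1 := hX.dist_ray_le (hX.ray_endpoint (F k x) (F k • η k)) (g x) t
  rw [hX.ray_zero, e, dist_comm (g x)] at a1
  have a2 := dist_triangle4 ((hX.ray (g x) (F k • η k)).toFun t) (F k ((hX.ray x (η k)).toFun t))
    (F k ((hX.ray x ξ).toFun t)) (g ((hX.ray x ξ).toFun t))
  rw [(F k).dist_eq] at a2
  rw [e']
  linarith

end IsometryGroup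

/-! ### Extension of homomorphisms from dense subgroups -/

/-- A homomorphism to a locally compact group that is continuous at the identity for the topology
induced by a homomorphism `p` with dense range extends along `p`. -/
theorem exists_extension {Δ B H : Type*} [Group Δ] [Group B] [TopologicalSpace B]
    [IsTopologicalGroup B] [Group H] [TopologicalSpace H] [IsTopologicalGroup H] [T2Space H]
    [LocallyCompactSpace H] (p : Δ →* B) (hp : DenseRange p) (φ : Δ →* H)
    (hφ : Tendsto φ (comap p (𝓝 1)) (𝓝 1)) :
    ∃ σ : B →* H, Continuous σ ∧ ∀ γ, σ (p γ) = φ γ := by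
  let t : TopologicalSpace Δ := TopologicalSpace.induced p inferInstance
  have hdi : IsDenseInducing p := ⟨⟨rfl⟩, hp⟩
  have hne : ∀ b, (comap p (𝓝 b)).NeBot := fun b => hdi.comap_nhds_neBot b
  have hcau : ∀ b, Tendsto (fun q : Δ × Δ => (φ q.1)⁻¹ * φ q.2)
      (comap p (𝓝 b) ×ˢ comap p (𝓝 b)) (𝓝 1) := by
    intro b
    have h1 : Tendsto (fun q : Δ × Δ => q.1⁻¹ * q.2) (comap p (𝓝 b) ×ˢ comap p (𝓝 b))
        (comap p (𝓝 1)) := by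
      rw [tendsto_comap_iff]
      have : Tendsto (fun q : Δ × Δ => (p q.1)⁻¹ * p q.2) (comap p (𝓝 b) ×ˢ comap p (𝓝 b))
          (𝓝 (b⁻¹ * b)) :=
        (tendsto_comap.comp tendsto_fst).inv.mul (tendsto_comap.comp tendsto_snd)
      simpa [Function.comp_def] using this
    simpa [Function.comp_def] using hφ.comp h1
  have hlim : ∀ b, ∃ h, Tendsto φ (comap p (𝓝 b)) (𝓝 h) := by
    intro b
    obtain ⟨K, hK, hK1⟩ := exists_compact_mem_nhds (1 : H)
    obtain ⟨S, hS, S', hS', hSS⟩ := mem_prod_iff.1 (hcau b hK1)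
    have := hne b
    obtain ⟨γ₀, hγ₀⟩ := nonempty_of_mem hS
    -- Near `b` the values of `φ` lie in one compact translate of `K`, where an ultrafilter has a
    -- limit; the Cauchy property `hcau` makes it the limit along the whole filter.
    have hcomp : IsCompact ((fun h => φ γ₀ * h) '' K) := hK.image (continuous_const_mul _)
    have hev : ∀ᶠ γ in comap p (𝓝 b), φ γ ∈ (fun h => φ γ₀ * h) '' K := by
      filter_upwards [hS'] with γ hγ
      exact ⟨_, hSS (Set.mk_mem_prod hγ₀ hγ), by simp⟩
    set 𝓤 := Ultrafilter.of (comap p (𝓝 b)) with hUdef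
    have hU : (𝓤 : Filter Δ) ≤ comap p (𝓝 b) := Ultrafilter.of_le _
    obtain ⟨h, -, hh⟩ := hcomp.ultrafilter_le_nhds (𝓤.map φ) (le_principal_iff.2 (hU hev))
    refine ⟨h, ?_⟩
    have h1 : Tendsto (fun q : Δ × Δ => φ q.1 * ((φ q.1)⁻¹ * φ q.2))
        ((𝓤 : Filter Δ) ×ˢ comap p (𝓝 b)) (𝓝 (h * 1)) :=
      (Tendsto.comp (show Tendsto φ 𝓤 (𝓝 h) from hh) tendsto_fst).mul
        ((hcau b).mono_left (prod_mono_left _ hU))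
    simp only [mul_inv_cancel_left, mul_one] at h1
    have h2 : Tendsto φ (map Prod.snd ((𝓤 : Filter Δ) ×ˢ comap p (𝓝 b))) (𝓝 h) := by
      rw [tendsto_map'_iff]; exact h1
    rwa [map_snd_prod] at h2
  have hval : ∀ γ, hdi.extend φ (p γ) = φ γ := by
    intro γ
    obtain ⟨h, hh⟩ := hlim (p γ)
    rw [hdi.extend_eq_of_tendsto hh]
    have hle : pure γ ≤ comap p (𝓝 (p γ)) := by
      rw [← map_le_iff_le_comap, map_pure]
      exact pure_le_nhds _
    exact tendsto_nhds_unique (hh.mono_left hle) (tendsto_pure_nhds φ γ)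
  have hcont : Continuous (hdi.extend φ) := hdi.continuous_extend hlim
  refine ⟨⟨⟨hdi.extend φ, by rw [← map_one p, hval, map_one]⟩, fun x y => ?_⟩, hcont, hval⟩
  have h1 : Continuous fun q : B × B => hdi.extend φ (q.1 * q.2) := by fun_prop
  have h2 : Continuous fun q : B × B => hdi.extend φ q.1 * hdi.extend φ q.2 := by fun_prop
  have := (hp.prodMap hp).equalizer h1 h2 (funext fun q => by
    simp only [Function.comp, Prod.map]
    rw [← map_mul, hval, hval, hval, map_mul])
  exact congrFun this (x, y)

/-! ### Quasi-invariant convex sets and their boundary -/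

section ConvexSets

variable {X : Type*} [MetricSpace X]

/-- The distance to `P` is midpoint convex along the segment and vanishes at its ends, so the
maximum argument of `cn_unitGeodesic` shows that it vanishes throughout. -/
theorem mem_of_isUnitGeodesic (hX : IsCAT0 X) {P : Set X} (hcl : IsClosed P)
    (hmid : ∀ x ∈ P, ∀ y ∈ P, hX.mid x y ∈ P) {σ : ℝ → X} (hσ : IsUnitGeodesic σ)
    (h0 : σ 0 ∈ P) (h1 : σ 1 ∈ P) {s : ℝ} (hs : s ∈ Set.Icc (0 : ℝ) 1) : σ s ∈ P := by
  have hne : P.Nonempty := ⟨_, h0⟩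
  set f : ℝ → ℝ := fun s => Metric.infDist (σ s) P with hf
  have hσc : ContinuousOn σ (Set.Icc 0 1) := by
    have : LipschitzOnWith ⟨dist (σ 0) (σ 1), dist_nonneg⟩ σ (Set.Icc 0 1) :=
      LipschitzOnWith.of_dist_le_mul fun s hs t ht => by
        rw [hσ s hs t ht, mul_comm, Real.dist_eq]; rfl
    exact this.continuousOn
  have hfc : ContinuousOn f (Set.Icc 0 1) := (Metric.continuous_infDist_pt P).comp_continuousOn hσc
  have hmidf : ∀ s ∈ Set.Icc (0 : ℝ) 1, ∀ t ∈ Set.Icc (0 : ℝ) 1,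
      f ((s + t) / 2) ≤ (f s + f t) / 2 := by
    intro s hs t ht
    have hm : (s + t) / 2 ∈ Set.Icc (0 : ℝ) 1 :=
      ⟨by linarith [hs.1, ht.1], by linarith [hs.2, ht.2]⟩
    have e1 := hσ s hs t ht
    have e2 : dist (σ s) (σ ((s + t) / 2)) = |s - t| * dist (σ 0) (σ 1) / 2 := by
      rw [hσ s hs _ hm, show s - (s + t) / 2 = (s - t) / 2 by ring, abs_div, abs_two]; ring
    have e3 : dist (σ t) (σ ((s + t) / 2)) = |s - t| * dist (σ 0) (σ 1) / 2 := by
      rw [hσ t ht _ hm, show t - (s + t) / 2 = -((s - t) / 2) by ring, abs_neg, abs_div, abs_two]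
      ring
    have e4 : σ ((s + t) / 2) = hX.mid (σ s) (σ t) :=
      hX.eq_mid (by rw [e1, e2]) (by rw [e1, e3])
    refine le_of_forall_pos_le_add fun ε hε => ?_
    obtain ⟨a, haP, ha⟩ := (Metric.infDist_lt_iff hne).1 (lt_add_of_pos_right (f s) hε)
    obtain ⟨b, hbP, hb⟩ := (Metric.infDist_lt_iff hne).1 (lt_add_of_pos_right (f t) hε)
    have h2 := hX.isMidpointMap.dist_mid_mid (σ s) (σ t) a b
    have h3 : f ((s + t) / 2) ≤ dist (hX.mid (σ s) (σ t)) (hX.mid a b) := by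
      simp only [hf]
      rw [e4]
      exact Metric.infDist_le_dist_of_mem (hmid a haP b hbP)
    linarith
  obtain ⟨m, hm, hmax⟩ := isCompact_Icc.exists_isMaxOn (Set.nonempty_Icc.2 zero_le_one) hfc
  have hf0 : f 0 = 0 := Metric.infDist_zero_of_mem h0
  have hf1 : f 1 = 0 := Metric.infDist_zero_of_mem h1
  have hm0 : f m ≤ 0 := by
    rcases le_total m (1 / 2) with h | h
    · have h2 : 2 * m ∈ Set.Icc (0 : ℝ) 1 := ⟨by linarith [hm.1], by linarith⟩
      have h3 := hmidf 0 ⟨le_rfl, zero_le_one⟩ _ h2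
      have h4 : f (2 * m) ≤ f m := hmax h2
      rw [show (0 + 2 * m) / 2 = m by ring] at h3
      linarith
    · have h2 : 2 * m - 1 ∈ Set.Icc (0 : ℝ) 1 := ⟨by linarith, by linarith [hm.2]⟩
      have h3 := hmidf _ h2 1 ⟨zero_le_one, le_rfl⟩
      have h4 : f (2 * m - 1) ≤ f m := hmax h2
      rw [show (2 * m - 1 + 1) / 2 = m by ring] at h3
      linarith
  have h5 : f s ≤ 0 := (hmax hs).trans hm0
  exact (hcl.mem_iff_infDist_zero hne).2 (le_antisymm h5 Metric.infDist_nonneg)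

variable [ProperSpace X]

/-- The ray is a limit of segments from `x` to points of `c`, all contained in `P`. -/
theorem ray_mem_of_mem (hX : IsCAT0 X) {P : Set X} (hcl : IsClosed P)
    (hmid : ∀ x ∈ P, ∀ y ∈ P, hX.mid x y ∈ P) {x : X} (hx : x ∈ P) {c : GeodesicRay X}
    (hc : ∀ t, c.toFun t ∈ P) (t : ℝ≥0) : (hX.ray x c.endpoint).toFun t ∈ P := by
  choose σ h0 h1 hσ using fun k : ℕ => hX.exists_unitGeodesic x (c.toFun k)
  obtain ⟨c', hc0, hce, hlim⟩ := hX.exists_ray_segments_asymptotic x c σ h0 h1 hσ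
  rw [← hX.eq_ray hc0 hce]
  refine hcl.mem_of_tendsto (hlim t) ?_
  have hbig : ∀ᶠ k : ℕ in (hyperfilter ℕ : Filter ℕ), (t : ℝ) + dist x (c.toFun 0) ≤ k := by
    have : ∀ᶠ k : ℕ in atTop, (t : ℝ) + dist x (c.toFun 0) ≤ k :=
      tendsto_natCast_atTop_atTop.eventually_ge_atTop _
    rw [← Nat.cofinite_eq_atTop] at this
    exact hyperfilter_le_cofinite this
  filter_upwards [hbig] with k hk
  have a : (k : ℝ) ≤ dist x (c.toFun 0) + dist x (c.toFun k) := by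
    have e : dist (c.toFun 0) (c.toFun k) = k := by rw [c.dist_eq]; simp
    have := dist_triangle_left (c.toFun 0) (c.toFun k) x
    linarith
  refine mem_of_isUnitGeodesic hX hcl hmid (hσ k) (by rw [h0]; exact hx)
    (by rw [h1]; exact hc k) ⟨by positivity, ?_⟩
  rw [h1]
  exact div_le_one_of_le₀ (by linarith) dist_nonneg

/-- An isometric map defined on a dense subset of a closed set extends. -/
theorem exists_isometric_extension {ι : Type*} (k : ι → X) (ρ : ι → ι)
    (hρ : ∀ i j, dist (k (ρ i)) (k (ρ j)) = dist (k i) (k j)) :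
    ∃ f : X → X, (∀ x ∈ closure (Set.range k), f x ∈ closure (Set.range k)) ∧
      (∀ x ∈ closure (Set.range k), ∀ y ∈ closure (Set.range k), dist (f x) (f y) = dist x y) ∧
      ∀ i, f (k i) = k (ρ i) := by
  have hseq : ∀ x : closure (Set.range k), ∃ i : ℕ → ι, Tendsto (fun n => k (i n)) atTop (𝓝 x) := by
    rintro ⟨x, hx⟩
    obtain ⟨u, hu, hux⟩ := mem_closure_iff_seq_limit.1 hx
    choose i hi using hu
    exact ⟨i, by simpa only [hi] using hux⟩
  choose i hi using hseq
  have hlim : ∀ x : closure (Set.range k), ∃ y, Tendsto (fun n => k (ρ (i x n))) atTop (𝓝 y) := by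
    intro x
    refine cauchySeq_tendsto_of_complete ?_
    have h1 := (hi x).cauchySeq
    rw [Metric.cauchySeq_iff] at h1 ⊢
    simpa only [hρ] using h1
  choose f hf using hlim
  classical
  refine ⟨fun x => if h : x ∈ closure (Set.range k) then f ⟨x, h⟩ else x, fun x hx => ?_,
    fun x hx y hy => ?_, fun j => ?_⟩
  · simp only [hx, dif_pos]
    exact mem_closure_of_tendsto (hf _) (Eventually.of_forall fun n => Set.mem_range_self _)
  · simp only [hx, hy, dif_pos]
    refine tendsto_nhds_unique ((hf _).dist (hf _)) ?_
    simpa only [hρ] using (hi ⟨x, hx⟩).dist (hi ⟨y, hy⟩)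
  · have hj : k j ∈ closure (Set.range k) := subset_closure (Set.mem_range_self j)
    simp only [hj, dif_pos]
    refine tendsto_nhds_unique (hf _) ?_
    have h1 := tendsto_iff_dist_tendsto_zero.1 (hi ⟨k j, hj⟩)
    rw [tendsto_iff_dist_tendsto_zero]
    simpa only [hρ] using h1

end ConvexSets

/-! ### Convergence in the isometry group from convergence at infinity -/

section Indecomposable

variable {X : Type*} [MetricSpace X] [ProperSpace X]

/-- Indecomposable groups: convergence to the identity on a closed invariant set of boundary
points implies convergence to the identity in the isometry group. -/
theorem IsIndecomposable.tendsto_one (hX : IsCAT0 X) {Δ : Type*} [Group Δ] {φ : Δ →* (X ≃ᵢ X)}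
    (hind : IsIndecomposable φ.range) {l : Filter Δ} (hl : Tendsto (fun γ => γ⁻¹) l l)
    {C : Set (Boundary X)} (hne : C.Nonempty) (hcl : IsClosed C)
    (hinv : ∀ (γ : Δ), ∀ ξ ∈ C, φ γ • ξ ∈ C)
    (hconv : ∀ ξ ∈ C, Tendsto (fun q : Δ × C => φ q.1 • (q.2 : Boundary X))
      (l ×ˢ comap Subtype.val (𝓝 ξ)) (𝓝 ξ)) :
    Tendsto φ l (𝓝 1) := by
  obtain ⟨o⟩ : Nonempty X := by
    obtain ⟨ξ, -⟩ := hne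
    obtain ⟨c⟩ := ξ
    exact ⟨c.toFun 0⟩
  have := hX.compactSpace_boundary o
  have := hX.metrizableSpace_boundary o
  have : CompactSpace C := isCompact_iff_compactSpace.1 hcl.isCompact
  let : MetricSpace C := TopologicalSpace.metrizableSpaceMetric C
  obtain ⟨hfaith, hclosed⟩ := hind C hne hcl (by rintro _ ⟨γ, rfl⟩ ξ hξ; exact hinv γ ξ hξ)
  set L : Subgroup (X ≃ᵢ X) := φ.range.topologicalClosure with hL
  have hLset : (L : Set (X ≃ᵢ X)) = closure (φ.range : Set (X ≃ᵢ X)) := rfl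
  have hmemL : ∀ γ, φ γ ∈ L := fun γ => subset_closure ⟨γ, rfl⟩
  have hLC : ∀ g ∈ L, ∀ ξ ∈ C, g • ξ ∈ C := by
    intro g hg ξ hξ
    have h1 : Continuous fun g : X ≃ᵢ X => g • ξ := continuous_iff_continuousAt.2 fun g =>
      tendsto_smul_boundary hX tendsto_id tendsto_const_nhds
    have h2 : IsClosed {g : X ≃ᵢ X | g • ξ ∈ C} := hcl.preimage h1
    exact closure_minimal (by rintro _ ⟨γ, rfl⟩; exact hinv γ ξ hξ) h2 hg
  -- The action of `L` on `C` and the map to pairs of mutually inverse self-maps of `C`.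
  let act : L → C → C := fun g ξ => ⟨(g : X ≃ᵢ X) • (ξ : Boundary X), hLC g g.2 ξ ξ.2⟩
  have hact : Continuous fun q : L × C => act q.1 q.2 := by
    refine Continuous.subtype_mk (continuous_iff_continuousAt.2 fun q => ?_) _
    exact tendsto_smul_boundary hX (continuous_subtype_val.comp continuous_fst).continuousAt
      (continuous_subtype_val.comp continuous_snd).continuousAt
  let cact : L → C(C, C) := fun g => ⟨act g, hact.comp (Continuous.prodMk_right g)⟩
  have hcact : Continuous cact := ContinuousMap.continuous_of_continuous_uncurry _ hact
  let Φ : L → C(C, C) × C(C, C) := fun g => (cact g, cact g⁻¹)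
  have hΦ : Continuous Φ := hcact.prodMk (hcact.comp continuous_inv)
  have hΦinj : Function.Injective Φ := by
    intro g h hgh
    have h1 : ∀ ξ ∈ C, (g : X ≃ᵢ X) • ξ = (h : X ≃ᵢ X) • ξ := fun ξ hξ => by
      have := DFunLike.congr_fun (congrArg Prod.fst hgh) ⟨ξ, hξ⟩
      exact congrArg Subtype.val this
    have h2 := hfaith ((h : X ≃ᵢ X)⁻¹ * g) (L.mul_mem (L.inv_mem h.2) g.2) fun ξ hξ => by
      rw [mul_smul, h1 ξ hξ, inv_smul_smul]
    exact Subtype.ext (inv_mul_eq_one.1 h2).symm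
  -- The image of `L` is only known to be closed among homeomorphisms, which need not be closed in
  -- `C(C, C)`. A limit of pairs of mutually inverse maps is again such a pair, so recording the
  -- inverse gives a closed subset of a complete space.
  have hΦclosed : IsClosed (Set.range Φ) := by
    refine isClosed_of_closure_subset fun q hq => ?_
    have hE : IsClosed {q : C(C, C) × C(C, C) | q.1.comp q.2 = ContinuousMap.id C ∧
        q.2.comp q.1 = ContinuousMap.id C} := by
      refine IsClosed.inter ?_ ?_
      · exact isClosed_eq (ContinuousMap.continuous_comp'.comp continuous_swap) continuous_const
      · exact isClosed_eq ContinuousMap.continuous_comp' continuous_const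
    have hrE : Set.range Φ ⊆ {q : C(C, C) × C(C, C) | q.1.comp q.2 = ContinuousMap.id C ∧
        q.2.comp q.1 = ContinuousMap.id C} := by
      rintro _ ⟨g, rfl⟩
      constructor
      · ext ξ
        exact smul_inv_smul (g : X ≃ᵢ X) (ξ : Boundary X)
      · ext ξ
        exact inv_smul_smul (g : X ≃ᵢ X) (ξ : Boundary X)
    let E := {q : C(C, C) × C(C, C) | q.1.comp q.2 = ContinuousMap.id C ∧
        q.2.comp q.1 = ContinuousMap.id C}
    have hqE : q ∈ E := closure_minimal hrE hE hq
    let toHomeo : E → (C ≃ₜ C) := fun e =>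
      { toFun := e.1.1
        invFun := e.1.2
        left_inv := fun ξ => DFunLike.congr_fun e.2.2 ξ
        right_inv := fun ξ => DFunLike.congr_fun e.2.1 ξ
        continuous_toFun := e.1.1.continuous
        continuous_invFun := e.1.2.continuous }
    have htoHomeo : Continuous toHomeo :=
      continuous_induced_rng.2 (continuous_fst.comp continuous_subtype_val)
    have hmem : toHomeo ⟨q, hqE⟩ ∈ imageInHomeo (closure (φ.range : Set (X ≃ᵢ X))) C := by
      have hcl' : IsClosed (toHomeo ⁻¹' imageInHomeo (closure (φ.range : Set (X ≃ᵢ X))) C) :=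
        hclosed.preimage htoHomeo
      have hq' : (⟨q, hqE⟩ : E) ∈ closure (Subtype.val ⁻¹' Set.range Φ) := by
        rw [closure_subtype, Subtype.image_preimage_coe, Set.inter_eq_right.2 hrE]
        exact hq
      refine closure_minimal ?_ hcl' hq'
      rintro ⟨e, he⟩ ⟨g, hg⟩
      refine ⟨g, g.2, fun ξ => ?_⟩
      change ((e.1 ξ : C) : Boundary X) = _
      simp only at hg
      rw [← hg]
      rfl
    obtain ⟨g, hg, hgq⟩ := hmem
    refine ⟨⟨g, hg⟩, Prod.ext ?_ ?_⟩
    · ext ξ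
      exact (hgq ξ).symm
    · ext ξ
      have h1 := hgq (q.2 ξ)
      have h2 : q.1 (q.2 ξ) = ξ := DFunLike.congr_fun hqE.1 ξ
      change ((q.1 (q.2 ξ) : C) : Boundary X) = _ at h1
      rw [h2] at h1
      change g⁻¹ • (ξ : Boundary X) = _
      rw [h1, inv_smul_smul]
  -- Baire's theorem bounds a neighbourhood of some point of the image.
  have hbaire : ∃ (m : ℕ) (g₀ : L), ∀ᶠ q in 𝓝 (Φ g₀), ∀ g : L, Φ g = q →
      dist ((g : X ≃ᵢ X) o) o ≤ m := by
    have : CompleteSpace (Set.range Φ) := hΦclosed.completeSpace_coe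
    let S : ℕ → Set (Set.range Φ) := fun m =>
      Subtype.val ⁻¹' (Φ '' {g : L | dist ((g : X ≃ᵢ X) o) o ≤ m})
    have hLclosed : IsClosed (L : Set (X ≃ᵢ X)) := φ.range.isClosed_topologicalClosure
    have hS : ∀ m, IsClosed (S m) := fun m => by
      have hc : IsCompact {g : L | dist ((g : X ≃ᵢ X) o) o ≤ m} :=
        hLclosed.isClosedEmbedding_subtypeVal.isCompact_preimage (isCompact_isometry_dist_le o m)
      exact (hc.image hΦ).isClosed.preimage continuous_subtype_val
    have hU : ⋃ m, S m = Set.univ := by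
      refine Set.eq_univ_of_forall fun ⟨q, hq⟩ => ?_
      obtain ⟨g, rfl⟩ := hq
      obtain ⟨m, hm⟩ := exists_nat_ge (dist ((g : X ≃ᵢ X) o) o)
      exact Set.mem_iUnion.2 ⟨m, g, hm, rfl⟩
    have : Nonempty (Set.range Φ) := ⟨⟨Φ 1, 1, rfl⟩⟩
    obtain ⟨m, q₀, hint⟩ := nonempty_interior_of_iUnion_of_closed hS hU
    rw [mem_interior_iff_mem_nhds, nhds_subtype_eq_comap, mem_comap] at hint
    obtain ⟨V, hV, hVS⟩ := hint
    obtain ⟨g₀, hg₀⟩ := q₀.2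
    refine ⟨m, g₀, ?_⟩
    rw [hg₀]
    filter_upwards [hV] with q hq g hgq
    subst hgq
    obtain ⟨g', hg', he⟩ := hVS (show (⟨Φ g, g, rfl⟩ : Set.range Φ) ∈ _ from hq)
    rw [hΦinj he] at hg'
    exact hg'
  obtain ⟨m, g₀, hm⟩ := hbaire
  let ψ : Δ → L := fun γ => ⟨φ γ, hmemL γ⟩
  have hψ : Tendsto (fun γ => cact (ψ γ)) l (𝓝 (ContinuousMap.id C)) := by
    rw [ContinuousMap.tendsto_iff_tendstoLocallyUniformly,
      tendstoLocallyUniformly_iff_forall_tendsto]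
    intro ξ
    have h1 : Tendsto (fun q : Δ × C => cact (ψ q.1) q.2) (l ×ˢ 𝓝 ξ) (𝓝 ξ) := by
      rw [tendsto_subtype_rng]
      have := hconv ξ ξ.2
      rwa [← nhds_subtype_eq_comap] at this
    have h2 : Tendsto (fun q : Δ × C => q.2) (l ×ˢ 𝓝 ξ) (𝓝 ξ) := tendsto_snd
    exact (h2.prodMk_nhds h1).mono_right (nhds_le_uniformity ξ)
  have hψinv : Tendsto (fun γ => cact (ψ γ)⁻¹) l (𝓝 (ContinuousMap.id C)) := by
    refine (hψ.comp hl).congr fun γ => ?_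
    have : ψ γ⁻¹ = (ψ γ)⁻¹ := Subtype.ext (map_inv φ γ)
    simp only [Function.comp, this]
  -- Multiplication by `g₀` transports convergence to the identity to the point where Baire's
  -- theorem gave a bound; this keeps `φ γ` in a compact set.
  have hΦψ : Tendsto (fun γ => Φ (g₀ * ψ γ)) l (𝓝 (Φ g₀)) := by
    refine Tendsto.prodMk_nhds ?_ ?_
    · have h1 : Tendsto (fun γ => (cact g₀).comp (cact (ψ γ))) l
          (𝓝 ((cact g₀).comp (ContinuousMap.id C))) :=
        ((ContinuousMap.continuous_postcomp (cact g₀)).tendsto _).comp hψ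
      rw [ContinuousMap.comp_id] at h1
      refine h1.congr fun γ => ?_
      ext ξ
      exact (mul_smul (g₀ : X ≃ᵢ X) (φ γ) (ξ : Boundary X)).symm
    · have h1 : Tendsto (fun γ => (cact (ψ γ)⁻¹).comp (cact g₀⁻¹)) l
          (𝓝 ((ContinuousMap.id C).comp (cact g₀⁻¹))) :=
        ((ContinuousMap.continuous_precomp (cact g₀⁻¹)).tendsto _).comp hψinv
      rw [ContinuousMap.id_comp] at h1
      refine h1.congr fun γ => ?_
      rw [mul_inv_rev]
      ext ξ
      exact (mul_smul ((φ γ)⁻¹ : X ≃ᵢ X) (g₀ : X ≃ᵢ X)⁻¹ (ξ : Boundary X)).symm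
  have hbound : ∀ᶠ γ in l, dist (φ γ o) o ≤ m + dist ((g₀ : X ≃ᵢ X)⁻¹ o) o := by
    filter_upwards [hΦψ.eventually hm] with γ hγ
    have h1 := hγ _ rfl
    have h2 : dist (φ γ o) ((g₀ : X ≃ᵢ X)⁻¹ o) ≤ m := by
      rw [← (g₀ : X ≃ᵢ X).dist_eq, IsometryEquiv.apply_inv_self]
      exact h1
    exact (dist_triangle _ _ _).trans (add_le_add_left h2 _)
  -- Every ultralimit of `φ` along `l` lies in the closure of the image and is trivial on `C`, hence
  -- is `1` by faithfulness.
  rw [tendsto_iff_ultrafilter]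
  intro 𝓤 hU
  obtain ⟨g, -, hg⟩ := (isCompact_isometry_dist_le o (m + dist ((g₀ : X ≃ᵢ X)⁻¹ o) o)).ultrafilter_le_nhds
    (𝓤.map φ) (le_principal_iff.2 (hU hbound))
  have hg' : Tendsto φ 𝓤 (𝓝 g) := hg
  have hgL : g ∈ L := by
    refine φ.range.isClosed_topologicalClosure.mem_of_tendsto hg' (Eventually.of_forall hmemL)
  have hg1 : g = 1 := hfaith g hgL fun ξ hξ => by
    have h1 : Tendsto (fun γ => φ γ • ξ) 𝓤 (𝓝 (g • ξ)) :=
      tendsto_smul_boundary hX hg' tendsto_const_nhds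
    have h2 : Tendsto (fun γ => φ γ • ξ) 𝓤 (𝓝 ξ) := by
      have h3 : Tendsto (fun γ : Δ => (γ, (⟨ξ, hξ⟩ : C))) 𝓤
          (l ×ˢ comap Subtype.val (𝓝 ξ)) := by
        refine (Tendsto.mono_left tendsto_id hU).prodMk ?_
        rw [tendsto_comap_iff]
        exact tendsto_const_nhds
      exact (hconv ξ hξ).comp h3
    exact tendsto_nhds_unique h1 h2
  rw [← hg1]
  exact hg'

/-- An unbounded convex set on which a filter of group elements acts, up to bounded error, by
isometries converging to the identity. -/
theorem IsIndecomposable.tendsto_one_of_convex_model (hX : IsCAT0 X) {Δ : Type*} [Group Δ]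
    {φ : Δ →* (X ≃ᵢ X)} (hind : IsIndecomposable φ.range) {l : Filter Δ}
    (hl : Tendsto (fun γ => γ⁻¹) l l) {ι : Type*} (k : ι → X) (ρ : Δ → ι → ι)
    (hρ : ∀ γ i j, dist (k (ρ γ i)) (k (ρ γ j)) = dist (k i) (k j))
    (hmid : ∀ i j, ∃ m, k m = hX.mid (k i) (k j))
    (hquasi : ∀ γ, ∃ R : ℝ, ∀ i, dist (φ γ (k i)) (k (ρ γ i)) ≤ R)
    (hcont : ∀ i, Tendsto (fun γ => k (ρ γ i)) l (𝓝 (k i)))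
    (hunb : ¬ Bornology.IsBounded (Set.range k)) :
    Tendsto φ l (𝓝 1) := by
  have hne : (Set.range k).Nonempty := by
    by_contra h
    rw [Set.not_nonempty_iff_eq_empty] at h
    exact hunb (h ▸ Bornology.isBounded_empty)
  obtain ⟨x, i₀, hx⟩ := hne
  set P := closure (Set.range k) with hP
  have hPcl : IsClosed P := isClosed_closure
  have hkP : ∀ i, k i ∈ P := fun i => subset_closure (Set.mem_range_self i)
  have hxP : x ∈ P := hx ▸ hkP i₀
  have hPmid : ∀ x ∈ P, ∀ y ∈ P, hX.mid x y ∈ P := fun x hx y hy =>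
    map_mem_closure₂ hX.isMidpointMap.continuous_uncurry hx hy (by
      rintro _ ⟨i, rfl⟩ _ ⟨j, rfl⟩
      obtain ⟨m, hm⟩ := hmid i j
      exact ⟨m, hm⟩)
  -- `f γ` is the isometric self-map of `P` that extends `ρ γ`; it stays at bounded distance from `φ
  -- γ`, so both have the same effect at infinity.
  choose f hfP hfd hfk using fun γ => exists_isometric_extension k (ρ γ) (hρ γ)
  have hfquasi : ∀ γ, ∃ R : ℝ, ∀ y ∈ P, dist (φ γ y) (f γ y) ≤ R := by
    intro γ
    obtain ⟨R, hR⟩ := hquasi γ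
    refine ⟨R + 2, fun y hy => ?_⟩
    obtain ⟨_, ⟨i, rfl⟩, hi⟩ := Metric.mem_closure_iff.1 hy 1 one_pos
    have h1 := dist_triangle4 (φ γ y) (φ γ (k i)) (k (ρ γ i)) (f γ y)
    rw [(φ γ).dist_eq, ← hfk γ i, hfd γ _ (hkP i) _ hy, dist_comm (k i) y] at h1
    have h2 := hR i
    rw [← hfk γ i] at h2
    linarith
  have hflim : ∀ y ∈ P, Tendsto (fun γ => f γ y) l (𝓝 y) := by
    intro y hy
    rw [Metric.tendsto_nhds]
    intro ε hε
    obtain ⟨_, ⟨i, rfl⟩, hi⟩ := Metric.mem_closure_iff.1 hy (ε / 3) (by positivity)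
    filter_upwards [Metric.tendsto_nhds.1 (hcont i) (ε / 3) (by positivity)] with γ hγ
    have h1 := dist_triangle4 (f γ y) (f γ (k i)) (k i) y
    rw [hfd γ _ hy _ (hkP i), hfk, dist_comm (k i) y] at h1
    linarith
  set C : Set (Boundary X) := {ξ | ∀ t, (hX.ray x ξ).toFun t ∈ P} with hC
  have hCcl : IsClosed C := by
    have : C = ⋂ t, (fun ξ => (hX.ray x ξ).toFun t) ⁻¹' P := by ext ξ; simp [hC]
    rw [this]
    exact isClosed_iInter fun t => hPcl.preimage (hX.continuous_ray x t)
  have hCne : C.Nonempty := by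
    have hex : ∀ n : ℕ, ∃ i, (n : ℝ) < dist x (k i) := by
      by_contra! h
      obtain ⟨n, hn⟩ := h
      refine hunb ((Metric.isBounded_iff_subset_closedBall x).2 ⟨n, ?_⟩)
      rintro _ ⟨i, rfl⟩
      rw [Metric.mem_closedBall, dist_comm]
      exact hn i
    choose i hi using hex
    choose σ h0 h1 hσ using fun n : ℕ => hX.exists_unitGeodesic x (k (i n))
    have hlen : Tendsto (fun n => dist x (σ n 1)) (hyperfilter ℕ) atTop := by
      refine tendsto_atTop_mono (f := fun k : ℕ => (k : ℝ)) (fun n => ?_) ?_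
      · rw [h1]; exact (hi n).le
      · exact tendsto_natCast_atTop_atTop.mono_left
          (by simpa [Nat.cofinite_eq_atTop] using (hyperfilter_le_cofinite (α := ℕ)))
    obtain ⟨c, hc0, hc⟩ := exists_ray_of_segments (hyperfilter ℕ) x σ h0 hσ hlen
    refine ⟨c.endpoint, fun t => ?_⟩
    rw [← hX.eq_ray hc0 rfl]
    refine hPcl.mem_of_tendsto (hc t) ?_
    filter_upwards [hlen.eventually_ge_atTop (t : ℝ), hlen.eventually_gt_atTop 0] with n ht hpos
    exact mem_of_isUnitGeodesic hX hPcl hPmid (hσ n) (by rw [h0]; exact hxP)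
      (by rw [h1]; exact hkP _) ⟨by positivity, div_le_one_of_le₀ ht hpos.le⟩
  -- The image of a ray in `P`, up to bounded error.
  have himg : ∀ γ, ∀ ξ ∈ C, ∃ c : GeodesicRay X, (∀ t, c.toFun t = f γ ((hX.ray x ξ).toFun t)) ∧
      c.endpoint = φ γ • ξ := by
    intro γ ξ hξ
    refine ⟨⟨fun t => f γ ((hX.ray x ξ).toFun t), Isometry.of_dist_eq fun s t => ?_⟩,
      fun t => rfl, ?_⟩
    · rw [hfd γ _ (hξ s) _ (hξ t), (hX.ray x ξ).isometry.dist_eq]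
    · obtain ⟨R, hR⟩ := hfquasi γ
      conv_rhs => rw [← hX.ray_endpoint x ξ, GeodesicRay.smul_endpoint]
      rw [GeodesicRay.endpoint_eq_iff]
      exact ⟨R, fun t => by rw [dist_comm]; exact hR _ (hξ t)⟩
  have hCinv : ∀ γ, ∀ ξ ∈ C, φ γ • ξ ∈ C := by
    intro γ ξ hξ t
    obtain ⟨c, hc, hce⟩ := himg γ ξ hξ
    rw [← hce]
    exact ray_mem_of_mem hX hPcl hPmid hxP (fun s => by rw [hc]; exact hfP γ _ (hξ s)) t
  refine hind.tendsto_one hX hl hCne hCcl hCinv fun ξ hξ => ?_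
  rw [hX.tendsto_boundary_iff x]
  intro t
  set z := (hX.ray x ξ).toFun t with hz
  rw [tendsto_iff_dist_tendsto_zero]
  have h1 : Tendsto (fun q : Δ × C => dist x (f q.1 x)) (l ×ˢ comap Subtype.val (𝓝 ξ))
      (𝓝 (dist x x)) := tendsto_const_nhds.dist ((hflim x hxP).comp tendsto_fst)
  have h2 : Tendsto (fun q : Δ × C => dist ((hX.ray x (q.2 : Boundary X)).toFun t) z)
      (l ×ˢ comap Subtype.val (𝓝 ξ)) (𝓝 (dist z z)) := by
    refine Tendsto.dist ?_ tendsto_const_nhds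
    exact (((hX.continuous_ray x t).tendsto ξ).comp tendsto_comap).comp tendsto_snd
  have h3 : Tendsto (fun q : Δ × C => dist (f q.1 z) z) (l ×ˢ comap Subtype.val (𝓝 ξ))
      (𝓝 (dist z z)) := ((hflim z (hξ t)).comp tendsto_fst).dist tendsto_const_nhds
  refine squeeze_zero (fun _ => dist_nonneg) (fun q => ?_)
    (by simpa only [dist_self, add_zero] using (h1.add h2).add h3)
  obtain ⟨c, hc, hce⟩ := himg q.1 q.2 q.2.2
  -- The ray to the moved point is within `dist x (f γ x)` of the image under `f γ` of the old ray.
  -- As `f γ` is isometric on `P`, the remaining errors are those at time `t` between the two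
  -- boundary points and of `f γ` at `z`.
  have a1 := hX.dist_ray_le hce x t
  rw [hc, hc, hX.ray_zero] at a1
  have a2 := hfd q.1 _ (q.2.2 t) _ (hξ t)
  have a3 := dist_triangle4 ((hX.ray x (φ q.1 • (q.2 : Boundary X))).toFun t)
    (f q.1 ((hX.ray x (q.2 : Boundary X)).toFun t)) (f q.1 z) z
  rw [a2] at a3
  linarith

end Indecomposable

/-! ### Fundamental domains of uniform lattices -/

section Domain

/-- Finitely many compact neighbourhoods cover the quotient by right multiplication by `Γ`;
inversion turns their union into a set for the left action. -/
theorem exists_compact_cover {G : Type*} [Group G] [TopologicalSpace G] [IsTopologicalGroup G]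
    [LocallyCompactSpace G] (Γ : Subgroup G) [CompactSpace (G ⧸ Γ)] :
    ∃ K : Set G, IsCompact K ∧ ∀ x : G, ∃ γ : Γ, (γ : G) * x ∈ K := by
  choose V hV hVn using fun x : G => exists_compact_mem_nhds x
  have hopen : ∀ x : G, IsOpen ((QuotientGroup.mk : G → G ⧸ Γ) '' interior (V x)) := fun x =>
    QuotientGroup.isOpenMap_coe _ isOpen_interior
  obtain ⟨t, ht⟩ := isCompact_univ.elim_finite_subcover
    (fun x : G => (QuotientGroup.mk : G → G ⧸ Γ) '' interior (V x)) hopen (by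
      intro q _
      obtain ⟨x, rfl⟩ := QuotientGroup.mk_surjective q
      exact Set.mem_iUnion.2 ⟨x, x, mem_interior_iff_mem_nhds.2 (hVn x), rfl⟩)
  refine ⟨(⋃ x ∈ t, V x)⁻¹, (t.isCompact_biUnion fun x _ => hV x).inv, fun x => ?_⟩
  have := ht (Set.mem_univ (QuotientGroup.mk x⁻¹ : G ⧸ Γ))
  simp only [Set.mem_iUnion] at this
  obtain ⟨y, hy, z, hz, hzx⟩ := this
  have hmem : x * z ∈ Γ := by
    have := QuotientGroup.eq.1 hzx.symm
    simpa using this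
  refine ⟨⟨(x * z)⁻¹, Γ.inv_mem hmem⟩, ?_⟩
  simp only [mul_inv_rev, inv_mul_cancel_right, Set.mem_inv, inv_inv, Set.mem_iUnion]
  exact ⟨y, hy, interior_subset hz⟩

theorem countable_of_discrete {G : Type*} [Group G] [TopologicalSpace G]
    [SecondCountableTopology G] (Γ : Subgroup G) [DiscreteTopology Γ] : Countable Γ :=
  TopologicalSpace.separableSpace_iff_countable.1 inferInstance

variable {G : Type*} [Group G] [TopologicalSpace G] [MeasurableSpace G]

/-- `D` is a relatively compact measurable fundamental domain of finite positive measure for the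
left action of `Γ`, over which integrals of `Γ`-invariant functions are right-invariant. -/
class IsLatticeDomain (Γ : Subgroup G) (μ : Measure G) (D : Set G) : Prop where
  measurableSet : MeasurableSet D
  measure_ne_zero : μ D ≠ 0
  measure_ne_top : μ D ≠ ⊤
  subset_compact : ∃ K, IsCompact K ∧ D ⊆ K
  existsUnique : ∀ x : G, ∃! γ : Γ, (γ : G) * x ∈ D
  finite_translates : ∀ K : Set G, IsCompact K → {γ : Γ | ∃ x ∈ K, (γ : G) * x ∈ D}.Finite
  lintegral_mul_right : ∀ f : G → ℝ≥0∞, (∀ (γ : Γ) (x : G), f (γ * x) = f x) →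
    ∀ g : G, ∫⁻ x in D, f (x * g) ∂μ = ∫⁻ x in D, f x ∂μ

namespace IsLatticeDomain

/-- Every point is moved into `D` by one of countably many measure-preserving left translations. -/
theorem ae_of_ae_restrict {Γ : Subgroup G} [Countable Γ] {μ : Measure G} [μ.IsMulLeftInvariant]
    [MeasurableMul G] {D : Set G} [h : IsLatticeDomain Γ μ D] {P : G → Prop}
    (hinv : ∀ (γ : Γ) (x : G), P (γ * x) → P x) (hP : ∀ᵐ x ∂μ.restrict D, P x) :
    ∀ᵐ x ∂μ, P x := by
  rw [ae_restrict_iff' h.measurableSet] at hP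
  have : ∀ γ : Γ, ∀ᵐ x ∂μ, (γ : G) * x ∈ D → P (γ * x) := fun γ =>
    (measurePreserving_mul_left μ (γ : G)).quasiMeasurePreserving.ae hP
  filter_upwards [ae_all_iff.2 this] with x hx
  obtain ⟨γ, hγ, -⟩ := h.existsUnique x
  exact hinv γ x (hx γ hγ)

end IsLatticeDomain

variable [IsTopologicalGroup G] [SecondCountableTopology G] [T2Space G] [BorelSpace G] [LocallyCompactSpace G]

/-- Countably many small pieces of a compact set meet every orbit, each piece meeting it at most
once. Removing from each piece the orbits met by earlier ones leaves exactly one point per orbit. -/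
theorem exists_fundamental_set (Γ : Subgroup G) [DiscreteTopology Γ] [CompactSpace (G ⧸ Γ)] :
    ∃ D : Set G, MeasurableSet D ∧ (∃ K, IsCompact K ∧ D ⊆ K) ∧
      ∀ x : G, ∃! γ : Γ, (γ : G) * x ∈ D := by
  have := countable_of_discrete Γ
  obtain ⟨K, hK, hcov⟩ := exists_compact_cover Γ
  obtain ⟨U, hU, hUΓ⟩ : ∃ U ∈ 𝓝 (1 : G), ∀ γ : Γ, (γ : G) ∈ U → γ = 1 := by
    have h1 : ({1} : Set Γ) ∈ 𝓝 (1 : Γ) := mem_nhds_discrete.2 rfl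
    rw [nhds_subtype_eq_comap] at h1
    obtain ⟨U, hU, h⟩ := h1
    exact ⟨U, hU, fun γ hγ => h hγ⟩
  obtain ⟨V, hV, hV1, hVV⟩ := exists_open_nhds_one_split (show U ∈ 𝓝 1 from hU)
  set W := V ∩ V⁻¹ with hW
  have hWo : IsOpen W := hV.inter hV.inv
  have hW1 : (1 : G) ∈ W := ⟨hV1, by simpa using hV1⟩
  have : Nonempty G := ⟨1⟩
  set d := TopologicalSpace.denseSeq G
  -- Two points of `E n` differ on the left by an element of `W * W⁻¹ ⊆ U`, which contains no
  -- lattice element but `1`.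
  let E : ℕ → Set G := fun n => {x | x * (d n)⁻¹ ∈ W} ∩ K
  have hE : ∀ n, MeasurableSet (E n) := fun n =>
    ((hWo.preimage (continuous_mul_const _)).measurableSet).inter hK.measurableSet
  have hEinj : ∀ n (γ : Γ) (x : G), x ∈ E n → (γ : G) * x ∈ E n → γ = 1 := by
    rintro n γ x ⟨hx, -⟩ ⟨hγ, -⟩
    refine hUΓ γ ?_
    have := hVV _ hγ.1 _ hx.2
    simpa [mul_assoc] using this
  have hEcov : ∀ x : G, ∃ n, ∃ γ : Γ, (γ : G) * x ∈ E n := by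
    intro x
    obtain ⟨γ, hγ⟩ := hcov x
    have ho : IsOpen {y : G | (γ : G) * x * y⁻¹ ∈ W} := hWo.preimage (by fun_prop)
    obtain ⟨n, hn⟩ := (TopologicalSpace.denseRange_denseSeq G).exists_mem_open ho
      ⟨(γ : G) * x, by simpa using hW1⟩
    exact ⟨n, γ, hn, hγ⟩
  let sat : ℕ → Set G := fun n => ⋃ γ : Γ, {x | (γ : G) * x ∈ E n}
  have hsat : ∀ n, MeasurableSet (sat n) := fun n =>
    MeasurableSet.iUnion fun γ => (measurable_const_mul (γ : G)) (hE n)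
  have hsatinv : ∀ n (γ : Γ) (x : G), (γ : G) * x ∈ sat n ↔ x ∈ sat n := by
    intro n γ x
    simp only [sat, Set.mem_iUnion, Set.mem_ofPred_eq]
    constructor
    · rintro ⟨δ, h⟩
      exact ⟨δ * γ, by simpa [mul_assoc] using h⟩
    · rintro ⟨δ, h⟩
      exact ⟨δ * γ⁻¹, by simpa [mul_assoc] using h⟩
  refine ⟨⋃ n, E n \ ⋃ m ∈ Set.Iio n, sat m, ?_, ⟨K, hK, ?_⟩, fun x => ?_⟩
  · exact MeasurableSet.iUnion fun n => (hE n).diff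
      (MeasurableSet.biUnion (Set.to_countable _) fun m _ => hsat m)
  · exact Set.iUnion_subset fun n => Set.sdiff_subset.trans Set.inter_subset_right
  · classical
    have hx := hEcov x
    have hmin : ∀ m < Nat.find hx, x ∉ sat m := fun m hm h => by
      simp only [sat, Set.mem_iUnion] at h
      exact Nat.find_min hx hm h
    have huniq : ∀ n (γ : Γ), (γ : G) * x ∈ E n \ ⋃ m ∈ Set.Iio n, sat m → n = Nat.find hx := by
      rintro n γ ⟨h1, h2⟩
      refine le_antisymm ?_ (Nat.find_min' hx ⟨γ, h1⟩)
      by_contra! hlt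
      refine h2 (Set.mem_biUnion hlt ((hsatinv _ _ _).2 ?_))
      exact Set.mem_iUnion.2 (Nat.find_spec hx)
    obtain ⟨γ, hγ⟩ := Nat.find_spec hx
    refine ⟨γ, Set.mem_iUnion.2 ⟨Nat.find hx, hγ, ?_⟩, fun γ' hγ' => ?_⟩
    · simp only [Set.mem_iUnion, not_exists]
      exact fun m hm h => hmin m hm ((hsatinv _ _ _).1 h)
    · obtain ⟨n, hn⟩ := Set.mem_iUnion.1 hγ'
      have hn' := huniq n γ' hn
      subst hn'
      have := hEinj _ (γ' * γ⁻¹) _ hγ (by simpa [mul_assoc] using hn.1)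
      exact mul_inv_eq_one.1 this

/-- Haar measure is right-invariant on fundamental domains of a uniform lattice. -/
theorem exists_isLatticeDomain (Γ : Subgroup G) [DiscreteTopology Γ] [CompactSpace (G ⧸ Γ)]
    (μ : Measure G) [μ.IsHaarMeasure] : ∃ D, IsLatticeDomain Γ μ D := by
  have := countable_of_discrete Γ
  obtain ⟨D, hD, ⟨K, hK, hDK⟩, huniq⟩ := exists_fundamental_set Γ
  have hfin : μ D ≠ ⊤ := ((measure_mono hDK).trans_lt hK.measure_lt_top).ne
  have hfd : ∀ g : G, IsFundamentalDomain Γ {x | x * g ∈ D} μ := fun g =>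
    IsFundamentalDomain.mk' ((measurable_mul_const g) hD).nullMeasurableSet fun x => by
      simpa [Subgroup.smul_def, mul_assoc] using huniq (x * g)
  have hfdD : IsFundamentalDomain Γ D μ := by simpa using hfd 1
  have hpos : μ D ≠ 0 := hfdD.measure_ne_zero (NeZero.ne μ)
  -- A right translate of `μ` is a multiple of `μ`. The factor is `1` because `D * g⁻¹` is again a
  -- fundamental domain and so has the same finite positive measure as `D`.
  have hright : ∀ g : G, μ.map (· * g) = μ := by
    intro g
    have h1 := Measure.isMulLeftInvariant_eq_smul (μ.map (· * g)) μ
    set c := Measure.haarScalarFactor (μ.map (· * g)) μ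
    have h2 : μ.map (· * g) D = μ D := by
      rw [Measure.map_apply (measurable_mul_const g) hD]
      exact (hfd g).measure_eq hfdD
    rw [h1, Measure.smul_apply] at h2
    have h3 : (c : ℝ≥0∞) = 1 := by
      rw [ENNReal.smul_def, smul_eq_mul] at h2
      calc (c : ℝ≥0∞) = c * μ D / μ D := (ENNReal.mul_div_cancel_right hpos hfin).symm
        _ = 1 := by rw [h2, ENNReal.div_self hpos hfin]
    rw [h1, show c = 1 from by exact_mod_cast h3, one_smul]
  have hfinite : ∀ Q : Set G, IsCompact Q → {γ : Γ | ∃ x ∈ Q, (γ : G) * x ∈ D}.Finite := by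
    intro Q hQ
    have hcl : IsClosed (Γ : Set G) := Subgroup.isClosed_of_discrete
    have hcomp : IsCompact ((↑) ⁻¹' (K * Q⁻¹) : Set Γ) :=
      hcl.isClosedEmbedding_subtypeVal.isCompact_preimage (hK.mul hQ.inv)
    refine hcomp.finite_of_discrete.subset ?_
    rintro γ ⟨x, hx, hγ⟩
    exact ⟨_, hDK hγ, x⁻¹, Set.inv_mem_inv.2 hx, by simp⟩
  refine ⟨D, hD, hpos, hfin, ⟨K, hK, hDK⟩, huniq, hfinite, fun f hf g => ?_⟩
  have hemb : MeasurableEmbedding (· * g : G → G) := measurableEmbedding_mulRight g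
  have h1 : ∫⁻ x in {x | x * g⁻¹ ∈ D}, f x ∂μ = ∫⁻ x in D, f (x * g) ∂μ := by
    conv_lhs => rw [← hright g]
    rw [hemb.restrict_map, hemb.lintegral_map]
    simp
  rw [← h1]
  exact (hfd g⁻¹).setLIntegral_eq hfdD f fun γ x => hf γ x

/-! ### Measurable length functions -/

/-- This is Steinhaus' theorem: the quotients of elements of a set of positive Haar measure fill a
neighbourhood of `1`. -/
theorem length_le_mem_nhds_one (μ : Measure G) [μ.IsHaarMeasure] {q : G → ℝ} (hq : Measurable q)
    (hdiv : ∀ g h, q (g / h) ≤ q g + q h) {r : ℝ} (hr : μ {g | q g ≤ r} ≠ 0) :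
    {g | q g ≤ 2 * r} ∈ 𝓝 (1 : G) := by
  have hm : MeasurableSet {g | q g ≤ r} := measurableSet_le hq measurable_const
  refine mem_of_superset (Measure.div_mem_nhds_one_of_haar_pos μ _ hm (pos_iff_ne_zero.2 hr)) ?_
  rintro _ ⟨g, hg, h, hh, rfl⟩
  have h1 : q g ≤ r := hg
  have h2 : q h ≤ r := hh
  have := hdiv g h
  simp only [Set.mem_ofPred_eq]
  linarith

/-- Some sublevel set has positive measure, so `q` is bounded near `1`; subadditivity carries the
bound to neighbourhoods of all points. -/
theorem length_bounded_on_compact (μ : Measure G) [μ.IsHaarMeasure] {q : G → ℝ}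
    (hq : Measurable q) (hdiv : ∀ g h, q (g / h) ≤ q g + q h) (hinv : ∀ g, q g⁻¹ = q g)
    {K : Set G} (hK : IsCompact K) : ∃ C : ℝ, ∀ g ∈ K, q g ≤ C := by
  obtain ⟨n, hn⟩ : ∃ n : ℕ, μ {g | q g ≤ n} ≠ 0 := by
    by_contra! h
    have h1 : μ (⋃ n : ℕ, {g | q g ≤ n}) = 0 := measure_iUnion_null h
    have h2 : ⋃ n : ℕ, {g | q g ≤ n} = Set.univ :=
      Set.eq_univ_of_forall fun g => Set.mem_iUnion.2 (exists_nat_ge (q g))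
    rw [h2] at h1
    exact NeZero.ne μ (Measure.measure_univ_eq_zero.1 h1)
  have hW := length_le_mem_nhds_one μ hq hdiv hn
  refine hK.induction_on (p := fun S => ∃ C : ℝ, ∀ g ∈ S, q g ≤ C) ⟨0, by simp⟩
    (fun s t hst ⟨C, hC⟩ => ⟨C, fun g hg => hC g (hst hg)⟩)
    (fun s t ⟨C, hC⟩ ⟨C', hC'⟩ => ⟨max C C', ?_⟩) fun x _ => ?_
  · rintro g (hg | hg)
    · exact (hC g hg).trans (le_max_left _ _)
    · exact (hC' g hg).trans (le_max_right _ _)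
  · refine ⟨{y | q (x⁻¹ * y) ≤ 2 * n}, mem_nhdsWithin_of_mem_nhds ?_, q x + 2 * n, fun y hy => ?_⟩
    · have : Tendsto (fun y => x⁻¹ * y) (𝓝 x) (𝓝 1) := by
        have h := (continuous_const_mul x⁻¹).tendsto x
        rwa [inv_mul_cancel] at h
      exact this hW
    · have h1 := hdiv x (x⁻¹ * y)⁻¹
      rw [div_inv_eq_mul, mul_inv_cancel_left, hinv] at h1
      have h2 : q (x⁻¹ * y) ≤ 2 * n := hy
      linarith

end Domain

/-! ### Square-integrable equivariant maps -/

/-- Measurable `Γ`-equivariant maps `G → X` that are square-integrable on `D`. -/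
structure L2Map {G : Type*} [Group G] [MeasurableSpace G] {X : Type*} [MetricSpace X]
    [MeasurableSpace X] {Γ : Subgroup G} (μ : Measure G) (D : Set G) (φ : Γ →* (X ≃ᵢ X)) where
  /-- The underlying map. -/
  toFun : G → X
  measurable' : Measurable toFun
  equivariant' : ∀ (γ : Γ) (x : G), toFun (γ * x) = φ γ (toFun x)
  memLp' : ∀ o : X, MemLp (fun x => dist (toFun x) o) 2 (μ.restrict D)

namespace L2Map

section Metric

variable {G : Type*} [Group G] [MeasurableSpace G] {X : Type*} [MetricSpace X] [ProperSpace X]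
  [MeasurableSpace X] [BorelSpace X] {Γ : Subgroup G} {μ : Measure G} {D : Set G}
  {φ : Γ →* (X ≃ᵢ X)}

instance : CoeFun (L2Map μ D φ) fun _ => G → X := ⟨toFun⟩

theorem measurable (f : L2Map μ D φ) : Measurable f := f.measurable'

theorem equivariant (f : L2Map μ D φ) (γ : Γ) (x : G) : f (γ * x) = φ γ (f x) :=
  f.equivariant' γ x

theorem measurable_dist (f g : L2Map μ D φ) : Measurable fun x => dist (f x) (g x) :=
  f.measurable.dist g.measurable

theorem dist_mul_left (f g : L2Map μ D φ) (γ : Γ) (x : G) :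
    dist (f (γ * x)) (g (γ * x)) = dist (f x) (g x) := by
  rw [f.equivariant, g.equivariant, IsometryEquiv.dist_eq]

theorem memLp_dist (f g : L2Map μ D φ) :
    MemLp (fun x => dist (f x) (g x)) 2 (μ.restrict D) := by
  refine ((f.memLp' (f 1)).add (g.memLp' (f 1))).mono (f.measurable_dist g).aestronglyMeasurable
    (Eventually.of_forall fun x => ?_)
  simp only [Pi.add_apply, Real.norm_eq_abs]
  rw [abs_of_nonneg dist_nonneg, abs_of_nonneg (by positivity)]
  exact dist_triangle_right _ _ _

/-- Maps that agree almost everywhere are not identified: genuine functions keep equivariance exact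
at every point, at the price of a pseudo-metric. -/
noncomputable instance : PseudoMetricSpace (L2Map μ D φ) where
  dist f g := (eLpNorm (fun x => dist (f x) (g x)) 2 (μ.restrict D)).toReal
  dist_self f := by simp
  dist_comm f g := by simp only [dist_comm]
  dist_triangle f g h := by
    have hfg := f.memLp_dist g
    have hgh := g.memLp_dist h
    rw [← ENNReal.toReal_add hfg.eLpNorm_ne_top hgh.eLpNorm_ne_top]
    refine ENNReal.toReal_mono (ENNReal.add_ne_top.2 ⟨hfg.eLpNorm_ne_top, hgh.eLpNorm_ne_top⟩) ?_
    refine le_trans (eLpNorm_mono_real fun x => ?_)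
      (eLpNorm_add_le hfg.aestronglyMeasurable hgh.aestronglyMeasurable (by norm_num))
    rw [Real.norm_eq_abs, abs_of_nonneg dist_nonneg]
    exact dist_triangle _ _ _

theorem dist_def (f g : L2Map μ D φ) :
    dist f g = (eLpNorm (fun x => dist (f x) (g x)) 2 (μ.restrict D)).toReal := rfl

theorem ofReal_dist (f g : L2Map μ D φ) :
    ENNReal.ofReal (dist f g) = eLpNorm (fun x => dist (f x) (g x)) 2 (μ.restrict D) := by
  rw [dist_def, ENNReal.ofReal_toReal (f.memLp_dist g).eLpNorm_ne_top]

theorem eLpNorm_two_sq {α : Type*} [MeasurableSpace α] {ν : Measure α} (a b : α → X) :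
    eLpNorm (fun x => dist (a x) (b x)) 2 ν ^ 2 = ∫⁻ x, edist (a x) (b x) ^ 2 ∂ν := by
  have h := eLpNorm_nnreal_pow_eq_lintegral (μ := ν) (f := fun x => dist (a x) (b x))
    (p := 2) two_ne_zero
  simp only [NNReal.coe_ofNat, ENNReal.coe_ofNat, ENNReal.rpow_ofNat] at h
  rw [h]
  refine lintegral_congr fun x => ?_
  rw [Real.enorm_of_nonneg dist_nonneg, ← edist_dist]

theorem ofReal_dist_sq (f g : L2Map μ D φ) :
    ENNReal.ofReal (dist f g ^ 2) = ∫⁻ x in D, edist (f x) (g x) ^ 2 ∂μ := by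
  rw [ENNReal.ofReal_pow dist_nonneg, ofReal_dist, eLpNorm_two_sq]

theorem integrable_dist_sq (f g : L2Map μ D φ) :
    Integrable (fun x => dist (f x) (g x) ^ 2) (μ.restrict D) := (f.memLp_dist g).integrable_sq

theorem dist_sq (f g : L2Map μ D φ) : dist f g ^ 2 = ∫ x in D, dist (f x) (g x) ^ 2 ∂μ := by
  rw [integral_eq_lintegral_of_nonneg_ae (Eventually.of_forall fun x => sq_nonneg _)
    (f.integrable_dist_sq g).aestronglyMeasurable, ← ENNReal.toReal_ofReal (sq_nonneg (dist f g)),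
    ofReal_dist_sq]
  congr 1
  refine lintegral_congr fun x => ?_
  rw [ENNReal.ofReal_pow dist_nonneg, edist_dist]

theorem dist_eq_zero_iff (f g : L2Map μ D φ) :
    dist f g = 0 ↔ ∀ᵐ x ∂μ.restrict D, f x = g x := by
  rw [dist_def, ENNReal.toReal_eq_zero_iff, or_iff_left (f.memLp_dist g).eLpNorm_ne_top,
    eLpNorm_eq_zero_iff (f.measurable_dist g).aestronglyMeasurable two_ne_zero]
  simp only [EventuallyEq, Pi.zero_apply, dist_eq_zero]

/-- The pointwise midpoint of two maps. -/
noncomputable def mid (hX : IsCAT0 X) (f g : L2Map μ D φ) : L2Map μ D φ where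
  toFun x := hX.mid (f x) (g x)
  measurable' := hX.isMidpointMap.continuous_uncurry.measurable.comp
    (f.measurable.prodMk g.measurable)
  equivariant' γ x := by rw [f.equivariant, g.equivariant, hX.map_mid]
  memLp' o := by
    have hm : Measurable fun x => hX.mid (f x) (g x) :=
      hX.isMidpointMap.continuous_uncurry.measurable.comp (f.measurable.prodMk g.measurable)
    refine ((f.memLp' o).add (g.memLp' o)).mono
      (hm.dist measurable_const).aestronglyMeasurable (Eventually.of_forall fun x => ?_)
    simp only [Pi.add_apply, Real.norm_eq_abs]
    rw [abs_of_nonneg dist_nonneg, abs_of_nonneg (by positivity)]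
    have h1 := hX.isMidpointMap.cn (f x) (g x) o
    refine abs_le_of_sq_le_sq' ?_ (by positivity) |>.2
    nlinarith [sq_nonneg (dist (f x) (g x)), mul_nonneg (dist_nonneg (x := f x) (y := o))
      (dist_nonneg (x := g x) (y := o)), sq_nonneg (dist (f x) o), sq_nonneg (dist (g x) o)]

theorem mid_apply (hX : IsCAT0 X) (f g : L2Map μ D φ) (x : G) :
    mid hX f g x = hX.mid (f x) (g x) := rfl

theorem isMidpointMap (hX : IsCAT0 X) : IsMidpointMap (mid hX : L2Map μ D φ → _ → _) where
  cn f g h := by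
    rw [dist_sq, dist_sq, dist_sq, dist_sq, ← integral_const_mul, ← integral_const_mul,
      ← integral_add ((integrable_dist_sq _ _).const_mul _) ((integrable_dist_sq _ _).const_mul _),
      ← integral_add (integrable_dist_sq _ _) (integrable_dist_sq _ _)]
    refine integral_mono (((integrable_dist_sq _ _).const_mul _).add
      ((integrable_dist_sq _ _).const_mul _))
      ((integrable_dist_sq _ _).add (integrable_dist_sq _ _)) fun x => ?_
    exact hX.isMidpointMap.cn (f x) (g x) (h x)

/-- As in the Riesz–Fischer theorem, a rapidly Cauchy sequence converges almost everywhere on `D`.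
The Kuratowski embedding into a normed space gives access to the linear version. -/
instance : CompleteSpace (L2Map μ D φ) := by
  refine Metric.complete_of_convergent_controlled_sequences (fun n => (1 / 2 : ℝ) ^ n)
    (fun n => by positivity) fun u hu => ?_
  have hu' : ∀ N n m : ℕ, N ≤ n → N ≤ m →
      eLpNorm (fun x => dist (u n x) (u m x)) 2 (μ.restrict D) < (1 / 2 : ℝ≥0∞) ^ N := by
    intro N n m hn hm
    rw [← ofReal_dist]
    have h1 := (ENNReal.ofReal_lt_ofReal_iff (by positivity)).2 (hu N n m hn hm)
    refine h1.trans_eq ?_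
    rw [ENNReal.ofReal_pow (by positivity), ENNReal.ofReal_div_of_pos two_pos]
    simp
  set ψ := kuratowskiEmbedding X
  have hψ : Isometry ψ := kuratowskiEmbedding.isometry X
  have hae : ∀ᵐ x ∂μ.restrict D, ∃ l, Tendsto (fun n => u n x) atTop (𝓝 l) := by
    have h1 := Lp.ae_tendsto_of_cauchy_eLpNorm (μ := μ.restrict D) (p := 2)
      (f := fun n x => ψ (u n x))
      (fun n => (hψ.continuous.comp_stronglyMeasurable
        (u n).measurable.stronglyMeasurable).aestronglyMeasurable)
      (by norm_num) (B := fun N => (1 / 2 : ℝ≥0∞) ^ N)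
      (by rw [ENNReal.tsum_geometric]; simp) (fun N n m hn hm => by
        refine lt_of_eq_of_lt ?_ (hu' N n m hn hm)
        refine eLpNorm_congr_norm_ae (Eventually.of_forall fun x => ?_)
        rw [Pi.sub_apply, ← dist_eq_norm, hψ.dist_eq, Real.norm_of_nonneg dist_nonneg])
    filter_upwards [h1] with x ⟨l, hl⟩
    refine cauchySeq_tendsto_of_complete ?_
    have h2 := Metric.cauchySeq_iff.1 hl.cauchySeq
    simp only [hψ.dist_eq] at h2
    exact Metric.cauchySeq_iff.2 h2
  -- The convergence set is measurable and `Γ`-invariant; using `u 0` off it makes the limit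
  -- measurable and equivariant everywhere.
  let S : Set G := {x | ∃ l, Tendsto (fun n => u n x) atTop (𝓝 l)}
  have hS : MeasurableSet S := measurableSet_exists_tendsto fun n => (u n).measurable
  have hSinv : ∀ (γ : Γ) (x : G), (γ : G) * x ∈ S ↔ x ∈ S := by
    intro γ x
    simp only [S, Set.mem_ofPred_eq, equivariant]
    constructor
    · rintro ⟨l, hl⟩
      exact ⟨(φ γ).symm l, by
        simpa [Function.comp_def] using ((φ γ).symm.continuous.tendsto l).comp hl⟩
    · rintro ⟨l, hl⟩
      exact ⟨φ γ l, ((φ γ).continuous.tendsto l).comp hl⟩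
  classical
  let f : G → X := fun x => if h : x ∈ S then h.choose else u 0 x
  have hf : ∀ x ∈ S, Tendsto (fun n => u n x) atTop (𝓝 (f x)) := fun x hx => by
    simp only [f, hx, dif_pos]
    exact Exists.choose_spec (p := fun l => Tendsto (fun n => u n x) atTop (𝓝 l)) hx
  have hf' : ∀ x ∉ S, f x = u 0 x := fun x hx => by simp [f, hx]
  have hfm : Measurable f := by
    refine measurable_of_tendsto_metrizable (f := fun n x => if x ∈ S then u n x else u 0 x)
      (fun n => Measurable.ite hS (u n).measurable (u 0).measurable) ?_
    rw [tendsto_pi_nhds]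
    intro x
    by_cases hx : x ∈ S
    · simpa [hx] using hf x hx
    · simp [hx, hf' x hx]
  have hfeq : ∀ (γ : Γ) (x : G), f (γ * x) = φ γ (f x) := by
    intro γ x
    by_cases hx : x ∈ S
    · refine tendsto_nhds_unique (hf _ ((hSinv γ x).2 hx)) ?_
      simp only [equivariant]
      exact ((φ γ).continuous.tendsto _).comp (hf x hx)
    · rw [hf' x hx, hf' _ (fun h => hx ((hSinv γ x).1 h)), equivariant]
  have hlim : ∀ N, eLpNorm (fun x => dist (u N x) (f x)) 2 (μ.restrict D) ≤ (1 / 2 : ℝ≥0∞) ^ N := by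
    intro N
    refine (Lp.eLpNorm_lim_le_liminf_eLpNorm (f := fun n x => dist (u N x) (u n x))
      (fun n => ((u N).measurable_dist (u n)).aestronglyMeasurable) _ ?_).trans ?_
    · filter_upwards [hae] with x hx
      exact tendsto_const_nhds.dist (hf x hx)
    · refine liminf_le_of_le ?_ ?_
      · isBoundedDefault
      · intro b hb
        obtain ⟨n, hn⟩ := (hb.and (eventually_ge_atTop N)).exists
        exact hn.1.trans (hu' N N n le_rfl hn.2).le
  let F : L2Map μ D φ := ⟨f, hfm, hfeq, fun o => by
    have h0 : MemLp (fun x => dist (u 0 x) (f x)) 2 (μ.restrict D) :=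
      ⟨((u 0).measurable.dist hfm).aestronglyMeasurable, (hlim 0).trans_lt (by simp)⟩
    refine (((u 0).memLp' o).add h0).mono (hfm.dist measurable_const).aestronglyMeasurable
      (Eventually.of_forall fun x => ?_)
    simp only [Pi.add_apply, Real.norm_eq_abs]
    rw [abs_of_nonneg dist_nonneg, abs_of_nonneg (by positivity), add_comm]
    exact dist_triangle_left _ _ _⟩
  refine ⟨F, tendsto_iff_dist_tendsto_zero.2 ?_⟩
  refine squeeze_zero (fun _ => dist_nonneg) (fun n => ?_)
    (tendsto_pow_atTop_nhds_zero_of_lt_one (r := (1 / 2 : ℝ)) (by norm_num) (by norm_num))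
  rw [dist_def]
  refine (ENNReal.toReal_mono (by simp) (hlim n)).trans_eq ?_
  simp

end Metric

/-! ### The isometric action of `G` by right translations -/

section Action

variable {G : Type*} [Group G] [TopologicalSpace G] [IsTopologicalGroup G]
  [SecondCountableTopology G] [MeasurableSpace G] [BorelSpace G] {X : Type*} [MetricSpace X]
  [ProperSpace X] [MeasurableSpace X] [BorelSpace X] {Γ : Subgroup G} {μ : Measure G} {D : Set G}
  [hD : IsLatticeDomain Γ μ D] [Countable Γ] {φ : Γ →* (X ≃ᵢ X)}

theorem lintegral_edist_mul_right (f g : L2Map μ D φ) (h : G) :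
    ∫⁻ x in D, edist (f (x * h)) (g (x * h)) ^ 2 ∂μ = ∫⁻ x in D, edist (f x) (g x) ^ 2 ∂μ :=
  hD.lintegral_mul_right (fun x => edist (f x) (g x) ^ 2) (fun γ x => by
    rw [f.equivariant, g.equivariant, IsometryEquiv.edist_eq]) h

theorem isFiniteMeasure_restrict (Γ : Subgroup G) (μ : Measure G) (D : Set G)
    [hD : IsLatticeDomain Γ μ D] : IsFiniteMeasure (μ.restrict D) :=
  ⟨by rw [Measure.restrict_apply_univ]; exact hD.measure_ne_top.lt_top⟩

/-- The equivariant map that is constant on the fundamental domain. -/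
noncomputable def const (hD : IsLatticeDomain Γ μ D) (φ : Γ →* (X ≃ᵢ X)) (o : X) :
    L2Map μ D φ where
  toFun x := (φ (hD.existsUnique x).choose)⁻¹ o
  measurable' := by
    intro S hS
    have : (fun x => (φ (hD.existsUnique x).choose)⁻¹ o) ⁻¹' S =
        ⋃ γ ∈ {γ : Γ | (φ γ)⁻¹ o ∈ S}, {x | (γ : G) * x ∈ D} := by
      ext x
      simp only [Set.mem_preimage, Set.mem_iUnion, Set.mem_ofPred_eq, exists_prop]
      constructor
      · exact fun h => ⟨_, h, (hD.existsUnique x).choose_spec.1⟩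
      · rintro ⟨γ, hγ, hx⟩
        rwa [← (hD.existsUnique x).choose_spec.2 γ hx]
    rw [this]
    exact MeasurableSet.biUnion (Set.to_countable _) fun γ _ =>
      (measurable_const_mul (γ : G)) hD.measurableSet
  equivariant' γ x := by
    have h1 : (hD.existsUnique (γ * x)).choose = (hD.existsUnique x).choose * γ⁻¹ :=
      ((hD.existsUnique (γ * x)).choose_spec.2 _ (by
        simpa [mul_assoc] using (hD.existsUnique x).choose_spec.1)).symm
    rw [h1]
    simp
  memLp' p := by
    have := isFiniteMeasure_restrict Γ μ D
    refine (memLp_const (dist o p)).ae_eq ?_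
    filter_upwards [ae_restrict_mem hD.measurableSet] with x hx
    have h1 : (hD.existsUnique x).choose = 1 :=
      ((hD.existsUnique x).choose_spec.2 1 (by simpa using hx)).symm
    change dist o p = dist ((φ (hD.existsUnique x).choose)⁻¹ o) p
    rw [h1]
    simp

theorem const_bounded (hD : IsLatticeDomain Γ μ D) (φ : Γ →* (X ≃ᵢ X)) (o p : X) {K : Set G}
    (hK : IsCompact K) : ∃ C : ℝ, ∀ x ∈ K, dist (const hD φ o x) p ≤ C := by
  obtain ⟨C, hC⟩ := ((hD.finite_translates K hK).image fun γ => dist ((φ γ)⁻¹ o) p).bddAbove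
  exact ⟨C, fun x hx => hC ⟨_, ⟨x, hx, (hD.existsUnique x).choose_spec.1⟩, rfl⟩⟩

/-- `G` acts on the equivariant maps by right translations of the variable. -/
noncomputable instance : MulAction G (L2Map μ D φ) where
  smul g f :=
    { toFun := fun x => f (x * g)
      measurable' := f.measurable.comp (measurable_mul_const g)
      equivariant' := fun γ x => by rw [mul_assoc, f.equivariant]
      memLp' := fun o => by
        have := isFiniteMeasure_restrict Γ μ D
        have hm : Measurable fun x => f (x * g) := f.measurable.comp (measurable_mul_const g)
        have hc : Measurable fun x => const hD φ o (x * g) :=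
          (const hD φ o).measurable.comp (measurable_mul_const g)
        -- Distances between equivariant maps are unchanged by translation, so it is enough to
        -- control the translate of one map; the map constant on `D` takes only finitely many values
        -- on a compact set.
        have h1 : MemLp (fun x => dist (f (x * g)) (const hD φ o (x * g))) 2 (μ.restrict D) := by
          refine ⟨(hm.dist hc).aestronglyMeasurable, ?_⟩
          have h2 := eLpNorm_two_sq (ν := μ.restrict D) (fun x => f (x * g))
            (fun x => const hD φ o (x * g))
          rw [lintegral_edist_mul_right, ← eLpNorm_two_sq] at h2
          refine lt_top_iff_ne_top.2 fun h3 => ?_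
          rw [h3] at h2
          exact ENNReal.pow_ne_top (f.memLp_dist (const hD φ o)).eLpNorm_ne_top
            (h2.symm.trans (by simp))
        have h2 : MemLp (fun x => dist (const hD φ o (x * g)) o) 2 (μ.restrict D) := by
          obtain ⟨K, hK, hDK⟩ := hD.subset_compact
          obtain ⟨C, hC⟩ := const_bounded hD φ o o (hK.image (continuous_mul_const g))
          refine MemLp.of_bound (hc.dist measurable_const).aestronglyMeasurable C ?_
          filter_upwards [ae_restrict_mem hD.measurableSet] with x hx
          rw [Real.norm_of_nonneg dist_nonneg]
          exact hC _ ⟨x, hDK hx, rfl⟩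
        refine (h1.add h2).mono (hm.dist measurable_const).aestronglyMeasurable
          (Eventually.of_forall fun x => ?_)
        simp only [Pi.add_apply, Real.norm_eq_abs]
        rw [abs_of_nonneg dist_nonneg, abs_of_nonneg (by positivity)]
        exact dist_triangle _ _ _ }
  one_smul f := by
    cases f
    change L2Map.mk _ _ _ _ = L2Map.mk _ _ _ _
    congr 1
    simp
  mul_smul g h f := by
    cases f
    change L2Map.mk _ _ _ _ = L2Map.mk _ _ _ _
    congr 1
    funext x
    exact congrArg _ (mul_assoc x g h).symm

theorem smul_apply (g : G) (f : L2Map μ D φ) (x : G) : (g • f) x = f (x * g) := rfl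

theorem dist_smul (g : G) (f h : L2Map μ D φ) : dist (g • f) (g • h) = dist f h := by
  have h1 : ENNReal.ofReal (dist (g • f) (g • h) ^ 2) = ENNReal.ofReal (dist f h ^ 2) := by
    rw [ofReal_dist_sq, ofReal_dist_sq, ← lintegral_edist_mul_right f h g]
    rfl
  rw [ENNReal.ofReal_eq_ofReal_iff (sq_nonneg _) (sq_nonneg _)] at h1
  exact (sq_eq_sq₀ dist_nonneg dist_nonneg).1 h1

theorem smul_mid (hX : IsCAT0 X) (g : G) (f h : L2Map μ D φ) :
    g • mid hX f h = mid hX (g • f) (g • h) := rfl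

theorem ofReal_dist_smul_sq (f : L2Map μ D φ) (g : G) :
    ENNReal.ofReal (dist f (g • f) ^ 2) = ∫⁻ x in D, edist (f x) (f (x * g)) ^ 2 ∂μ :=
  ofReal_dist_sq _ _

theorem measurable_displacement [SFinite μ] (f : L2Map μ D φ) :
    Measurable fun g : G => dist f (g • f) := by
  have h1 : Measurable fun g : G => ∫⁻ x in D, edist (f x) (f (x * g)) ^ 2 ∂μ := by
    refine Measurable.lintegral_prod_left' (f := fun q : G × G =>
      edist (f q.1) (f (q.1 * q.2)) ^ 2) ?_
    exact ((f.measurable.comp measurable_fst).edist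
      (f.measurable.comp (measurable_fst.mul measurable_snd))).pow_const 2
  have h2 : (fun g : G => dist f (g • f)) =
      fun g => √(∫⁻ x in D, edist (f x) (f (x * g)) ^ 2 ∂μ).toReal := by
    funext g
    rw [← ofReal_dist_smul_sq, ENNReal.toReal_ofReal (sq_nonneg _), Real.sqrt_sq dist_nonneg]
  rw [h2]
  exact h1.ennreal_toReal.sqrt

theorem displacement_inv (f : L2Map μ D φ) (g : G) : dist f (g⁻¹ • f) = dist f (g • f) := by
  rw [← dist_smul g, smul_inv_smul, dist_comm]

theorem displacement_mul (f : L2Map μ D φ) (g h : G) :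
    dist f ((g * h) • f) ≤ dist f (g • f) + dist f (h • f) := by
  have := dist_triangle f (g • f) (g • h • f)
  rw [dist_smul] at this
  rwa [mul_smul]

theorem displacement_div (f : L2Map μ D φ) (g h : G) :
    dist f ((g / h) • f) ≤ dist f (g • f) + dist f (h • f) := by
  rw [div_eq_mul_inv, ← displacement_inv f h]
  exact displacement_mul f g h⁻¹

theorem displacement_bounded [T2Space G] [LocallyCompactSpace G] [μ.IsHaarMeasure]
    (f : L2Map μ D φ) {K : Set G} (hK : IsCompact K) : ∃ C : ℝ, ∀ g ∈ K, dist f (g • f) ≤ C :=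
  length_bounded_on_compact μ f.measurable_displacement f.displacement_div f.displacement_inv hK

end Action

end L2Map

/-! ### Minimisation of convex functions -/

/-- A convex function on a closed convex set is minimised, or the projections of a point to its
sublevel sets form an unbounded sequence that is displaced little by the symmetries. -/
theorem IsMidpointMap.exists_minimizer_or_unbounded {Y : Type*} [PseudoMetricSpace Y]
    {mid : Y → Y → Y} [CompleteSpace Y] (h : IsMidpointMap mid) {S : Set Y} (hne : S.Nonempty)
    (hcl : IsClosed S) (hmid : ∀ x ∈ S, ∀ y ∈ S, mid x y ∈ S) {E : Y → ℝ} (hE : Continuous E)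
    (hpos : ∀ y, 0 ≤ E y) (hconv : ∀ x y, E (mid x y) ≤ 1 / 2 * E x + 1 / 2 * E y) (p : Y) :
    (∃ y ∈ S, ∀ s ∈ S, E y ≤ E s) ∨
      ∃ (c : ℝ) (t : ℕ → Y), (∀ k, t k ∈ S ∧ E (t k) ≤ c) ∧ (∀ R, ∃ k, R < dist p (t k)) ∧
        ∀ T T' : Y → Y, (∀ x y, dist (T x) (T y) = dist x y) → (∀ y, T (T' y) = y) →
          (∀ s ∈ S, T s ∈ S ∧ E (T s) ≤ E s) → (∀ s ∈ S, T' s ∈ S ∧ E (T' s) ≤ E s) →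
          ∀ k, dist (t k) (T (t k)) ^ 2 ≤ 2 * dist p (T p) ^ 2 := by
  have hbdd : BddBelow (E '' S) := ⟨0, by rintro _ ⟨y, -, rfl⟩; exact hpos y⟩
  set c := sInf (E '' S) with hc
  have hle : ∀ s ∈ S, c ≤ E s := fun s hs => csInf_le hbdd ⟨s, hs, rfl⟩
  let L : ℕ → Set Y := fun k => {y | y ∈ S ∧ E y ≤ c + 1 / ((k : ℝ) + 1)}
  have hLne : ∀ k, (L k).Nonempty := fun k => by
    obtain ⟨_, ⟨s, hs, rfl⟩, hlt⟩ :=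
      exists_lt_of_csInf_lt (hne.image E) (lt_add_of_pos_right c (Nat.one_div_pos_of_nat (n := k)))
    exact ⟨s, hs, hlt.le⟩
  have hLcl : ∀ k, IsClosed (L k) := fun k => hcl.inter (isClosed_le hE continuous_const)
  have hLmid : ∀ k, ∀ x ∈ L k, ∀ y ∈ L k, mid x y ∈ L k := fun k x hx y hy =>
    ⟨hmid x hx.1 y hy.1, by linarith [hconv x y, hx.2, hy.2]⟩
  choose t htL ht using fun k => h.exists_projection (hLne k) (hLcl k) (hLmid k) p
  by_cases hR : ∃ R, ∀ k, dist p (t k) ≤ R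
  · left
    obtain ⟨R, hR⟩ := hR
    have hanti : Antitone L := fun k l hkl y hy =>
      ⟨hy.1, hy.2.trans (by have := Nat.one_div_le_one_div (α := ℝ) hkl; linarith)⟩
    obtain ⟨y, hy⟩ := IsMidpointMap.exists_mem_iInter hanti hLcl htL ht hR
    refine ⟨y, (hy 0).1, fun s hs => le_trans ?_ (hle s hs)⟩
    refine ge_of_tendsto' (x := atTop) (f := fun k : ℕ => c + 1 / ((k : ℝ) + 1)) ?_ fun k => (hy k).2
    simpa using (tendsto_const_nhds (x := c)).add (tendsto_one_div_add_atTop_nhds_zero_nat (𝕜 := ℝ))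
  · right
    push Not at hR
    refine ⟨c + 1, t, fun k => ⟨(htL k).1, (htL k).2.trans ?_⟩, hR, ?_⟩
    · have := Nat.one_div_le_one_div (α := ℝ) (Nat.zero_le k)
      simp only [Nat.cast_zero, zero_add, div_one] at this
      linarith
    · intro T T' hT hTT' hS hS' k
      refine h.projection_lipschitz (S := L k) (htL k)
        ⟨(hS _ (htL k).1).1, (hS _ (htL k).1).2.trans (htL k).2⟩ (ht k) fun s hs => ?_
      have := ht k (T' s) ⟨(hS' s hs.1).1, (hS' s hs.1).2.trans hs.2⟩
      rwa [← hT p, ← hT (t k), ← hT p (T' s), hTT'] at this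

/-! ### Finite measures equivalent to a Haar measure -/

/-- A finite measure that dominates `ν` on compact sets and integrates a given function. -/
theorem exists_finite_dominating_measure {A : Type*} [TopologicalSpace A] [MeasurableSpace A]
    [WeaklyLocallyCompactSpace A] [SigmaCompactSpace A] (ν : Measure A)
    [IsFiniteMeasureOnCompacts ν] {f : A → ℝ≥0∞}
    (hfK : ∀ K, IsCompact K → ∃ C : ℝ≥0∞, C ≠ ⊤ ∧ ∀ a ∈ K, f a ≤ C) :
    ∃ m : Measure A, IsFiniteMeasure m ∧ ∫⁻ a, f a ∂m ≠ ⊤ ∧ ν ≪ m ∧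
      ∀ K, IsCompact K → ∃ C : ℝ≥0, ν.restrict K ≤ C • m := by
  set K := CompactExhaustion.choice A
  have hfin : ∀ k, ν (K k) + ∫⁻ a in K k, f a ∂ν ≠ ⊤ := fun k => by
    obtain ⟨C, hC, h⟩ := hfK (K k) (K.isCompact k)
    have h0 : ν (K k) ≠ ⊤ := (K.isCompact k).measure_ne_top
    refine ENNReal.add_ne_top.2 ⟨h0, ne_top_of_le_ne_top (ENNReal.mul_ne_top hC h0) ?_⟩
    exact (setLIntegral_mono measurable_const h).trans_eq (setLIntegral_const _ _)
  -- The weights are summable against both the masses of the exhausting compact sets and the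
  -- integrals of `f` over them.
  obtain ⟨ε, hε, hsum⟩ := ENNReal.exists_pos_tsum_mul_lt_of_countable one_ne_zero _ hfin
  set m := Measure.sum fun k => ε k • ν.restrict (K k) with hm
  have hle : ∀ k, ε k • ν.restrict (K k) ≤ m := fun k => Measure.le_sum _ k
  have hdom : ∀ Q, IsCompact Q → ∃ C : ℝ≥0, ν.restrict Q ≤ C • m := fun Q hQ => by
    obtain ⟨k, hk⟩ := K.exists_superset_of_isCompact hQ
    refine ⟨(ε k)⁻¹, (Measure.restrict_mono_set ν hk).trans ?_⟩
    have h1 : ν.restrict (K k) = (ε k)⁻¹ • ε k • ν.restrict (K k) := by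
      rw [smul_smul, inv_mul_cancel₀ (hε k).ne', one_smul]
    rw [h1]
    refine Measure.le_iff'.2 fun s => ?_
    have h2 := hle k s
    change (((ε k)⁻¹ : ℝ≥0) : ℝ≥0∞) * (ε k • ν.restrict (K k)) s ≤ (((ε k)⁻¹ : ℝ≥0) : ℝ≥0∞) * m s
    gcongr
  refine ⟨m, ⟨?_⟩, ?_, ?_, hdom⟩
  · rw [hm, Measure.sum_apply _ MeasurableSet.univ]
    refine (ENNReal.tsum_le_tsum fun k => ?_).trans_lt (hsum.trans ENNReal.one_lt_top)
    simp only [Measure.smul_apply, Measure.restrict_apply_univ]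
    rw [ENNReal.smul_def, smul_eq_mul, mul_comm]
    gcongr
    exact le_self_add
  · rw [hm, lintegral_sum_measure]
    refine ((ENNReal.tsum_le_tsum fun k => ?_).trans_lt (hsum.trans ENNReal.one_lt_top)).ne
    rw [lintegral_smul_measure, ENNReal.smul_def, smul_eq_mul, mul_comm]
    gcongr
    exact le_add_self
  · refine Measure.AbsolutelyContinuous.mk fun s hs h0 => ?_
    have h1 : ∀ k, ν (s ∩ K k) = 0 := fun k => by
      obtain ⟨C, hC⟩ := hdom _ (K.isCompact k)
      rw [← Measure.restrict_apply hs]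
      refine le_antisymm ((hC s).trans ?_) zero_le
      simp [h0]
    have h2 : s = ⋃ k, s ∩ K k := by rw [← Set.inter_iUnion, K.iUnion_eq, Set.inter_univ]
    rw [h2]
    exact measure_iUnion_null h1

namespace L2Map

variable {G : Type*} [Group G] [TopologicalSpace G] [IsTopologicalGroup G]
  [SecondCountableTopology G] [MeasurableSpace G] [BorelSpace G] {X : Type*} [MetricSpace X]
  [ProperSpace X] [MeasurableSpace X] [BorelSpace X] {Γ : Subgroup G} {μ : Measure G} {D : Set G}
  [hD : IsLatticeDomain Γ μ D] [Countable Γ] {φ : Γ →* (X ≃ᵢ X)}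

/-! ### The energy -/

section Energy

theorem continuous_smul_left (g : G) : Continuous fun y : L2Map μ D φ => g • y :=
  (Isometry.of_dist_eq (dist_smul g)).continuous

theorem displacement_le_add (g : G) (y y' : L2Map μ D φ) :
    dist y' (g • y') ≤ dist y (g • y) + 2 * dist y y' := by
  have h1 := dist_triangle4 y' y (g • y) (g • y')
  rw [dist_smul, dist_comm y' y] at h1
  linarith

theorem displacement_sq_le_add (g : G) (y y' : L2Map μ D φ) :
    dist y' (g • y') ^ 2 ≤ 2 * dist y (g • y) ^ 2 + 8 * dist y y' ^ 2 := by
  have h1 := pow_le_pow_left₀ dist_nonneg (displacement_le_add g y y') 2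
  nlinarith [sq_nonneg (dist y (g • y) - 2 * dist y y')]

theorem displacement_mid_sq_le (hX : IsCAT0 X) (g : G) (y y' : L2Map μ D φ) :
    dist (mid hX y y') (g • mid hX y y') ^ 2 ≤
      1 / 2 * dist y (g • y) ^ 2 + 1 / 2 * dist y' (g • y') ^ 2 := by
  have h1 := (isMidpointMap hX).dist_mid_mid y y' (g • y) (g • y')
  rw [← smul_mid] at h1
  have h2 := pow_le_pow_left₀ dist_nonneg h1 2
  nlinarith [sq_nonneg (dist y (g • y) - dist y' (g • y'))]

/-- If the midpoint of two maps is displaced by `g` as much as convexity allows, then the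
distances along the two maps and between them are preserved. -/
theorem ae_eq_of_le_displacement_mid [μ.IsMulLeftInvariant] (hX : IsCAT0 X) {g : G}
    {y y' : L2Map μ D φ}
    (h : 1 / 2 * dist y (g • y) ^ 2 + 1 / 2 * dist y' (g • y') ^ 2 ≤
      dist (mid hX y y') (g • mid hX y y') ^ 2) :
    ∀ᵐ x ∂μ, dist (y (x * g)) (y' (x * g)) = dist (y x) (y' x) ∧
      dist (y x) (y (x * g)) = dist (y' x) (y' (x * g)) := by
  refine hD.ae_of_ae_restrict (Γ := Γ) (fun γ x hx => ?_) ?_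
  · rwa [mul_assoc, dist_mul_left, dist_mul_left, equivariant, equivariant, equivariant,
      equivariant, IsometryEquiv.dist_eq, IsometryEquiv.dist_eq] at hx
  set z := mid hX y y'
  let I : G → ℝ := fun x => 1 / 2 * dist (y x) ((g • y) x) ^ 2 +
    1 / 2 * dist (y' x) ((g • y') x) ^ 2 - dist (z x) ((g • z) x) ^ 2
  have h1 := integrable_dist_sq y (g • y)
  have h2 := integrable_dist_sq y' (g • y')
  have h3 := integrable_dist_sq z (g • z)
  have hI : Integrable I (μ.restrict D) := ((h1.const_mul _).add (h2.const_mul _)).sub h3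
  have hint : ∫ x in D, I x ∂μ ≤ 0 := by
    have h12 : Integrable (fun x => 1 / 2 * dist (y x) ((g • y) x) ^ 2 +
        1 / 2 * dist (y' x) ((g • y') x) ^ 2) (μ.restrict D) :=
      (h1.const_mul _).add (h2.const_mul _)
    simp only [I]
    rw [integral_sub h12 h3, integral_add (h1.const_mul _) (h2.const_mul _), integral_const_mul, integral_const_mul,
      ← dist_sq, ← dist_sq, ← dist_sq]
    linarith
  have hlow : ∀ x, 1 / 4 * (dist (y x) (y' x) - dist (y (x * g)) (y' (x * g))) ^ 2 ≤ I x ∧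
      1 / 4 * (dist (y x) (y (x * g)) - dist (y' x) (y' (x * g))) ^ 2 ≤ I x := fun x => by
    have a1 := hX.dist_mid_mid_sq_add_le (y x) (y' x) (y (x * g)) (y' (x * g))
    have a2 := hX.dist_mid_mid_sq_add_le' (y x) (y' x) (y (x * g)) (y' (x * g))
    simp only [I, smul_apply, z, mid_apply]
    constructor <;> linarith
  have hpos : ∀ x, 0 ≤ I x := fun x => le_trans (by positivity) (hlow x).1
  have h0 : I =ᵐ[μ.restrict D] 0 := (integral_eq_zero_iff_of_nonneg hpos hI).1
    (le_antisymm hint (integral_nonneg hpos))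
  filter_upwards [h0] with x hx
  have hx' : I x = 0 := hx
  have b1 := hlow x
  rw [hx'] at b1
  have c1 := pow_eq_zero_iff (two_ne_zero) |>.1
    (le_antisymm (by linarith [b1.1]) (sq_nonneg (dist (y x) (y' x) - dist (y (x * g)) (y' (x * g)))))
  have c2 := pow_eq_zero_iff (two_ne_zero) |>.1
    (le_antisymm (by linarith [b1.2])
      (sq_nonneg (dist (y x) (y (x * g)) - dist (y' x) (y' (x * g)))))
  constructor <;> linarith

variable {A : Type*} [MeasurableSpace A]

/-- The mean square displacement. -/
noncomputable def energy (m : Measure A) (α : A → G) (y : L2Map μ D φ) : ℝ :=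
  ∫ a, dist y (α a • y) ^ 2 ∂m

variable {m : Measure A} [IsFiniteMeasure m] [SFinite μ] {α : A → G} {y₀ : L2Map μ D φ}

theorem energy_nonneg (y : L2Map μ D φ) : 0 ≤ energy m α y :=
  integral_nonneg fun _ => sq_nonneg _

theorem integrable_displacement_sq (hα : Measurable α)
    (h₀ : Integrable (fun a => dist y₀ (α a • y₀) ^ 2) m) (y : L2Map μ D φ) :
    Integrable (fun a => dist y (α a • y) ^ 2) m := by
  refine ((h₀.const_mul 2).add (integrable_const (8 * dist y₀ y ^ 2))).mono
    ((y.measurable_displacement.comp hα).pow_const 2).aestronglyMeasurable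
    (Eventually.of_forall fun a => ?_)
  rw [Real.norm_of_nonneg (sq_nonneg _), Pi.add_apply, Real.norm_of_nonneg (by positivity)]
  exact displacement_sq_le_add _ _ _

theorem continuous_energy (hα : Measurable α)
    (h₀ : Integrable (fun a => dist y₀ (α a • y₀) ^ 2) m) :
    Continuous (energy m α : L2Map μ D φ → ℝ) := by
  refine continuous_iff_continuousAt.2 fun y => ?_
  refine continuousAt_of_dominated (bound := fun a => 2 * dist y (α a • y) ^ 2 + 8)
    (Eventually.of_forall fun z =>
      ((z.measurable_displacement.comp hα).pow_const 2).aestronglyMeasurable) ?_ ?_ ?_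
  · filter_upwards [Metric.ball_mem_nhds y one_pos] with z hz
    refine Eventually.of_forall fun a => ?_
    rw [Real.norm_of_nonneg (sq_nonneg _)]
    have h1 := displacement_sq_le_add (α a) y z
    have h2 : dist y z ≤ 1 := by rw [dist_comm]; exact (Metric.mem_ball.1 hz).le
    have h3 : dist y z ^ 2 ≤ 1 := pow_le_one₀ dist_nonneg h2
    linarith
  · exact ((integrable_displacement_sq hα h₀ y).const_mul 2).add (integrable_const 8)
  · exact Eventually.of_forall fun a =>
      ((continuous_id.dist (continuous_smul_left (α a))).pow 2).continuousAt

theorem energy_mid_le (hX : IsCAT0 X) (hα : Measurable α)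
    (h₀ : Integrable (fun a => dist y₀ (α a • y₀) ^ 2) m) (y y' : L2Map μ D φ) :
    energy m α (mid hX y y') ≤ 1 / 2 * energy m α y + 1 / 2 * energy m α y' := by
  have h1 := integrable_displacement_sq hα h₀
  rw [energy, energy, energy, ← integral_const_mul, ← integral_const_mul,
    ← integral_add ((h1 _).const_mul _) ((h1 _).const_mul _)]
  exact integral_mono (h1 _) (((h1 _).const_mul _).add ((h1 _).const_mul _)) fun a =>
    displacement_mid_sq_le hX (α a) y y'

/-- The convexity defect is non-negative for each `a` and has integral at most zero, so it vanishes
for almost every `a`. This rigidity is the source of all information on minimisers. -/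
theorem ae_eq_of_le_energy_mid [μ.IsMulLeftInvariant] (hX : IsCAT0 X) (hα : Measurable α)
    (h₀ : Integrable (fun a => dist y₀ (α a • y₀) ^ 2) m) {y y' : L2Map μ D φ}
    (h : 1 / 2 * energy m α y + 1 / 2 * energy m α y' ≤ energy m α (mid hX y y')) :
    ∀ᵐ a ∂m, ∀ᵐ x ∂μ, dist (y (x * α a)) (y' (x * α a)) = dist (y x) (y' x) ∧
      dist (y x) (y (x * α a)) = dist (y' x) (y' (x * α a)) := by
  have h1 := integrable_displacement_sq hα h₀
  let I : A → ℝ := fun a => 1 / 2 * dist y (α a • y) ^ 2 + 1 / 2 * dist y' (α a • y') ^ 2 -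
    dist (mid hX y y') (α a • mid hX y y') ^ 2
  have hpos : ∀ a, 0 ≤ I a := fun a => sub_nonneg.2 (displacement_mid_sq_le hX (α a) y y')
  have hI : Integrable I m := (((h1 _).const_mul _).add ((h1 _).const_mul _)).sub (h1 _)
  have hint : ∫ a, I a ∂m ≤ 0 := by
    have h12 : Integrable (fun a => 1 / 2 * dist y (α a • y) ^ 2 +
        1 / 2 * dist y' (α a • y') ^ 2) m := ((h1 _).const_mul _).add ((h1 _).const_mul _)
    simp only [I]
    rw [integral_sub h12 (h1 _),
      integral_add ((h1 _).const_mul _) ((h1 _).const_mul _), integral_const_mul,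
      integral_const_mul]
    exact sub_nonpos.2 h
  have h0 : I =ᵐ[m] 0 := (integral_eq_zero_iff_of_nonneg hpos hI).1
    (le_antisymm hint (integral_nonneg hpos))
  filter_upwards [h0] with a ha
  exact ae_eq_of_le_displacement_mid hX (sub_nonpos.1 (le_of_eq ha))

end Energy

/-! ### Unbounded sequences of small displacement -/

section Evanescent

theorem const_apply_of_mem (φ : Γ →* (X ≃ᵢ X)) (o : X) {x : G} (hx : x ∈ D) :
    const hD φ o x = o := by
  have h1 : (hD.existsUnique x).choose = 1 :=
    ((hD.existsUnique x).choose_spec.2 1 (by simpa using hx)).symm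
  change (φ (hD.existsUnique x).choose)⁻¹ o = o
  rw [h1]
  simp

theorem ofReal_dist_const_sq (y : L2Map μ D φ) (o : X) :
    ENNReal.ofReal (dist (const hD φ o) y ^ 2) = ∫⁻ x in D, edist o (y x) ^ 2 ∂μ := by
  rw [ofReal_dist_sq]
  exact setLIntegral_congr_fun hD.measurableSet fun x hx => by rw [const_apply_of_mem φ o hx]

theorem dist_const_const_sq (o p : X) :
    dist (const hD φ o) (const hD φ p) ^ 2 = (μ D).toReal * dist o p ^ 2 := by
  rw [dist_sq, setIntegral_congr_fun (g := fun _ => dist o p ^ 2) hD.measurableSet fun x hx => by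
    simp only [const_apply_of_mem φ _ hx], setIntegral_const]
  rfl

variable [μ.IsMulLeftInvariant] [SFinite μ]

/-- For fixed `x` substitute `x' = x * g`, then exchange integrals: the mean square displacement
over `Q` dominates the oscillation of `y` between `D` and `K`. -/
theorem lintegral_lintegral_edist_le (y : L2Map μ D φ) {K Q : Set G} (hK : MeasurableSet K)
    (hQ : MeasurableSet Q) (hKQ : ∀ x ∈ D, ∀ x' ∈ K, x⁻¹ * x' ∈ Q) :
    ∫⁻ x in D, ∫⁻ x' in K, edist (y x) (y x') ^ 2 ∂μ ∂μ ≤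
      ∫⁻ g in Q, ENNReal.ofReal (dist y (g • y) ^ 2) ∂μ := by
  have h1 : ∀ x ∈ D, ∫⁻ x' in K, edist (y x) (y x') ^ 2 ∂μ ≤
      ∫⁻ g in Q, edist (y x) (y (x * g)) ^ 2 ∂μ := fun x hx => by
    rw [← lintegral_indicator hK, ← lintegral_indicator hQ,
      ← lintegral_mul_left_eq_self (K.indicator _) x]
    refine lintegral_mono fun g => ?_
    by_cases hg : x * g ∈ K
    · rw [Set.indicator_of_mem hg, Set.indicator_of_mem (by simpa using hKQ x hx _ hg)]
    · rw [Set.indicator_of_notMem hg]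
      exact zero_le
  refine (setLIntegral_mono' hD.measurableSet h1).trans_eq ?_
  rw [lintegral_lintegral_swap]
  · simp only [ofReal_dist_smul_sq]
  · exact Measurable.aemeasurable (((y.measurable.comp measurable_fst).edist
      (y.measurable.comp (measurable_fst.mul measurable_snd))).pow_const 2)

variable [T2Space G] [LocallyCompactSpace G] [IsFiniteMeasureOnCompacts μ]

/-- Averaging over `D` selects a value `p k` of `t k` such that `t k` is boundedly close to the map
equal to `p k` on `D`. The oscillation of the latter between `D` and `γ D` measures `dist (p k) (φ γ
(p k))`, which is therefore bounded in `k`; by `hNE` the points `p k`, and with them the maps `t k`,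
are bounded. -/
theorem bounded_of_lintegral_displacement
    (hNE : ∀ T : Set X, (∀ γ, ∃ K, ∀ p ∈ T, dist (φ γ p) p ≤ K) → Bornology.IsBounded T)
    {ι : Type*} {t : ι → L2Map μ D φ}
    (ht : ∀ Q : Set G, IsCompact Q → ∃ C : ℝ≥0∞, C ≠ ⊤ ∧
      ∀ k, ∫⁻ g in Q, ENNReal.ofReal (dist (t k) (g • t k) ^ 2) ∂μ ≤ C) (y : L2Map μ D φ) :
    ∃ R, ∀ k, dist y (t k) ≤ R := by
  obtain ⟨K, hK, hDK⟩ := hD.subset_compact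
  have hμ0 := hD.measure_ne_zero
  have hμ1 := hD.measure_ne_top
  obtain ⟨C₀, hC₀, ht₀⟩ := ht (K⁻¹ * K) (hK.inv.mul hK)
  have hex : ∀ k, ∃ p : X, dist (const hD φ p) (t k) ^ 2 ≤ (C₀ / μ D).toReal := fun k => by
    have hm : Measurable fun x => ∫⁻ x' in D, edist (t k x) (t k x') ^ 2 ∂μ :=
      Measurable.lintegral_prod_right' (f := fun q : G × G => edist (t k q.1) (t k q.2) ^ 2)
        ((((t k).measurable.comp measurable_fst).edist
          ((t k).measurable.comp measurable_snd)).pow_const 2)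
    obtain ⟨x, hx, hle⟩ := exists_le_setLAverage hμ0 hμ1 hm.aemeasurable
    refine ⟨t k x, ?_⟩
    rw [← ENNReal.ofReal_le_iff_le_toReal (ENNReal.div_ne_top hC₀ hμ0), ofReal_dist_const_sq]
    refine hle.trans ?_
    rw [setLAverage_eq]
    gcongr
    refine (lintegral_lintegral_edist_le (t k) hD.measurableSet
      (hK.inv.mul hK).measurableSet fun x hx x' hx' => ?_).trans (ht₀ k)
    exact Set.mul_mem_mul (Set.inv_mem_inv.2 (hDK hx)) (hDK hx')
  choose p hp using hex
  set M := (C₀ / μ D).toReal with hM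
  have hbdd : Bornology.IsBounded (Set.range p) := by
    refine hNE _ fun γ => ?_
    -- `Q` contains every `x⁻¹ * x'` with `x ∈ D` and `x' ∈ γ D`.
    set Q : Set G := K⁻¹ * ((γ : G) • K)
    have hQ : IsCompact Q := hK.inv.mul (hK.smul (γ : G))
    obtain ⟨C, hC, htC⟩ := ht Q hQ
    have hQμ : μ Q ≠ ⊤ := hQ.measure_ne_top
    set C' : ℝ≥0∞ := 2 * C + ENNReal.ofReal (8 * M) * μ Q
    have hC' : C' ≠ ⊤ := ENNReal.add_ne_top.2
      ⟨ENNReal.mul_ne_top ENNReal.ofNat_ne_top hC, ENNReal.mul_ne_top ENNReal.ofReal_ne_top hQμ⟩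
    have key : ∀ k, edist (p k) (φ γ (p k)) ^ 2 * μ D * μ D ≤ C' := fun k => by
      set c := const hD φ (p k)
      have hDγ : MeasurableSet {x : G | ((γ⁻¹ : Γ) : G) * x ∈ D} :=
        (measurable_const_mul _) hD.measurableSet
      have h1 := lintegral_lintegral_edist_le c hDγ hQ.measurableSet fun x hx x' hx' => by
        refine Set.mul_mem_mul (Set.inv_mem_inv.2 (hDK hx)) ?_
        refine ⟨_, hDK hx', ?_⟩
        simp
      have h2 : ∫⁻ x in D, ∫⁻ x' in {x : G | ((γ⁻¹ : Γ) : G) * x ∈ D},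
          edist (c x) (c x') ^ 2 ∂μ ∂μ = edist (p k) (φ γ (p k)) ^ 2 * μ D * μ D := by
        have h3 : ∀ x ∈ D, ∫⁻ x' in {x : G | ((γ⁻¹ : Γ) : G) * x ∈ D},
            edist (c x) (c x') ^ 2 ∂μ = edist (p k) (φ γ (p k)) ^ 2 * μ D := fun x hx => by
          rw [setLIntegral_congr_fun (g := fun _ => edist (p k) (φ γ (p k)) ^ 2) hDγ
            fun x' hx' => ?_, setLIntegral_const]
          · congr 1
            exact measure_preimage_mul μ _ D
          · have h4 := c.equivariant γ (((γ⁻¹ : Γ) : G) * x')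
            rw [const_apply_of_mem φ (p k) (show ((γ⁻¹ : Γ) : G) * x' ∈ D from hx')] at h4
            have h5 : (γ : G) * (((γ⁻¹ : Γ) : G) * x') = x' := by simp
            rw [h5] at h4
            simp only
            rw [h4, const_apply_of_mem φ _ hx]
        rw [setLIntegral_congr_fun hD.measurableSet h3, setLIntegral_const]
      rw [h2] at h1
      refine h1.trans ?_
      have h6 : ∀ g : G, ENNReal.ofReal (dist c (g • c) ^ 2) ≤
          2 * ENNReal.ofReal (dist (t k) (g • t k) ^ 2) + ENNReal.ofReal (8 * M) := fun g => by
        have h7 := displacement_sq_le_add g (t k) c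
        rw [dist_comm (t k) c] at h7
        have h8 := hp k
        rw [show (2 : ℝ≥0∞) = ENNReal.ofReal 2 by simp, ← ENNReal.ofReal_mul zero_le_two,
          ← ENNReal.ofReal_add (by positivity) (by positivity)]
        exact ENNReal.ofReal_le_ofReal (by linarith)
      refine (lintegral_mono h6).trans ?_
      have h9 : Measurable fun g : G => ENNReal.ofReal (dist (t k) (g • t k) ^ 2) :=
        ((t k).measurable_displacement.pow_const 2).ennreal_ofReal
      rw [lintegral_add_right _ measurable_const, lintegral_const_mul _ h9,
        lintegral_const, Measure.restrict_apply_univ]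
      change _ ≤ 2 * C + ENNReal.ofReal (8 * M) * μ Q
      gcongr
      exact htC k
    refine ⟨√(C' / (μ D * μ D)).toReal, ?_⟩
    rintro _ ⟨k, rfl⟩
    refine Real.le_sqrt_of_sq_le ?_
    rw [← ENNReal.ofReal_le_iff_le_toReal
      (ENNReal.div_ne_top hC' (mul_ne_zero hμ0 hμ0)), ENNReal.ofReal_pow dist_nonneg,
      ← edist_dist, edist_comm, ENNReal.le_div_iff_mul_le (Or.inl (mul_ne_zero hμ0 hμ0))
        (Or.inl (ENNReal.mul_ne_top hμ1 hμ1)), ← mul_assoc]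
    exact key k
  rcases isEmpty_or_nonempty ι with hι | ⟨⟨k₀⟩⟩
  · exact ⟨0, fun k => hι.elim k⟩
  obtain ⟨R, hR⟩ := hbdd.subset_closedBall (p k₀)
  refine ⟨dist y (const hD φ (p k₀)) + √((μ D).toReal * R ^ 2) + √M, fun k => ?_⟩
  have h1 := dist_triangle4 y (const hD φ (p k₀)) (const hD φ (p k)) (t k)
  have h2 : dist (const hD φ (p k)) (t k) ≤ √M := Real.le_sqrt_of_sq_le (hp k)
  have h3 : dist (const hD φ (p k₀)) (const hD φ (p k)) ≤ √((μ D).toReal * R ^ 2) := by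
    refine Real.le_sqrt_of_sq_le ?_
    rw [dist_const_const_sq]
    have h4 : dist (p k₀) (p k) ≤ R := by
      rw [dist_comm]
      exact hR ⟨k, rfl⟩
    gcongr
  linarith

end Evanescent

end L2Map

section Haar

variable {B : Type*} [Group B] [TopologicalSpace B] [IsTopologicalGroup B]
  [SecondCountableTopology B] [T2Space B] [LocallyCompactSpace B] [MeasurableSpace B] [BorelSpace B]
  (ν : Measure B) [ν.IsHaarMeasure]

/-! ### Ergodicity of dense translations -/

/-- The restriction of `ν` to `E` is invariant under `P`, hence under all of `B`, since integrals of
compactly supported functions depend continuously on the translation. It is thus a multiple of `ν`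
that vanishes off `E`. -/
theorem ae_mem_or_ae_notMem_of_dense {P : Set B} (hP : Dense P) {E : Set B}
    (hE : MeasurableSet E) (hinv : ∀ p ∈ P, ∀ᵐ b ∂ν, p * b ∈ E ↔ b ∈ E) :
    (∀ᵐ b ∂ν, b ∈ E) ∨ ∀ᵐ b ∂ν, b ∉ E := by
  set ρ := ν.restrict E with hρ
  have hfin : IsFiniteMeasureOnCompacts ρ :=
    ⟨fun K hK => (Measure.restrict_apply_le E K).trans_lt hK.measure_lt_top⟩
  have hpres : ∀ p ∈ P, MeasurePreserving (p * ·) ρ ρ := fun p hp => by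
    have h1 := (measurePreserving_mul_left ν p).restrict_preimage hE
    have h2 : (p * ·) ⁻¹' E =ᵐ[ν] E := by
      filter_upwards [hinv p hp] with b hb
      exact propext hb
    rwa [Measure.restrict_congr_set h2] at h1
  have hint : ∀ (f : CompactlySupportedContinuousMap B ℝ) (x : B), ∫ y, f (x⁻¹ * y) ∂ρ = ∫ y, f y ∂ρ := by
    intro f
    have hc : Continuous fun x : B => ∫ y, f (x⁻¹ * y) ∂ρ := by
      have h1 := continuous_integral_apply_inv_mul (μ := ρ) (g := fun b => f b⁻¹)
        (f.continuous.comp continuous_inv) (f.hasCompactSupport.comp_homeomorph (Homeomorph.inv B))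
      simpa using h1
    have hcl : IsClosed {x : B | ∫ y, f (x⁻¹ * y) ∂ρ = ∫ y, f y ∂ρ} :=
      isClosed_eq hc continuous_const
    have hsub : P ⊆ {x : B | ∫ y, f (x⁻¹ * y) ∂ρ = ∫ y, f y ∂ρ} := fun p hp => by
      have := (hpres p hp).integral_comp (measurableEmbedding_mulLeft p) fun y => f (p⁻¹ * y)
      simpa using this.symm
    intro x
    have := hcl.closure_subset_iff.2 hsub (hP x)
    exact this
  have hleft : ρ.IsMulLeftInvariant := ⟨fun x => by
    have hfin' : IsFiniteMeasureOnCompacts (ρ.map (x * ·)) :=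
      ⟨fun K hK => by
        rw [(measurableEmbedding_mulLeft x).map_apply]
        exact ((Homeomorph.mulLeft x).isCompact_preimage.2 hK).measure_lt_top⟩
    refine Measure.ext_of_integral_eq_on_compactlySupported fun f => ?_
    rw [(measurableEmbedding_mulLeft x).integral_map]
    simpa using hint f x⁻¹⟩
  have h1 := Measure.isMulLeftInvariant_eq_smul ρ ν
  set c := Measure.haarScalarFactor ρ ν
  rcases eq_or_ne c 0 with hc | hc
  · right
    rw [hc, zero_smul, hρ, Measure.restrict_eq_zero] at h1
    exact measure_eq_zero_iff_ae_notMem.1 h1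
  · left
    have h2 : ρ Eᶜ = 0 := by rw [hρ, Measure.restrict_apply hE.compl]; simp
    rw [h1, Measure.smul_apply, ENNReal.smul_def, smul_eq_mul, mul_eq_zero] at h2
    exact h2.resolve_left (by simpa using hc)

theorem exists_ae_eq_const_of_dense {P : Set B} (hP : Dense P) {f : B → ℝ} (hf : Measurable f)
    (hinv : ∀ p ∈ P, ∀ᵐ b ∂ν, f (p * b) = f b) : ∃ c, ∀ᵐ b ∂ν, f b = c := by
  refine exists_eventuallyEq_const_of_forall_separating MeasurableSet fun U hU => ?_
  refine ae_mem_or_ae_notMem_of_dense ν hP (E := f ⁻¹' U) (hf hU) fun p hp => ?_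
  filter_upwards [hinv p hp] with b hb
  simp [hb]

/-! ### Maps along which the distance is a length function -/

variable {X : Type*} [MetricSpace X]

/-- Countably many balls of radius `r / 2` cover `X`, so one has a preimage of positive measure;
seen from a generic point of it, almost all of it has length at most `r`. -/
theorem measure_length_le_ne_zero [TopologicalSpace.SeparableSpace X] {f : B → X} {q : B → ℝ}
    (hfq : ∀ᵐ b ∂ν, ∀ᵐ b' ∂ν, dist (f b) (f b') = q (b⁻¹ * b')) {r : ℝ} (hr : 0 < r) :
    ν {b | q b ≤ r} ≠ 0 := by
  have hX : Nonempty X := ⟨f 1⟩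
  set s := TopologicalSpace.denseSeq X
  obtain ⟨n, hn⟩ : ∃ n, ν (f ⁻¹' Metric.ball (s n) (r / 2)) ≠ 0 := by
    by_contra! h
    have h1 : ν (⋃ n, f ⁻¹' Metric.ball (s n) (r / 2)) = 0 := measure_iUnion_null h
    have h2 : ⋃ n, f ⁻¹' Metric.ball (s n) (r / 2) = Set.univ := by
      refine Set.eq_univ_of_forall fun b => Set.mem_iUnion.2 ?_
      obtain ⟨n, hn⟩ := (TopologicalSpace.denseRange_denseSeq X).exists_dist_lt (f b)
        (half_pos hr)
      exact ⟨n, hn⟩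
    rw [h2] at h1
    exact NeZero.ne ν (Measure.measure_univ_eq_zero.1 h1)
  obtain ⟨b, hbW, hb⟩ : ∃ b ∈ f ⁻¹' Metric.ball (s n) (r / 2),
      ∀ᵐ b' ∂ν, dist (f b) (f b') = q (b⁻¹ * b') := by
    by_contra h
    exact hn (measure_mono_null (fun b hb hb' => h ⟨b, hb, hb'⟩) (ae_iff.1 hfq))
  have h1 : f ⁻¹' Metric.ball (s n) (r / 2) ≤ᵐ[ν] (b⁻¹ * ·) ⁻¹' {b | q b ≤ r} := by
    filter_upwards [hb] with c hc hcW
    have hd : dist (f b) (f c) ≤ r := by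
      have := dist_triangle_right (f b) (f c) (s n)
      have h2 : dist (f b) (s n) < r / 2 := hbW
      have h3 : dist (f c) (s n) < r / 2 := hcW
      linarith
    change q (b⁻¹ * c) ≤ r
    rwa [← hc]
  intro h0
  have h2 := measure_mono_ae h1
  rw [measure_preimage_mul, h0] at h2
  exact hn (le_antisymm h2 zero_le)

theorem continuous_of_length {q : B → ℝ} (hmul : ∀ g h, q (g * h) ≤ q g + q h)
    (hinv : ∀ g, q g⁻¹ = q g) (h1 : Tendsto q (𝓝 1) (𝓝 0)) : Continuous q := by
  refine continuous_iff_continuousAt.2 fun g => ?_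
  refine tendsto_iff_dist_tendsto_zero.2 (squeeze_zero (fun _ => dist_nonneg) (fun h => ?_)
    (h1.comp (?_ : Tendsto (fun h => g⁻¹ * h) (𝓝 g) (𝓝 1))))
  · have a1 := hmul g (g⁻¹ * h)
    have a2 := hmul h (h⁻¹ * g)
    have a3 := hinv (g⁻¹ * h)
    rw [mul_inv_cancel_left] at a1 a2
    rw [mul_inv_rev, inv_inv] at a3
    rw [Real.dist_eq, abs_le, Function.comp_apply]
    constructor <;> linarith
  · have h := (continuous_const_mul g⁻¹).tendsto g
    rwa [inv_mul_cancel] at h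

/-- The points at which the distance formula holds almost everywhere form a dense set `S`.
Approximating through points generic for both arguments gives the formula for all pairs in `S`, so
`f` is Cauchy along `S` at every point and extends. -/
theorem exists_continuous_representative [CompleteSpace X] {f : B → X} {q : B → ℝ}
    (hq : Continuous q) (hq1 : q 1 = 0)
    (hfq : ∀ᵐ b ∂ν, ∀ᵐ b' ∂ν, dist (f b) (f b') = q (b⁻¹ * b')) :
    ∃ u : B → X, (∀ b b', dist (u b) (u b') = q (b⁻¹ * b')) ∧ ∀ᵐ b ∂ν, f b = u b := by
  set S : Set B := {b | ∀ᵐ b' ∂ν, dist (f b) (f b') = q (b⁻¹ * b')} with hS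
  have hSd : Dense S := Measure.dense_of_ae hfq
  have hqc : ∀ b b', Tendsto (fun c : B × B => q (c.1⁻¹ * c.2)) (𝓝 (b, b')) (𝓝 (q (b⁻¹ * b'))) :=
    fun b b' => (hq.comp (by fun_prop : Continuous fun c : B × B => c.1⁻¹ * c.2)).tendsto (b, b')
  have hqr : ∀ b b', Tendsto (fun c : B => q (b⁻¹ * c)) (𝓝 b') (𝓝 (q (b⁻¹ * b'))) :=
    fun b b' => (hq.comp (continuous_const_mul b⁻¹)).tendsto b'
  have hSS : ∀ b ∈ S, ∀ b' ∈ S, dist (f b) (f b') = q (b⁻¹ * b') := by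
    intro b hb b' hb'
    set C : Set B := {c | dist (f b) (f c) = q (b⁻¹ * c) ∧ dist (f b') (f c) = q (b'⁻¹ * c)}
    have hC : Dense C := Measure.dense_of_ae (by
      filter_upwards [hb, hb'] with c h1 h2 using ⟨h1, h2⟩)
    have hne : (𝓝[C] b').NeBot := mem_closure_iff_nhdsWithin_neBot.1 (hC b')
    have hfC : Tendsto f (𝓝[C] b') (𝓝 (f b')) := by
      rw [tendsto_iff_dist_tendsto_zero]
      have h1 := (hqr b' b').mono_left (nhdsWithin_le_nhds (s := C))
      rw [inv_mul_cancel, hq1] at h1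
      refine h1.congr' ?_
      filter_upwards [self_mem_nhdsWithin] with c hc
      rw [dist_comm, hc.2]
    refine tendsto_nhds_unique (tendsto_const_nhds.dist hfC)
      (((hqr b b').mono_left nhdsWithin_le_nhds).congr' ?_)
    filter_upwards [self_mem_nhdsWithin] with c hc
    exact hc.1.symm
  have hlim : ∀ b, ∃ x, Tendsto f (𝓝[S] b) (𝓝 x) := by
    intro b
    have hne : (𝓝[S] b).NeBot := mem_closure_iff_nhdsWithin_neBot.1 (hSd b)
    refine cauchy_iff_exists_le_nhds.1 (Metric.cauchy_iff.2 ⟨inferInstance, fun ε hε => ?_⟩)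
    have h1 := hqc b b
    rw [inv_mul_cancel, hq1] at h1
    have h2 := h1.eventually (gt_mem_nhds hε)
    rw [nhds_prod_eq] at h2
    obtain ⟨V, hV, hVq⟩ := mem_prod_same_iff.1 h2
    refine ⟨f '' (V ∩ S), image_mem_map (inter_mem (nhdsWithin_le_nhds hV) self_mem_nhdsWithin), ?_⟩
    rintro _ ⟨c, hc, rfl⟩ _ ⟨c', hc', rfl⟩
    rw [hSS c hc.2 c' hc'.2]
    exact hVq (Set.mk_mem_prod hc.1 hc'.1)
  choose u hu using hlim
  refine ⟨u, fun b b' => ?_, ?_⟩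
  · have hne : (𝓝[S] b).NeBot := mem_closure_iff_nhdsWithin_neBot.1 (hSd b)
    have hne' : (𝓝[S] b').NeBot := mem_closure_iff_nhdsWithin_neBot.1 (hSd b')
    have h1 : Tendsto (fun c : B × B => dist (f c.1) (f c.2)) (𝓝[S] b ×ˢ 𝓝[S] b')
        (𝓝 (dist (u b) (u b'))) :=
      ((hu b).comp tendsto_fst).dist ((hu b').comp tendsto_snd)
    have h2 := (hqc b b')
    rw [nhds_prod_eq] at h2
    refine tendsto_nhds_unique h1 ((h2.mono_left (prod_mono nhdsWithin_le_nhds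
      nhdsWithin_le_nhds)).congr' ?_)
    filter_upwards [prod_mem_prod (self_mem_nhdsWithin (s := S)) (self_mem_nhdsWithin (s := S))]
      with c hc
    exact (hSS _ hc.1 _ hc.2).symm
  · filter_upwards [hfq] with b hb
    have hne : (𝓝[S] b).NeBot := mem_closure_iff_nhdsWithin_neBot.1 (hSd b)
    refine tendsto_nhds_unique ?_ (hu b)
    rw [tendsto_iff_dist_tendsto_zero]
    have h1 := (hqr b b).mono_left (nhdsWithin_le_nhds (s := S))
    rw [inv_mul_cancel, hq1] at h1
    refine h1.congr' ?_
    filter_upwards [self_mem_nhdsWithin] with c hc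
    rw [dist_comm, hSS b hb c hc]

end Haar

/-! ### Minimisers of the energy along the first factor -/

namespace L2Map

variable {A B G : Type*} [Group A] [TopologicalSpace A] [IsTopologicalGroup A]
  [SecondCountableTopology A] [T2Space A] [LocallyCompactSpace A] [MeasurableSpace A] [BorelSpace A]
  [Group B] [TopologicalSpace B] [IsTopologicalGroup B] [SecondCountableTopology B] [T2Space B]
  [LocallyCompactSpace B] [MeasurableSpace B] [BorelSpace B]
  [Group G] [TopologicalSpace G] [IsTopologicalGroup G] [SecondCountableTopology G] [T2Space G]
  [LocallyCompactSpace G] [MeasurableSpace G] [BorelSpace G]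
  {e : A × B ≃ₜ* G} {νA : Measure A} {νB : Measure B} {μ : Measure G} [νA.IsHaarMeasure]
  [νB.IsHaarMeasure] [μ.IsHaarMeasure]
  {X : Type*} [MetricSpace X] [ProperSpace X] [MeasurableSpace X] [BorelSpace X]
  {Γ : Subgroup G} {D : Set G} [hD : IsLatticeDomain Γ μ D] [Countable Γ] {φ : Γ →* (X ≃ᵢ X)}

theorem smul_smul_comm_factors (a : A) (b : B) (y : L2Map μ D φ) :
    e (a, 1) • e (1, b) • y = e (1, b) • e (a, 1) • y := by
  rw [← mul_smul, ← mul_smul, ← map_mul, ← map_mul]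
  simp

/-- Fubini bound for the mean square displacement over a compact set. -/
theorem lintegral_displacement_le (hμ : MeasurePreserving e (νA.prod νB) μ) {Q : Set G}
    (hQ : IsCompact Q) : ∃ QA : Set A, ∃ QB : Set B, IsCompact QA ∧ IsCompact QB ∧
      ∀ (y : L2Map μ D φ) (M : ℝ≥0∞),
        (∀ b ∈ QB, ENNReal.ofReal (dist y (e (1, b) • y) ^ 2) ≤ M) →
        ∫⁻ g in Q, ENNReal.ofReal (dist y (g • y) ^ 2) ∂μ ≤
          (2 * (∫⁻ a in QA, ENNReal.ofReal (dist y (e (a, 1) • y) ^ 2) ∂νA) + 2 * M * νA QA) *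
            νB QB := by
  have hQ' : IsCompact (e ⁻¹' Q) := e.toHomeomorph.isCompact_preimage.2 hQ
  refine ⟨Prod.fst '' (e ⁻¹' Q), Prod.snd '' (e ⁻¹' Q), hQ'.image continuous_fst,
    hQ'.image continuous_snd, fun y M hM => ?_⟩
  set QA := Prod.fst '' (e ⁻¹' Q)
  set QB := Prod.snd '' (e ⁻¹' Q)
  have hQA : MeasurableSet QA := (hQ'.image continuous_fst).measurableSet
  have hQB : MeasurableSet QB := (hQ'.image continuous_snd).measurableSet
  have hm : Measurable fun a : A => ENNReal.ofReal (dist y (e (a, 1) • y) ^ 2) :=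
    ((y.measurable_displacement.comp (e.continuous.comp (by fun_prop :
      Continuous fun a : A => (a, (1 : B)))).measurable).pow_const 2).ennreal_ofReal
  rw [← hμ.setLIntegral_comp_preimage_emb e.toHomeomorph.measurableEmbedding]
  have hsub : e ⁻¹' Q ⊆ QA ×ˢ QB := fun p hp => ⟨⟨p, hp, rfl⟩, ⟨p, hp, rfl⟩⟩
  refine (lintegral_mono_set hsub).trans ?_
  have hle : ∀ p ∈ QA ×ˢ QB, ENNReal.ofReal (dist y (e p • y) ^ 2) ≤
      2 * ENNReal.ofReal (dist y (e (p.1, 1) • y) ^ 2) + 2 * M := fun p hp => by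
    have h1 := displacement_mul y (e (p.1, 1)) (e (1, p.2))
    rw [← map_mul, Prod.mk_mul_mk, mul_one, one_mul] at h1
    have h2 := pow_le_pow_left₀ dist_nonneg h1 2
    have h3 : dist y (e (p.1, p.2) • y) ^ 2 ≤
        2 * dist y (e (p.1, 1) • y) ^ 2 + 2 * dist y (e (1, p.2) • y) ^ 2 := by
      nlinarith [sq_nonneg (dist y (e (p.1, 1) • y) - dist y (e (1, p.2) • y))]
    refine (ENNReal.ofReal_le_ofReal h3).trans ?_
    rw [ENNReal.ofReal_add (by positivity) (by positivity), ENNReal.ofReal_mul zero_le_two,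
      ENNReal.ofReal_mul zero_le_two, show ENNReal.ofReal 2 = 2 by simp]
    gcongr
    exact hM _ hp.2
  refine (setLIntegral_mono' (hQA.prod hQB) hle).trans_eq ?_
  have hm' : Measurable fun p : A × B =>
      2 * ENNReal.ofReal (dist y (e (p.1, 1) • y) ^ 2) + 2 * M :=
    ((hm.comp measurable_fst).const_mul 2).add_const (2 * M)
  rw [← Measure.prod_restrict, lintegral_prod _ hm'.aemeasurable]
  simp only [lintegral_const, Measure.restrict_apply_univ]
  rw [lintegral_mul_const _ ((hm.const_mul 2).add_const (2 * M)), lintegral_add_right _ measurable_const,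
    lintegral_const_mul _ hm]
  simp

/-- The closed convex set of minimisers of the energy in the direction of the first factor. -/
theorem exists_minimizing_set (hX : IsCAT0 X) (hμ : MeasurePreserving e (νA.prod νB) μ)
    (hNE : ∀ T : Set X, (∀ γ, ∃ K, ∀ p ∈ T, dist (φ γ p) p ≤ K) → Bornology.IsBounded T)
    {S : Set (L2Map μ D φ)} (hne : S.Nonempty) (hcl : IsClosed S)
    (hmid : ∀ y ∈ S, ∀ y' ∈ S, mid hX y y' ∈ S) (hinv : ∀ b, ∀ y ∈ S, e (1, b) • y ∈ S) :
    ∃ F ⊆ S, F.Nonempty ∧ IsClosed F ∧ (∀ y ∈ F, ∀ y' ∈ F, mid hX y y' ∈ F) ∧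
      (∀ b, ∀ y ∈ F, e (1, b) • y ∈ F) ∧
      ∀ y ∈ F, ∀ y' ∈ F, ∀ᵐ a ∂νA, ∀ᵐ x ∂μ,
        dist (y (x * e (a, 1))) (y' (x * e (a, 1))) = dist (y x) (y' x) ∧
        dist (y x) (y (x * e (a, 1))) = dist (y' x) (y' (x * e (a, 1))) := by
  obtain ⟨y₀, hy₀⟩ := hne
  have hαc : Continuous fun a : A => e (a, 1) := e.continuous.comp (by fun_prop)
  have hβc : Continuous fun b : B => e (1, b) := e.continuous.comp (by fun_prop)
  set α : A → G := fun a => e (a, 1) with hα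
  have hαm : Measurable α := hαc.measurable
  -- With a finite measure in place of Haar measure the energy is finite. Domination on compact sets
  -- lets it control displacements there, and `hac` returns almost-everywhere statements to `νA`.
  obtain ⟨m, hm, hm0, hac, hdom⟩ := exists_finite_dominating_measure νA
    (f := fun a => ENNReal.ofReal (dist y₀ (α a • y₀) ^ 2)) fun K hK => by
      obtain ⟨C, hC⟩ := y₀.displacement_bounded (hK.image hαc)
      refine ⟨ENNReal.ofReal (C ^ 2), by simp, fun a ha => ENNReal.ofReal_le_ofReal ?_⟩
      exact pow_le_pow_left₀ dist_nonneg (hC _ ⟨a, ha, rfl⟩) 2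
  have h₀ : Integrable (fun a => dist y₀ (α a • y₀) ^ 2) m := by
    refine ⟨((y₀.measurable_displacement.comp hαm).pow_const 2).aestronglyMeasurable, ?_⟩
    rw [hasFiniteIntegral_iff_ofReal (Eventually.of_forall fun a => sq_nonneg _)]
    exact hm0.lt_top
  -- The factors commute, so translation by `B` preserves the displacement by each element of `A`.
  have hEinv : ∀ (b : B) (y : L2Map μ D φ), energy m α (e (1, b) • y) = energy m α y :=
    fun b y => by
      simp only [energy, hα, smul_smul_comm_factors, dist_smul]
  rcases (isMidpointMap hX).exists_minimizer_or_unbounded ⟨y₀, hy₀⟩ hcl hmid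
    (continuous_energy hαm h₀) energy_nonneg (energy_mid_le hX hαm h₀) y₀ with
    ⟨v, hv, hmin⟩ | ⟨c, t, ht, htu, htd⟩
  · refine ⟨{y | y ∈ S ∧ energy m α y ≤ energy m α v}, fun y hy => hy.1, ⟨v, hv, le_rfl⟩,
      hcl.inter (isClosed_le (continuous_energy hαm h₀) continuous_const),
      fun y hy y' hy' => ⟨hmid y hy.1 y' hy'.1, ?_⟩,
      fun b y hy => ⟨hinv b y hy.1, (hEinv b y).trans_le hy.2⟩, fun y hy y' hy' => ?_⟩
    · have := energy_mid_le hX hαm h₀ y y'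
      linarith [hy.2, hy'.2]
    -- The midpoint of two minimisers lies in `S`, so minimality gives the equality case of
    -- convexity.
    · refine hac.ae_le (ae_eq_of_le_energy_mid hX hαm h₀ ?_)
      have := hmin _ (hmid y hy.1 y' hy'.1)
      linarith [hy.2, hy'.2]
  · exfalso
    -- Along the escaping sequence, projection bounds the displacement by `B` and the energy bounds
    -- that by `A`; together they contradict `bounded_of_lintegral_displacement`.
    have hdisp : ∀ b k, dist (t k) (e (1, b) • t k) ^ 2 ≤ 2 * dist y₀ (e (1, b) • y₀) ^ 2 :=
      fun b k => htd (e (1, b) • ·) (e (1, b⁻¹) • ·) (fun _ _ => dist_smul _ _ _)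
        (fun y => by
          rw [← mul_smul, ← map_mul, Prod.mk_mul_mk, mul_one, mul_inv_cancel, ← Prod.one_eq_mk,
            map_one, one_smul])
        (fun s hs => ⟨hinv b s hs, (hEinv b s).le⟩)
        (fun s hs => ⟨hinv _ s hs, (hEinv _ s).le⟩) k
    obtain ⟨R, hR⟩ := bounded_of_lintegral_displacement hNE (t := t) (fun Q hQ => by
      obtain ⟨QA, QB, hQA, hQB, hle⟩ := lintegral_displacement_le (φ := φ) (D := D) hμ hQ
      obtain ⟨C, hC⟩ := y₀.displacement_bounded (hQB.image hβc)
      obtain ⟨C', hC'⟩ := hdom QA hQA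
      set M := ENNReal.ofReal (2 * C ^ 2)
      refine ⟨(2 * (C' * ENNReal.ofReal c) + 2 * M * νA QA) * νB QB, ?_, fun k => ?_⟩
      · refine ENNReal.mul_ne_top (ENNReal.add_ne_top.2 ⟨?_, ?_⟩) hQB.measure_ne_top
        · exact ENNReal.mul_ne_top (by simp) (ENNReal.mul_ne_top (by simp) (by simp))
        · exact ENNReal.mul_ne_top (ENNReal.mul_ne_top (by simp) ENNReal.ofReal_ne_top)
            hQA.measure_ne_top
      · refine (hle (t k) M fun b hb => ?_).trans ?_
        · refine ENNReal.ofReal_le_ofReal ((hdisp b k).trans ?_)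
          have := pow_le_pow_left₀ dist_nonneg (hC _ ⟨b, hb, rfl⟩) 2
          linarith
        · gcongr
          refine (lintegral_mono' hC' le_rfl).trans ?_
          rw [lintegral_smul_measure, ENNReal.smul_def, smul_eq_mul]
          gcongr
          rw [← ofReal_integral_eq_lintegral_ofReal (integrable_displacement_sq hαm h₀ _)
            (Eventually.of_forall fun a => sq_nonneg _)]
          exact ENNReal.ofReal_le_ofReal (ht k).2) y₀
    obtain ⟨k, hk⟩ := htu R
    exact absurd (hR k) hk.not_ge

/-- Two minimisers are at constant distance. -/
theorem ae_dist_eq_const (hμ : MeasurePreserving e (νA.prod νB) μ)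
    (hdense : DenseRange fun γ : Γ => (e.symm (γ : G)).2) {y y' : L2Map μ D φ}
    (h : ∀ᵐ a ∂νA, ∀ᵐ x ∂μ,
      dist (y (x * e (a, 1))) (y' (x * e (a, 1))) = dist (y x) (y' x)) :
    ∀ᵐ x ∂μ, dist (y x) (y' x) = (√(μ D).toReal)⁻¹ * dist y y' := by
  have hem : Measurable e := e.continuous.measurable
  set f : A × B → ℝ := fun p => dist (y (e p)) (y' (e p)) with hf
  have hfm : Measurable f := (y.measurable.comp hem).dist (y'.measurable.comp hem)
  have h1 : ∀ᵐ a ∂νA, ∀ᵐ p ∂νA.prod νB, f (p.1 * a, p.2) = f p := by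
    filter_upwards [h] with a ha
    filter_upwards [hμ.quasiMeasurePreserving.ae ha] with p hp
    rw [← map_mul] at hp
    simpa [hf, Prod.mul_def] using hp
  -- Exchanging quantifiers and translating by `p.1⁻¹` turns invariance under almost every `a` into
  -- independence of the first coordinate.
  have h2 : ∀ᵐ p ∂νA.prod νB, ∀ᵐ a ∂νA, f (p.1 * a, p.2) = f p :=
    (Measure.ae_ae_comm (p := fun a (p : A × B) => f (p.1 * a, p.2) = f p)
      (measurableSet_eq_fun (by fun_prop) (by fun_prop))).1 h1
  have h3 : ∀ᵐ p ∂νA.prod νB, ∀ᵐ a ∂νA, f (a, p.2) = f p := by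
    filter_upwards [h2] with p hp
    have := (measurePreserving_mul_left νA p.1⁻¹).quasiMeasurePreserving.ae hp
    simpa using this
  obtain ⟨a₀, ha₀⟩ := (Measure.ae_ae_of_ae_prod h3).exists
  have h4 : ∀ᵐ a ∂νA, ∀ᵐ b ∂νB, f (a, b) = f (a₀, b) :=
    (Measure.ae_ae_comm (p := fun a b => f (a, b) = f (a₀, b))
      (measurableSet_eq_fun (by fun_prop) (by fun_prop))).2 ha₀
  -- As a function of the second coordinate alone, the `Γ`-invariant distance is invariant under the
  -- dense projection of `Γ`.
  obtain ⟨c, hc⟩ := exists_ae_eq_const_of_dense νB hdense (f := fun b => f (a₀, b))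
    (by fun_prop) (by
      rintro _ ⟨γ, rfl⟩
      obtain ⟨a, ha, ha'⟩ := (h4.and ((measurePreserving_mul_left νA
        (e.symm (γ : G)).1).quasiMeasurePreserving.ae h4)).exists
      filter_upwards [ha, (measurePreserving_mul_left νB
        (e.symm (γ : G)).2).quasiMeasurePreserving.ae ha'] with b hb hb'
      rw [← hb, ← hb']
      have h5 : e ((e.symm (γ : G)).1 * a, (e.symm (γ : G)).2 * b) = (γ : G) * e (a, b) := by
        rw [← Prod.mk_mul_mk, map_mul]
        simp
      simp only [hf, h5, dist_mul_left])
  have h6 : ∀ᵐ p ∂νA.prod νB, f p = c := by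
    refine (Measure.ae_prod_iff_ae_ae (measurableSet_eq_fun hfm measurable_const)).2 ?_
    filter_upwards [h4] with a ha
    filter_upwards [ha, hc] with b hb hb'
    rw [hb, hb']
  have h7 : ∀ᵐ x ∂μ, dist (y x) (y' x) = c := by
    have h7' := (ae_map_iff (p := fun x => dist (y x) (y' x) = c) hem.aemeasurable
      (measurableSet_eq_fun (y.measurable_dist y') measurable_const)).2 h6
    rwa [hμ.map_eq] at h7'
  have hc0 : 0 ≤ c := by
    obtain ⟨x, hx⟩ := h7.exists
    exact hx ▸ dist_nonneg
  have hμD : 0 < (μ D).toReal := ENNReal.toReal_pos hD.measure_ne_zero hD.measure_ne_top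
  have h8 : dist y y' ^ 2 = (μ D).toReal * c ^ 2 := by
    have h9 : (fun x => dist (y x) (y' x) ^ 2) =ᵐ[μ.restrict D] fun _ => c ^ 2 := by
      filter_upwards [ae_restrict_of_ae h7] with x hx
      rw [hx]
    rw [dist_sq, integral_congr_ae h9, setIntegral_const]
    rfl
  have h10 : dist y y' = √(μ D).toReal * c := by
    rw [← Real.sqrt_sq (dist_nonneg (x := y)), h8, Real.sqrt_mul hμD.le, Real.sqrt_sq hc0]
  rw [h10, inv_mul_cancel_left₀ (Real.sqrt_pos.2 hμD).ne']
  exact h7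

end L2Map

/-- A point lies in a countable set that is stable under countably many operations. -/
theorem exists_countable_stable {Y ι : Type*} [Countable ι] {F : Set Y} {v : Y} (hv : v ∈ F)
    (op : Y → Y → Y) (hop : ∀ x ∈ F, ∀ y ∈ F, op x y ∈ F) (T : ι → Y → Y)
    (hT : ∀ i, ∀ x ∈ F, T i x ∈ F) :
    ∃ F₀ ⊆ F, F₀.Countable ∧ v ∈ F₀ ∧ (∀ x ∈ F₀, ∀ y ∈ F₀, op x y ∈ F₀) ∧
      ∀ i, ∀ x ∈ F₀, T i x ∈ F₀ := by
  let s : ℕ → Set Y := fun n => Nat.rec {v}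
    (fun _ P => P ∪ (Set.image2 op P P ∪ ⋃ i, T i '' P)) n
  have hs : ∀ n, s (n + 1) = s n ∪ (Set.image2 op (s n) (s n) ∪ ⋃ i, T i '' s n) := fun n => rfl
  have hmono : Monotone s := monotone_nat_of_le_succ fun n => by
    rw [hs]
    exact Set.subset_union_left
  have hsF : ∀ n, s n ⊆ F := fun n => by
    induction n with
    | zero => exact Set.singleton_subset_iff.2 hv
    | succ n ih =>
      rw [hs]
      refine Set.union_subset ih (Set.union_subset ?_ (Set.iUnion_subset fun i => ?_))
      · rintro _ ⟨x, hx, y, hy, rfl⟩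
        exact hop x (ih hx) y (ih hy)
      · rintro _ ⟨x, hx, rfl⟩
        exact hT i x (ih hx)
  have hsc : ∀ n, (s n).Countable := fun n => by
    induction n with
    | zero => exact Set.countable_singleton v
    | succ n ih =>
      rw [hs]
      exact ih.union ((ih.image2 ih op).union (Set.countable_iUnion fun i => ih.image _))
  refine ⟨⋃ n, s n, Set.iUnion_subset hsF, Set.countable_iUnion hsc,
    Set.mem_iUnion.2 ⟨0, rfl⟩, fun x hx y hy => ?_, fun i x hx => ?_⟩
  · obtain ⟨n, hn⟩ := Set.mem_iUnion.1 hx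
    obtain ⟨m, hm⟩ := Set.mem_iUnion.1 hy
    refine Set.mem_iUnion.2 ⟨max n m + 1, ?_⟩
    rw [hs]
    exact Or.inr (Or.inl ⟨x, hmono (le_max_left n m) hn, y, hmono (le_max_right n m) hm, rfl⟩)
  · obtain ⟨n, hn⟩ := Set.mem_iUnion.1 hx
    refine Set.mem_iUnion.2 ⟨n + 1, ?_⟩
    rw [hs]
    exact Or.inr (Or.inr (Set.mem_iUnion.2 ⟨i, x, hn, rfl⟩))

/-! ### Regularity of minimisers on slices of the product -/

namespace L2Map

variable {A B G : Type*} [Group A] [TopologicalSpace A] [IsTopologicalGroup A]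
  [SecondCountableTopology A] [T2Space A] [LocallyCompactSpace A] [MeasurableSpace A] [BorelSpace A]
  [Group B] [TopologicalSpace B] [IsTopologicalGroup B] [SecondCountableTopology B] [T2Space B]
  [LocallyCompactSpace B] [MeasurableSpace B] [BorelSpace B]
  [Group G] [TopologicalSpace G] [IsTopologicalGroup G] [SecondCountableTopology G] [T2Space G]
  [LocallyCompactSpace G] [MeasurableSpace G] [BorelSpace G]
  {e : A × B ≃ₜ* G} {νA : Measure A} {νB : Measure B} {μ : Measure G} [νA.IsHaarMeasure]
  [νB.IsHaarMeasure] [μ.IsHaarMeasure]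
  {X : Type*} [MetricSpace X] [ProperSpace X] [MeasurableSpace X] [BorelSpace X]
  {Γ : Subgroup G} {D : Set G} [hD : IsLatticeDomain Γ μ D] [Countable Γ] {φ : Γ →* (X ≃ᵢ X)}

theorem mul_factor (a : A) (b c : B) : e (a, b) * e (1, c) = e (a, b * c) := by
  rw [← map_mul, Prod.mk_mul_mk, mul_one]

theorem displacement_factor_mul (y : L2Map μ D φ) (b c : B) :
    dist y (e (1, b * c) • y) ≤ dist y (e (1, b) • y) + dist y (e (1, c) • y) := by
  rw [← mul_factor]
  exact displacement_mul y _ _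

theorem displacement_factor_inv (y : L2Map μ D φ) (b : B) :
    dist y (e (1, b⁻¹) • y) = dist y (e (1, b) • y) := by
  rw [← displacement_inv y (e (1, b)), ← map_inv, Prod.inv_mk, inv_one]

/-- A map whose displacement in the direction of the second factor is constant is continuous in
that direction. -/
theorem continuous_in_factor (hμ : MeasurePreserving e (νA.prod νB) μ) {y : L2Map μ D φ} {κ : ℝ}
    (hκ : 0 ≤ κ)
    (h : ∀ b, ∀ᵐ x ∂μ, dist (y x) (y (x * e (1, b))) = κ * dist y (e (1, b) • y)) :
    Continuous (fun b => κ * dist y (e (1, b) • y)) ∧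
      ∀ᵐ a ∂νA, ∃ u : B → X, Continuous u ∧ ∀ᵐ b ∂νB, y (e (a, b)) = u b := by
  have hem : Measurable e := e.continuous.measurable
  set q : B → ℝ := fun b => κ * dist y (e (1, b) • y) with hq
  have hqm : Measurable q := (y.measurable_displacement.comp
    (e.continuous.comp (by fun_prop : Continuous fun b : B => ((1 : A), b))).measurable).const_mul κ
  have hqmul : ∀ b c, q (b * c) ≤ q b + q c := fun b c => by
    simp only [hq, ← mul_add]
    exact mul_le_mul_of_nonneg_left (displacement_factor_mul y b c) hκ
  have hqinv : ∀ b, q b⁻¹ = q b := fun b => by simp only [hq, displacement_factor_inv]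
  have hq1 : q 1 = 0 := by
    simp only [hq]
    rw [← Prod.one_eq_mk, map_one, one_smul, dist_self, mul_zero]
  have hym : Measurable fun p : A × B => y (e p) := y.measurable.comp hem
  have h1 : ∀ᵐ b ∂νB, ∀ᵐ p ∂νA.prod νB, dist (y (e p)) (y (e (p.1, p.2 * b))) = q b := by
    refine Eventually.of_forall fun b => ?_
    filter_upwards [hμ.quasiMeasurePreserving.ae (h b)] with p hp
    rwa [mul_factor] at hp
  have h2 : ∀ᵐ p ∂νA.prod νB, ∀ᵐ b ∂νB, dist (y (e p)) (y (e (p.1, p.2 * b))) = q b := by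
    refine (Measure.ae_ae_comm (p := fun b (p : A × B) =>
      dist (y (e p)) (y (e (p.1, p.2 * b))) = q b) (measurableSet_eq_fun ?_ ?_)).1 h1
    · exact (hym.comp measurable_snd).dist (hym.comp (by fun_prop :
        Measurable fun z : B × (A × B) => (z.2.1, z.2.2 * z.1)))
    · exact hqm.comp measurable_fst
  have h3 : ∀ᵐ p ∂νA.prod νB, ∀ᵐ b ∂νB, dist (y (e p)) (y (e (p.1, b))) = q (p.2⁻¹ * b) := by
    filter_upwards [h2] with p hp
    have := (measurePreserving_mul_left νB p.2⁻¹).quasiMeasurePreserving.ae hp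
    simpa using this
  have h4 := Measure.ae_ae_of_ae_prod h3
  -- `q` is a measurable length function whose sublevel sets at positive heights have positive
  -- measure, because it is a distance along a slice of `y`; Steinhaus makes it continuous at `1`.
  have hqc : Continuous q := by
    refine continuous_of_length hqmul hqinv ?_
    obtain ⟨a, ha⟩ := h4.exists
    refine tendsto_order.2 ⟨fun r hr => ?_, fun r hr => ?_⟩
    · exact Eventually.of_forall fun b => hr.trans_le (mul_nonneg hκ dist_nonneg)
    · have h5 := measure_length_le_ne_zero νB (f := fun b => y (e (a, b))) ha
        (show 0 < r / 4 by linarith)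
      have h6 := length_le_mem_nhds_one νB hqm (fun g h => by
        rw [div_eq_mul_inv, ← hqinv h]
        exact hqmul g h⁻¹) h5
      filter_upwards [h6] with b hb
      have h7 : q b ≤ 2 * (r / 4) := hb
      linarith
  refine ⟨hqc, ?_⟩
  filter_upwards [h4] with a ha
  obtain ⟨u, hu, hfu⟩ := exists_continuous_representative νB (f := fun b => y (e (a, b))) hqc hq1 ha
  refine ⟨u, continuous_iff_continuousAt.2 fun b => ?_, hfu⟩
  refine tendsto_iff_dist_tendsto_zero.2 ?_
  have h5 : Tendsto (fun c : B => q (b⁻¹ * c)) (𝓝 b) (𝓝 (q (b⁻¹ * b))) :=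
    (hqc.comp (continuous_const_mul b⁻¹)).tendsto b
  rw [inv_mul_cancel, hq1] at h5
  refine h5.congr fun c => ?_
  rw [dist_comm, hu]

/-- Fubini turns equal pointwise displacements along the first factor into equal variation between
generic slices. Among minimisers this variation does not depend on the map, which gives the uniform
error in the quasi-action of `Γ`. -/
theorem ae_dist_eq_dist_of_ae (hμ : MeasurePreserving e (νA.prod νB) μ) {y y' : L2Map μ D φ}
    (h : ∀ᵐ a ∂νA, ∀ᵐ x ∂μ,
      dist (y x) (y (x * e (a, 1))) = dist (y' x) (y' (x * e (a, 1)))) :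
    ∀ᵐ a ∂νA, ∀ᵐ a' ∂νA, ∀ᵐ b ∂νB,
      dist (y (e (a, b))) (y (e (a', b))) = dist (y' (e (a, b))) (y' (e (a', b))) := by
  have hem : Measurable e := e.continuous.measurable
  have hym : ∀ y : L2Map μ D φ, Measurable fun p : A × B => y (e p) :=
    fun y => y.measurable.comp hem
  have hdm : ∀ y : L2Map μ D φ, Measurable fun z : A × (A × B) =>
      dist (y (e z.2)) (y (e (z.2.1 * z.1, z.2.2))) := fun y =>
    ((hym y).comp measurable_snd).dist ((hym y).comp (by fun_prop :
        Measurable fun z : A × (A × B) => (z.2.1 * z.1, z.2.2)))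
  have hdm' : ∀ (y : L2Map μ D φ) (a : A), Measurable fun z : B × A =>
      dist (y (e (a, z.1))) (y (e (z.2, z.1))) := fun y a =>
    ((hym y).comp (by fun_prop : Measurable fun z : B × A => (a, z.1))).dist
      ((hym y).comp (by fun_prop : Measurable fun z : B × A => (z.2, z.1)))
  have h1 : ∀ᵐ a ∂νA, ∀ᵐ p ∂νA.prod νB, dist (y (e p)) (y (e (p.1 * a, p.2))) =
      dist (y' (e p)) (y' (e (p.1 * a, p.2))) := by
    filter_upwards [h] with a ha
    filter_upwards [hμ.quasiMeasurePreserving.ae ha] with p hp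
    rw [← map_mul] at hp
    simpa [Prod.mul_def] using hp
  have h2 : ∀ᵐ p ∂νA.prod νB, ∀ᵐ a ∂νA, dist (y (e p)) (y (e (p.1 * a, p.2))) =
      dist (y' (e p)) (y' (e (p.1 * a, p.2))) :=
    (Measure.ae_ae_comm (p := fun a (p : A × B) => dist (y (e p)) (y (e (p.1 * a, p.2))) =
      dist (y' (e p)) (y' (e (p.1 * a, p.2)))) (measurableSet_eq_fun (hdm y) (hdm y'))).1 h1
  have h3 : ∀ᵐ p ∂νA.prod νB, ∀ᵐ a ∂νA, dist (y (e p)) (y (e (a, p.2))) =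
      dist (y' (e p)) (y' (e (a, p.2))) := by
    filter_upwards [h2] with p hp
    have := (measurePreserving_mul_left νA p.1⁻¹).quasiMeasurePreserving.ae hp
    simpa using this
  filter_upwards [Measure.ae_ae_of_ae_prod h3] with a ha
  exact (Measure.ae_ae_comm (p := fun b a' => dist (y (e (a, b))) (y (e (a', b))) =
    dist (y' (e (a, b))) (y' (e (a', b)))) (measurableSet_eq_fun (hdm' y a) (hdm' y' a))).1 ha

end L2Map

/-! ### Fixed map or continuity through the second factor -/

namespace L2Map

variable {A B G : Type*} [Group A] [TopologicalSpace A] [IsTopologicalGroup A]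
  [SecondCountableTopology A] [T2Space A] [LocallyCompactSpace A] [MeasurableSpace A] [BorelSpace A]
  [Group B] [TopologicalSpace B] [IsTopologicalGroup B] [SecondCountableTopology B] [T2Space B]
  [LocallyCompactSpace B] [MeasurableSpace B] [BorelSpace B]
  [Group G] [TopologicalSpace G] [IsTopologicalGroup G] [SecondCountableTopology G] [T2Space G]
  [LocallyCompactSpace G] [MeasurableSpace G] [BorelSpace G]
  {e : A × B ≃ₜ* G} {νA : Measure A} {νB : Measure B} {μ : Measure G} [νA.IsHaarMeasure]
  [νB.IsHaarMeasure] [μ.IsHaarMeasure]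
  {X : Type*} [MetricSpace X] [ProperSpace X] [MeasurableSpace X] [BorelSpace X]
  {Γ : Subgroup G} {D : Set G} [hD : IsLatticeDomain Γ μ D] [Countable Γ] {φ : Γ →* (X ≃ᵢ X)}

theorem map_mul_factors (γ : Γ) (a : A) (b : B) :
    e ((e.symm (γ : G)).1 * a, (e.symm (γ : G)).2 * b) = (γ : G) * e (a, b) := by
  rw [← Prod.mk_mul_mk, map_mul]
  simp

/-- An unbounded minimising set makes `φ` continuous for the topology of the second factor. -/
theorem tendsto_one_of_minimizing_set (hX : IsCAT0 X) (hμ : MeasurePreserving e (νA.prod νB) μ)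
    (hind : IsIndecomposable φ.range)
    (hdense : DenseRange fun γ : Γ => (e.symm (γ : G)).2)
    {F : Set (L2Map μ D φ)} (hmid : ∀ y ∈ F, ∀ y' ∈ F, mid hX y y' ∈ F)
    (hinv : ∀ b, ∀ y ∈ F, e (1, b) • y ∈ F)
    (hF : ∀ y ∈ F, ∀ y' ∈ F, ∀ᵐ a ∂νA, ∀ᵐ x ∂μ,
        dist (y (x * e (a, 1))) (y' (x * e (a, 1))) = dist (y x) (y' x) ∧
        dist (y x) (y (x * e (a, 1))) = dist (y' x) (y' (x * e (a, 1))))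
    {v : L2Map μ D φ} (hv : v ∈ F) (hunb : ∀ R : ℝ, ∃ b : B, R < dist v (e (1, b) • v)) :
    Tendsto φ (comap (fun γ : Γ => (e.symm (γ : G)).2) (𝓝 1)) (𝓝 1) := by
  set pA : Γ → A := fun γ => (e.symm (γ : G)).1 with hpA
  set pB : Γ → B := fun γ => (e.symm (γ : G)).2 with hpB
  set κ : ℝ := (√(μ D).toReal)⁻¹ with hκ
  have hκ0 : 0 < κ := inv_pos.2 (Real.sqrt_pos.2
    (ENNReal.toReal_pos hD.measure_ne_zero hD.measure_ne_top))
  have hconst : ∀ y ∈ F, ∀ y' ∈ F, ∀ᵐ x ∂μ, dist (y x) (y' x) = κ * dist y y' :=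
    fun y hy y' hy' => ae_dist_eq_const hμ hdense ((hF y hy y' hy').mono fun a ha =>
      ha.mono fun x hx => hx.1)
  have hcts := fun y (hy : y ∈ F) => continuous_in_factor (y := y) hμ hκ0.le fun b =>
    hconst y hy _ (hinv b y hy)
  -- A generic point must serve all maps at once, so `F` is replaced by a countable subset stable
  -- under midpoints and the projected lattice.
  obtain ⟨F₀, hF₀F, hF₀c, hvF₀, hF₀mid, hF₀inv⟩ := exists_countable_stable hv (mid hX) hmid
    (fun (γ : Γ) y => e (1, pB γ) • y) fun γ => hinv (pB γ)
  -- the conditions defining generic points of the first factor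
  let P : A → Prop := fun a =>
    (∀ y ∈ F₀, ∃ u : B → X, Continuous u ∧ ∀ᵐ b ∂νB, y (e (a, b)) = u b) ∧
    (∀ᵐ a' ∂νA, ∀ y ∈ F₀, ∀ᵐ b ∂νB,
      dist (y (e (a, b))) (y (e (a', b))) = dist (v (e (a, b))) (v (e (a', b)))) ∧
    ∀ y ∈ F₀, ∀ y' ∈ F₀, ∀ᵐ b ∂νB, dist (y (e (a, b))) (y' (e (a, b))) = κ * dist y y'
  have hP : ∀ᵐ a ∂νA, P a := by
    have h1 : ∀ᵐ a ∂νA, ∀ y ∈ F₀, ∃ u : B → X, Continuous u ∧ ∀ᵐ b ∂νB, y (e (a, b)) = u b :=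
      (ae_ball_iff hF₀c).2 fun y hy => (hcts y (hF₀F hy)).2
    have h2 : ∀ᵐ a ∂νA, ∀ y ∈ F₀, ∀ᵐ a' ∂νA, ∀ᵐ b ∂νB,
        dist (y (e (a, b))) (y (e (a', b))) = dist (v (e (a, b))) (v (e (a', b))) :=
      (ae_ball_iff hF₀c).2 fun y hy => ae_dist_eq_dist_of_ae hμ
        ((hF y (hF₀F hy) v hv).mono fun a ha => ha.mono fun x hx => hx.2)
    have h3 : ∀ᵐ a ∂νA, ∀ y ∈ F₀, ∀ y' ∈ F₀, ∀ᵐ b ∂νB,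
        dist (y (e (a, b))) (y' (e (a, b))) = κ * dist y y' :=
      (ae_ball_iff hF₀c).2 fun y hy => (ae_ball_iff hF₀c).2 fun y' hy' =>
        Measure.ae_ae_of_ae_prod (hμ.quasiMeasurePreserving.ae
          (hconst y (hF₀F hy) y' (hF₀F hy')))
    filter_upwards [h1, h2, h3] with a ha1 ha2 ha3
    exact ⟨ha1, (ae_ball_iff hF₀c).2 ha2, ha3⟩
  -- All lattice translates of `a₀` must be generic too, because `φ γ` carries the slice at `a₀` to
  -- the one at `pA γ * a₀`.
  have hPΓ : ∀ᵐ a ∂νA, ∀ γ, P (pA γ * a) := ae_all_iff.2 fun γ =>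
    (measurePreserving_mul_left νA (pA γ)).quasiMeasurePreserving.ae hP
  obtain ⟨a₀, ha₀, ha₀Γ⟩ := (hP.and hPΓ).exists
  have hexu : ∀ (a : A) (y : F₀), ∃ u : B → X, P a →
      Continuous u ∧ ∀ᵐ b ∂νB, (y : L2Map μ D φ) (e (a, b)) = u b := fun a y => by
    by_cases h : P a
    · obtain ⟨u, hu⟩ := h.1 y y.2
      exact ⟨u, fun _ => hu⟩
    · exact ⟨fun _ => v 1, fun h' => absurd h' h⟩
  choose u hu using hexu
  have hdist : ∀ (y y' : F₀) (b : B), dist (u a₀ y b) (u a₀ y' b) =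
      κ * dist (y : L2Map μ D φ) y' := fun y y' => by
    have h1 : (fun b => dist (u a₀ y b) (u a₀ y' b)) =
        fun _ => κ * dist (y : L2Map μ D φ) y' := by
      refine (Continuous.ae_eq_iff_eq νB ((hu a₀ y ha₀).1.dist (hu a₀ y' ha₀).1)
        continuous_const).1 ?_
      filter_upwards [(hu a₀ y ha₀).2, (hu a₀ y' ha₀).2, ha₀.2.2 y y.2 y' y'.2] with b h1 h2 h3
      rw [← h1, ← h2, h3]
    exact fun b => congrFun h1 b
  let ρ : Γ → F₀ → F₀ := fun γ y => ⟨e (1, pB γ) • y, hF₀inv γ y y.2⟩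
  have hρu : ∀ γ y b, u a₀ (ρ γ y) b = u a₀ y (b * pB γ) := fun γ y => by
    have h1 : u a₀ (ρ γ y) = fun b => u a₀ y (b * pB γ) := by
      refine (Continuous.ae_eq_iff_eq νB (hu a₀ (ρ γ y) ha₀).1
        ((hu a₀ y ha₀).1.comp (continuous_mul_const (pB γ)))).1 ?_
      filter_upwards [(hu a₀ (ρ γ y) ha₀).2,
        (quasiMeasurePreserving_mul_right νB (pB γ)).ae (hu a₀ y ha₀).2] with b h1 h2
      rw [Function.comp_apply, ← h1, ← h2, ← mul_factor, ← smul_apply]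
    exact fun b => congrFun h1 b
  have hmidu : ∀ y y' : F₀, ∃ z : F₀, ∀ b, u a₀ z b = hX.mid (u a₀ y b) (u a₀ y' b) :=
    fun y y' => by
    refine ⟨⟨mid hX y y', hF₀mid y y.2 y' y'.2⟩, ?_⟩
    have h1 : u a₀ ⟨mid hX y y', hF₀mid y y.2 y' y'.2⟩ =
        fun b => hX.mid (u a₀ y b) (u a₀ y' b) := by
      refine (Continuous.ae_eq_iff_eq νB (hu a₀ _ ha₀).1
        (hX.isMidpointMap.continuous_uncurry.comp
          ((hu a₀ y ha₀).1.prodMk (hu a₀ y' ha₀).1))).1 ?_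
      filter_upwards [(hu a₀ ⟨mid hX y y', hF₀mid y y.2 y' y'.2⟩ ha₀).2, (hu a₀ y ha₀).2,
        (hu a₀ y' ha₀).2] with b h1 h2 h3
      rw [Function.comp_apply, ← h1, ← h2, ← h3, mid_apply]
    exact fun b => congrFun h1 b
  have hequi : ∀ (γ : Γ) (y : F₀) (b : B),
      φ γ (u a₀ y b) = u (pA γ * a₀) y (pB γ * b) := fun γ y => by
    have h1 : (fun b => φ γ (u a₀ y b)) = fun b => u (pA γ * a₀) y (pB γ * b) := by
      refine (Continuous.ae_eq_iff_eq νB ((φ γ).continuous.comp (hu a₀ y ha₀).1)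
        ((hu _ y (ha₀Γ γ)).1.comp (continuous_const_mul (pB γ)))).1 ?_
      filter_upwards [(hu a₀ y ha₀).2, (measurePreserving_mul_left νB
        (pB γ)).quasiMeasurePreserving.ae (hu _ y (ha₀Γ γ)).2] with b h1 h2
      rw [Function.comp_apply, Function.comp_apply, ← h1, ← h2, map_mul_factors, equivariant]
    exact fun b => congrFun h1 b
  have hcomp : ∀ a a' : A, P a → P a' → (∀ y ∈ F₀, ∀ᵐ b ∂νB,
      dist (y (e (a, b))) (y (e (a', b))) = dist (v (e (a, b))) (v (e (a', b)))) →
      ∀ (y : F₀) (b : B), dist (u a y b) (u a' y b) =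
        dist (u a ⟨v, hvF₀⟩ b) (u a' ⟨v, hvF₀⟩ b) := fun a a' ha ha' h y => by
    have h1 : (fun b => dist (u a y b) (u a' y b)) =
        fun b => dist (u a ⟨v, hvF₀⟩ b) (u a' ⟨v, hvF₀⟩ b) := by
      refine (Continuous.ae_eq_iff_eq νB ((hu a y ha).1.dist (hu a' y ha').1)
        ((hu a _ ha).1.dist (hu a' _ ha').1)).1 ?_
      filter_upwards [(hu a y ha).2, (hu a' y ha').2, (hu a ⟨v, hvF₀⟩ ha).2,
        (hu a' ⟨v, hvF₀⟩ ha').2, h y y.2] with b h1 h2 h3 h4 h5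
      rw [← h1, ← h2, ← h3, ← h4, h5]
    exact fun b => congrFun h1 b
  have hpB1 : ∀ γ : Γ, pB γ⁻¹ = (pB γ)⁻¹ := fun γ => by simp [hpB]
  -- The model is evaluation at `(a₀, 1)`: it multiplies distances by `κ`, respects midpoints, and
  -- carries translation by `pB γ` to the isometric map `ρ γ`.
  refine hind.tendsto_one_of_convex_model hX (tendsto_comap_iff.2 ?_) (fun y : F₀ => u a₀ y 1) ρ
    (fun γ y y' => ?_) (fun y y' => ?_) (fun γ => ?_) (fun y => ?_) fun hbdd => ?_
  · have h1 : Tendsto (fun γ => (pB γ)⁻¹) (comap pB (𝓝 1)) (𝓝 1) := by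
      have := (continuous_inv (G := B)).tendsto 1
      rw [inv_one] at this
      exact this.comp tendsto_comap
    exact h1.congr fun γ => (hpB1 γ).symm
  · simp only [hdist, ρ, dist_smul]
  · obtain ⟨z, hz⟩ := hmidu y y'
    exact ⟨z, hz 1⟩
  -- Genericity compares a slice only with almost every other one, so the slices at `a₀` and `pA γ *
  -- a₀` are compared through a third. The bound involves `v` alone and not `y`.
  · obtain ⟨a₂, ha₂, h0, h1⟩ := (hP.and (ha₀.2.1.and (ha₀Γ γ).2.1)).exists
    refine ⟨dist (u (pA γ * a₀) ⟨v, hvF₀⟩ (pB γ)) (u a₂ ⟨v, hvF₀⟩ (pB γ)) +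
      dist (u a₀ ⟨v, hvF₀⟩ (pB γ)) (u a₂ ⟨v, hvF₀⟩ (pB γ)), fun y => ?_⟩
    rw [hequi, hρu, mul_one, one_mul, ← hcomp _ _ (ha₀Γ γ) ha₂ h1 y,
      ← hcomp _ _ ha₀ ha₂ h0 y]
    exact dist_triangle_right _ _ _
  · simp only [hρu, one_mul]
    exact ((hu a₀ y ha₀).1.tendsto 1).comp tendsto_comap
  -- The displacement of `v` is continuous in `b`; bounded on the dense projection of `Γ`, it would
  -- be bounded on `B`.
  · obtain ⟨R, hR⟩ := hbdd.subset_closedBall (u a₀ ⟨v, hvF₀⟩ 1)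
    have hcl : IsClosed {b : B | κ * dist v (e (1, b) • v) ≤ R} :=
      isClosed_le (hcts v hv).1 continuous_const
    have hsub : Set.range pB ⊆ {b : B | κ * dist v (e (1, b) • v) ≤ R} := by
      rintro _ ⟨γ, rfl⟩
      have h1 := hR ⟨ρ γ ⟨v, hvF₀⟩, rfl⟩
      rw [Metric.mem_closedBall, dist_comm, hdist] at h1
      exact h1
    obtain ⟨b, hb⟩ := hunb (R / κ)
    have h2 : κ * dist v (e (1, b) • v) ≤ R := hcl.closure_subset_iff.2 hsub (hdense b)
    rw [div_lt_iff₀' hκ0] at hb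
    linarith

/-- Either the second factor fixes a point of `S`, or `φ` is continuous for the topology of the
second factor. -/
theorem exists_fixed_or_tendsto_one (hX : IsCAT0 X) (hμ : MeasurePreserving e (νA.prod νB) μ)
    (hNE : ∀ T : Set X, (∀ γ, ∃ K, ∀ p ∈ T, dist (φ γ p) p ≤ K) → Bornology.IsBounded T)
    (hind : IsIndecomposable φ.range)
    (hdense : DenseRange fun γ : Γ => (e.symm (γ : G)).2)
    {S : Set (L2Map μ D φ)} (hne : S.Nonempty) (hcl : IsClosed S)
    (hmid : ∀ y ∈ S, ∀ y' ∈ S, mid hX y y' ∈ S) (hinv : ∀ b, ∀ y ∈ S, e (1, b) • y ∈ S) :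
    (∃ y ∈ S, ∀ b, dist y (e (1, b) • y) = 0) ∨
      Tendsto φ (comap (fun γ : Γ => (e.symm (γ : G)).2) (𝓝 1)) (𝓝 1) := by
  obtain ⟨F, hFS, ⟨v, hv⟩, hFcl, hFmid, hFinv, hF⟩ :=
    exists_minimizing_set hX hμ hNE hne hcl hmid hinv
  by_cases hR : ∃ R : ℝ, ∀ b : B, dist v (e (1, b) • v) ≤ R
  · left
    obtain ⟨R, hR⟩ := hR
    let E : B →* G :=
      { toFun := fun b => e (1, b)
        map_one' := by rw [← Prod.one_eq_mk, map_one]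
        map_mul' := fun b c => (mul_factor 1 b c).symm }
    let _ : MulAction B (L2Map μ D φ) := MulAction.compHom _ E
    have hsmul : ∀ (b : B) (y : L2Map μ D φ), b • y = e (1, b) • y := fun _ _ => rfl
    obtain ⟨y, hy, hfix⟩ := (isMidpointMap hX).exists_fixed_of_bounded_orbit (B := B)
      (fun b y y' => by rw [hsmul, hsmul, dist_smul]) hFcl hFmid
      (fun b y hy => by rw [hsmul]; exact hFinv b y hy) hv
      (R := R) fun b => by rw [hsmul]; exact hR b
    exact ⟨y, hFS hy, fun b => by rw [← hsmul]; exact hfix b⟩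
  · right
    push Not at hR
    exact tendsto_one_of_minimizing_set hX hμ hind hdense hFmid hFinv hF hv hR

end L2Map

/-! ### Lattices in products of second countable groups -/

/-- A group that displaces an unbounded set boundedly fixes a point at infinity, which an
unbounded indecomposable group does not. -/
theorem IsIndecomposable.isBounded_of_displacement {X : Type*} [MetricSpace X] [ProperSpace X]
    (hX : IsCAT0 X) {Δ : Type*} [Group Δ] {φ : Δ →* (X ≃ᵢ X)} (hind : IsIndecomposable φ.range)
    (hunb : IsUnbounded (φ.range : Set (X ≃ᵢ X))) (T : Set X)
    (hT : ∀ γ, ∃ K, ∀ p ∈ T, dist (φ γ p) p ≤ K) : Bornology.IsBounded T := by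
  by_contra hTb
  obtain ⟨x, hx⟩ := hunb
  obtain ⟨ξ, hξ⟩ := hX.exists_fixed_boundary (L := (φ.range : Set (X ≃ᵢ X))) hTb (by
    rintro _ ⟨γ, rfl⟩
    exact hT γ)
  have := hX.t2Space_boundary x
  have h1 := (hind {ξ} (Set.singleton_nonempty ξ) isClosed_singleton (by
    rintro g hg _ rfl
    exact hξ g hg)).1
  refine hx ((Bornology.isBounded_singleton (x := x)).subset ?_)
  rintro _ ⟨g, hg, rfl⟩
  have h2 : g = 1 := h1 g (subset_closure hg) (by
    rintro _ rfl
    exact hξ g hg)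
  rw [h2]
  rfl

/-- Splitting off a factor of a product. -/
def splitFactor {ι : Type*} [DecidableEq ι] (i : ι) (G : ι → Type*) [∀ j, Group (G j)]
    [∀ j, TopologicalSpace (G j)] :
    ((∀ j : {j // j ≠ i}, G j) × G i) ≃ₜ* (∀ j, G j) :=
  ContinuousMulEquiv.symm
    { (Homeomorph.piSplitAt i G).trans (Homeomorph.prodComm _ _) with
      map_mul' := fun _ _ => rfl }

theorem splitFactor_one_left {ι : Type*} [DecidableEq ι] (i : ι) (G : ι → Type*)
    [∀ j, Group (G j)] [∀ j, TopologicalSpace (G j)] (b : G i) :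
    splitFactor i G (1, b) = Pi.mulSingle i b := by
  refine (splitFactor i G).symm.injective ?_
  rw [ContinuousMulEquiv.symm_apply_apply]
  refine Prod.ext (funext fun j => ?_) ?_
  · exact (Pi.mulSingle_eq_of_ne (M := G) j.2 b).symm
  · exact (Pi.mulSingle_eq_same (M := G) i b).symm

/-! ### One factor at a time, and maps fixed by the whole group -/

namespace L2Map

section Step

variable {A B G : Type*} [Group A] [TopologicalSpace A] [IsTopologicalGroup A]
  [SecondCountableTopology A] [T2Space A] [LocallyCompactSpace A]
  [Group B] [TopologicalSpace B] [IsTopologicalGroup B] [SecondCountableTopology B] [T2Space B]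
  [LocallyCompactSpace B]
  [Group G] [TopologicalSpace G] [IsTopologicalGroup G] [SecondCountableTopology G] [T2Space G]
  [LocallyCompactSpace G] [MeasurableSpace G] [BorelSpace G] {μ : Measure G} [μ.IsHaarMeasure]
  {X : Type*} [MetricSpace X] [ProperSpace X] [MeasurableSpace X] [BorelSpace X]
  {Γ : Subgroup G} {D : Set G} [hD : IsLatticeDomain Γ μ D] [Countable Γ] {φ : Γ →* (X ≃ᵢ X)}

/-- Uniqueness of Haar measure identifies `μ` with a product measure up to a positive constant,
which is absorbed into the measure on `A`. -/
theorem exists_fixed_or_tendsto_one' (e : A × B ≃ₜ* G) (hX : IsCAT0 X)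
    (hNE : ∀ T : Set X, (∀ γ, ∃ K, ∀ p ∈ T, dist (φ γ p) p ≤ K) → Bornology.IsBounded T)
    (hind : IsIndecomposable φ.range)
    (hdense : DenseRange fun γ : Γ => (e.symm (γ : G)).2)
    {S : Set (L2Map μ D φ)} (hne : S.Nonempty) (hcl : IsClosed S)
    (hmid : ∀ y ∈ S, ∀ y' ∈ S, mid hX y y' ∈ S) (hinv : ∀ b, ∀ y ∈ S, e (1, b) • y ∈ S) :
    (∃ y ∈ S, ∀ b, dist y (e (1, b) • y) = 0) ∨
      Tendsto φ (comap (fun γ : Γ => (e.symm (γ : G)).2) (𝓝 1)) (𝓝 1) := by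
  borelize A B
  set ν := (Measure.haar : Measure A).prod (Measure.haar : Measure B)
  have hν : (ν.map e).IsHaarMeasure := e.isHaarMeasure_map ν
  have h1 := Measure.isMulLeftInvariant_eq_smul μ (ν.map e)
  set c := Measure.haarScalarFactor μ (ν.map e)
  have hc : c ≠ 0 := fun hc => by
    rw [hc, zero_smul] at h1
    exact NeZero.ne μ h1
  have hA : (c • (Measure.haar : Measure A)).IsHaarMeasure :=
    Measure.IsHaarMeasure.nnreal_smul _ hc
  have hμ : MeasurePreserving e
      ((c • (Measure.haar : Measure A)).prod (Measure.haar : Measure B)) μ :=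
    ⟨e.continuous.measurable, by rw [Measure.prod_smul_left, Measure.map_smul]; exact h1.symm⟩
  exact exists_fixed_or_tendsto_one hX hμ hNE hind hdense hne hcl hmid hinv

/-- An equivariant map fixed by the whole group is constant, and `φ` fixes its value. -/
theorem exists_fixed_of_invariant (y : L2Map μ D φ) (h : ∀ g : G, dist y (g • y) = 0) :
    ∃ p : X, ∀ γ, φ γ p = p := by
  have h1 : ∀ᵐ g ∂μ, ∀ᵐ x ∂μ, y x = y (x * g) := Eventually.of_forall fun g =>
    hD.ae_of_ae_restrict (Γ := Γ) (fun γ x hx => by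
      rw [mul_assoc, equivariant, equivariant] at hx
      exact (φ γ).injective hx) ((dist_eq_zero_iff y (g • y)).1 (h g))
  have h2 : ∀ᵐ x ∂μ, ∀ᵐ g ∂μ, y x = y (x * g) :=
    (Measure.ae_ae_comm (p := fun g x => y x = y (x * g)) (measurableSet_eq_fun
      (y.measurable.comp measurable_snd)
      (y.measurable.comp (measurable_snd.mul measurable_fst)))).1 h1
  obtain ⟨x, hx⟩ := h2.exists
  have h3 : ∀ᵐ z ∂μ, y z = y x := by
    have := (measurePreserving_mul_left μ x⁻¹).quasiMeasurePreserving.ae hx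
    filter_upwards [this] with z hz
    rw [hz, mul_inv_cancel_left]
  refine ⟨y x, fun γ => ?_⟩
  obtain ⟨z, hz, hz'⟩ := (h3.and
    ((measurePreserving_mul_left μ (γ : G)).quasiMeasurePreserving.ae h3)).exists
  rw [equivariant, hz] at hz'
  exact hz'

end Step

end L2Map

/-- If every factor failed, induction over sets of factors would produce maps fixed by more and more
of them, and finally a map fixed by `G`. Its value would be a fixed point of `Γ` in `X`,
contradicting unboundedness. -/
theorem exists_tendsto_one_of_secondCountable {ι : Type*} [Fintype ι] [DecidableEq ι]
    {G : ι → Type*} [∀ i, Group (G i)] [∀ i, TopologicalSpace (G i)]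
    [∀ i, IsTopologicalGroup (G i)] [∀ i, T2Space (G i)] [∀ i, LocallyCompactSpace (G i)]
    [∀ i, SecondCountableTopology (G i)] (Γ : Subgroup (∀ i, G i)) [DiscreteTopology Γ]
    [CompactSpace ((∀ i, G i) ⧸ Γ)] (hirr : ∀ i, DenseRange fun γ : Γ => (γ : ∀ i, G i) i)
    {X : Type*} [MetricSpace X] [ProperSpace X] (hX : IsCAT0 X) (φ : Γ →* (X ≃ᵢ X))
    (hind : IsIndecomposable φ.range) (hunb : IsUnbounded (φ.range : Set (X ≃ᵢ X))) :
    ∃ i, Tendsto φ (comap (fun γ : Γ => (γ : ∀ i, G i) i) (𝓝 1)) (𝓝 1) := by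
  by_contra! hcon
  let _ : MeasurableSpace (∀ i, G i) := borel _
  have : BorelSpace (∀ i, G i) := ⟨rfl⟩
  borelize X
  set μ : Measure (∀ i, G i) := Measure.haar
  have := countable_of_discrete Γ
  obtain ⟨D, hD⟩ := exists_isLatticeDomain Γ μ
  have hNE := hind.isBounded_of_displacement hX hunb
  obtain ⟨o, ho⟩ := hunb
  have key : ∀ I : Finset ι, ∃ y : L2Map μ D φ, ∀ g : ∀ i, G i, (∀ j ∉ I, g j = 1) →
      dist y (g • y) = 0 := by
    intro I
    induction I using Finset.induction_on with
    | empty =>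
      refine ⟨L2Map.const hD φ o, fun g hg => ?_⟩
      have h1 : g = 1 := funext fun j => hg j (Finset.notMem_empty j)
      rw [h1, one_smul, dist_self]
    | insert i I hi ih =>
      set S : Set (L2Map μ D φ) := {y | ∀ g : ∀ i, G i, (∀ j ∉ I, g j = 1) → dist y (g • y) = 0}
      have hScl : IsClosed S := by
        have : S = ⋂ (g : ∀ i, G i) (_ : ∀ j ∉ I, g j = 1),
            {y : L2Map μ D φ | dist y (g • y) = 0} := by
          ext y
          simp [S]
        rw [this]
        exact isClosed_iInter fun g => isClosed_iInter fun _ =>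
          isClosed_eq (continuous_id.dist (L2Map.continuous_smul_left g)) continuous_const
      have hSmid : ∀ y ∈ S, ∀ y' ∈ S, L2Map.mid hX y y' ∈ S := fun y hy y' hy' g hg => by
        have h1 := L2Map.displacement_mid_sq_le hX g y y'
        rw [hy g hg, hy' g hg] at h1
        exact pow_eq_zero_iff two_ne_zero |>.1 (le_antisymm (by linarith) (sq_nonneg _))
      have hSinv : ∀ b, ∀ y ∈ S, splitFactor i G (1, b) • y ∈ S := fun b y hy g hg => by
        have hcomm : g * splitFactor i G (1, b) = splitFactor i G (1, b) * g := by
          rw [splitFactor_one_left]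
          funext j
          by_cases hj : j = i
          · subst hj
            simp [hg j hi]
          · simp [Pi.mulSingle_eq_of_ne hj]
        rw [← mul_smul, hcomm, mul_smul, L2Map.dist_smul]
        exact hy g hg
      rcases L2Map.exists_fixed_or_tendsto_one' (splitFactor i G) hX hNE hind (hirr i)
        (show S.Nonempty from ih) hScl hSmid hSinv with ⟨y, hy, hfix⟩ | h
      · refine ⟨y, fun g hg => ?_⟩
        have h1 := hy (Function.update g i 1) fun j hj => by
          by_cases hji : j = i
          · subst hji
            simp
          · rw [Function.update_of_ne hji]
            exact hg j (by simp [hji, hj])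
        have h2 : g = Function.update g i 1 * splitFactor i G (1, g i) := by
          rw [splitFactor_one_left]
          funext j
          by_cases hj : j = i
          · subst hj
            simp
          · simp [Pi.mulSingle_eq_of_ne hj, Function.update_of_ne hj]
        have h3 := L2Map.displacement_mul y (Function.update g i 1) (splitFactor i G (1, g i))
        rw [← h2, h1, hfix, add_zero] at h3
        exact le_antisymm h3 dist_nonneg
      · exact absurd h (hcon i)
  obtain ⟨y, hy⟩ := key Finset.univ
  obtain ⟨p, hp⟩ := L2Map.exists_fixed_of_invariant y fun g => hy g (by simp)
  refine ho ((Metric.isBounded_closedBall (x := p) (r := dist o p)).subset ?_)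
  rintro _ ⟨_, ⟨γ, rfl⟩, rfl⟩
  have h1 : dist (φ γ o) (φ γ p) = dist o p := (φ γ).dist_eq o p
  rw [hp] at h1
  exact h1.le

/-! ### Second countable quotients of `σ`-compact groups -/

/-- A countable basis at `1` makes the group pseudometrisable, and `σ`-compact pseudometric spaces
are second countable. -/
theorem secondCountableTopology_of_nhds_one (G : Type*) [Group G] [TopologicalSpace G]
    [IsTopologicalGroup G] [SigmaCompactSpace G] (h : (𝓝 (1 : G)).IsCountablyGenerated) :
    SecondCountableTopology G := by
  let _ : UniformSpace G := IsTopologicalGroup.rightUniformSpace G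
  have : (uniformity G).IsCountablyGenerated := by
    rw [uniformity_eq_comap_nhds_one']
    infer_instance
  let _ : PseudoMetricSpace G := UniformSpace.pseudoMetricSpace G
  exact EMetric.secondCountable_of_sigmaCompact G

/-- The Kakutani–Kodaira theorem: a `σ`-compact locally compact group has arbitrarily small compact
normal subgroups with second countable quotient. -/
theorem exists_compact_normal_secondCountable {G : Type*} [Group G] [TopologicalSpace G]
    [IsTopologicalGroup G] [T2Space G] [LocallyCompactSpace G] [SigmaCompactSpace G] {U : Set G}
    (hU : U ∈ 𝓝 (1 : G)) :
    ∃ N : Subgroup G, N.Normal ∧ IsCompact (N : Set G) ∧ (N : Set G) ⊆ U ∧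
      SecondCountableTopology (G ⧸ N) := by
  set K := CompactExhaustion.choice G
  -- Each step halves the neighbourhood multiplicatively and makes conjugation by one more compact
  -- piece harmless; normality of the intersection follows because the pieces exhaust `G`.
  have hstep : ∀ (n : ℕ) (V : Set G), V ∈ 𝓝 (1 : G) → ∃ W ∈ 𝓝 (1 : G), IsClosed W ∧
      (∀ x ∈ W, x⁻¹ ∈ W) ∧ (∀ x ∈ W, ∀ y ∈ W, x * y ∈ V) ∧
      ∀ g ∈ K n, ∀ x ∈ W, g * x * g⁻¹ ∈ V := by
    intro n V hV
    have h1 : ∀ᶠ x in 𝓝 (1 : G), ∀ g ∈ K n, g * x * g⁻¹ ∈ V := by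
      refine (K.isCompact n).eventually_forall_of_forall_eventually
        (P := fun x g => g * x * g⁻¹ ∈ V) fun g _ => ?_
      have hc : Continuous fun z : G × G => z.2 * z.1 * z.2⁻¹ := by fun_prop
      have := hc.tendsto (1, g)
      simp only [mul_one, mul_inv_cancel] at this
      exact this hV
    obtain ⟨W₁, hW₁, h2⟩ := exists_nhds_one_split hV
    obtain ⟨W, hW, hWcl, hWsub⟩ := exists_mem_nhds_isClosed_subset (inter_mem h1 hW₁)
    refine ⟨W ∩ W⁻¹, inter_mem hW (inv_mem_nhds_one G hW), hWcl.inter hWcl.inv, fun x hx =>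
      ⟨hx.2, by simpa using hx.1⟩, fun x hx y hy => h2 x (hWsub hx.1).2 y (hWsub hy.1).2,
      fun g hg x hx => (hWsub hx.1).1 g hg⟩
  obtain ⟨C, hC, hCn⟩ := exists_compact_mem_nhds (1 : G)
  choose f hf using hstep
  let s : ℕ → {V : Set G // V ∈ 𝓝 (1 : G)} := fun n => Nat.rec ⟨C ∩ U, inter_mem hCn hU⟩
    (fun n V => ⟨f n V.1 V.2, (hf n V.1 V.2).1⟩) n
  -- The index is shifted since the initial set `C ∩ U` need be neither closed nor symmetric.
  let V : ℕ → Set G := fun n => (s (n + 1)).1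
  have hV0 : ∀ n, V n ∈ 𝓝 (1 : G) := fun n => (s (n + 1)).2
  have hVcl : ∀ n, IsClosed (V n) := fun n => (hf n (s n).1 (s n).2).2.1
  have hVinv : ∀ n, ∀ x ∈ V n, x⁻¹ ∈ V n := fun n => (hf n (s n).1 (s n).2).2.2.1
  have hVmul' : ∀ n, ∀ x ∈ V n, ∀ y ∈ V n, x * y ∈ (s n).1 := fun n =>
    (hf n (s n).1 (s n).2).2.2.2.1
  have hVmul : ∀ n, ∀ x ∈ V (n + 1), ∀ y ∈ V (n + 1), x * y ∈ V n := fun n => hVmul' (n + 1)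
  have hVconj : ∀ n, ∀ g ∈ K (n + 1), ∀ x ∈ V (n + 1), g * x * g⁻¹ ∈ V n := fun n =>
    (hf (n + 1) (s (n + 1)).1 (s (n + 1)).2).2.2.2.2
  have h1V : ∀ n, (1 : G) ∈ V n := fun n => mem_of_mem_nhds (hV0 n)
  have hanti : Antitone V := antitone_nat_of_succ_le fun n x hx => by
    simpa using hVmul n x hx 1 (h1V _)
  have hVCU : ∀ n, V n ⊆ C ∩ U := fun n x hx => by
    have h1 : x * 1 ∈ C ∩ U := hVmul' 0 x (hanti (Nat.zero_le n) hx) 1 (h1V _)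
    rwa [mul_one] at h1
  have hVcpt : ∀ n, IsCompact (V n) := fun n =>
    hC.of_isClosed_subset (hVcl n) fun x hx => (hVCU n hx).1
  let N : Subgroup G :=
    { carrier := ⋂ n, V n
      one_mem' := Set.mem_iInter.2 h1V
      mul_mem' := fun {x y} hx hy => Set.mem_iInter.2 fun n =>
        hVmul n x (Set.mem_iInter.1 hx _) y (Set.mem_iInter.1 hy _)
      inv_mem' := fun {x} hx => Set.mem_iInter.2 fun n => hVinv n x (Set.mem_iInter.1 hx n) }
  have hN : (N : Set G) = ⋂ n, V n := rfl
  have hNormal : N.Normal := ⟨fun x hx g => by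
    have hx' : ∀ n, x ∈ V n := Set.mem_iInter.1 hx
    obtain ⟨m, hm⟩ := K.exists_mem g
    refine Set.mem_iInter.2 fun n => ?_
    refine hanti (le_max_left n m) (hVconj _ g ?_ x (hx' _))
    exact K.subset ((le_max_right n m).trans (Nat.le_succ _)) hm⟩
  have hNcpt : IsCompact (N : Set G) :=
    hN ▸ (hVcpt 0).of_isClosed_subset (isClosed_iInter hVcl) (Set.iInter_subset _ 0)
  have hbasis : (𝓝 (1 : G ⧸ N)).HasBasis (fun _ : ℕ => True)
      fun n => (QuotientGroup.mk : G → G ⧸ N) '' V n := by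
    refine ⟨fun t => ⟨fun ht => ?_, ?_⟩⟩
    · obtain ⟨O, hOt, hO, h1O⟩ := mem_nhds_iff.1 ht
      obtain ⟨n, hn⟩ := exists_subset_nhds_of_isCompact (V := V)
        (directed_of_isDirected_le hanti) hVcpt
        (U := (QuotientGroup.mk : G → G ⧸ N) ⁻¹' O) fun x hx => by
          refine (hO.preimage QuotientGroup.continuous_mk).mem_nhds ?_
          have : (QuotientGroup.mk x : G ⧸ N) = 1 := (QuotientGroup.eq_one_iff x).2 hx
          rw [Set.mem_preimage, this]
          exact h1O
      exact ⟨n, trivial, (Set.image_subset_iff.2 hn).trans hOt⟩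
    · rintro ⟨n, -, hn⟩
      refine mem_of_superset ?_ hn
      have := QuotientGroup.isOpenMap_coe (N := N) |>.image_mem_nhds (hV0 n)
      exact this
  have hσ : SigmaCompactSpace (G ⧸ N) := by
    have := isSigmaCompact_range (QuotientGroup.continuous_mk (N := N))
    rwa [QuotientGroup.mk_surjective.range_eq, isSigmaCompact_univ_iff] at this
  refine ⟨N, hNormal, hNcpt, fun x hx => (hVCU 0 (Set.mem_iInter.1 hx 0)).2, ?_⟩
  exact secondCountableTopology_of_nhds_one (G ⧸ N) hbasis.isCountablyGenerated

/-! ### Reduction to second countable groups -/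

/-- The image of a uniform lattice modulo a small normal subgroup is a uniform lattice. -/
theorem discrete_and_cocompact_map {G G' : Type*} [Group G] [TopologicalSpace G]
    [IsTopologicalGroup G] [Group G'] [TopologicalSpace G'] [IsTopologicalGroup G'] (Γ : Subgroup G)
    [CompactSpace (G ⧸ Γ)] {π : G →* G'} (hπc : Continuous π) (hπo : IsOpenMap π)
    (hπs : Function.Surjective π) {W : Set G} (hW : W ∈ 𝓝 (1 : G))
    (hWΓ : ∀ x ∈ W, ∀ y ∈ W, x * y ∈ Γ → x * y = 1) (hker : (π.ker : Set G) ⊆ W) :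
    Function.Injective (π.comp Γ.subtype) ∧ DiscreteTopology (Γ.map π) ∧
      CompactSpace (G' ⧸ Γ.map π) := by
  have h1W : (1 : G) ∈ W := mem_of_mem_nhds hW
  refine ⟨(injective_iff_map_eq_one _).2 fun γ hγ => ?_, ?_, ?_⟩
  · have := hWΓ γ (hker hγ) 1 h1W (by simp)
    simpa using this
  · refine discreteTopology_of_isOpen_singleton_one ?_
    rw [isOpen_singleton_iff_nhds_eq_pure]
    refine le_antisymm ?_ (pure_le_nhds _)
    rw [le_pure_iff, nhds_subtype_eq_comap]
    refine ⟨π '' W, by simpa using hπo.image_mem_nhds hW, ?_⟩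
    rintro ⟨_, γ, hγ, rfl⟩ ⟨w, hw, hwγ⟩
    have hmem : w⁻¹ * γ ∈ π.ker := by
      rw [MonoidHom.mem_ker, map_mul, map_inv]
      exact inv_mul_eq_one.2 hwγ
    have h2 := hWΓ w hw _ (hker hmem) (by simpa using hγ)
    rw [mul_inv_cancel_left] at h2
    exact Subtype.ext (by simp [h2])
  · let f : G ⧸ Γ → G' ⧸ Γ.map π := Quotient.map' π fun x y hxy => by
      rw [QuotientGroup.leftRel_apply] at hxy ⊢
      exact ⟨_, hxy, by simp⟩
    have hfc : Continuous f := continuous_quot_lift _ (QuotientGroup.continuous_mk.comp hπc)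
    have hfs : Function.Surjective f := fun q => by
      obtain ⟨x', rfl⟩ := QuotientGroup.mk_surjective q
      obtain ⟨x, rfl⟩ := hπs x'
      exact ⟨QuotientGroup.mk x, rfl⟩
    exact hfs.compactSpace hfc

/-- Each factor is divided by a compact normal subgroup so small that the kernel meets `Γ` trivially
and the image of `Γ` stays a uniform lattice. Projections tending to `1` still do so in the
quotient, so continuity lifts back. -/
theorem exists_tendsto_one {ι : Type*} [Fintype ι] [DecidableEq ι]
    {G : ι → Type*} [∀ i, Group (G i)] [∀ i, TopologicalSpace (G i)]
    [∀ i, IsTopologicalGroup (G i)] [∀ i, T2Space (G i)] [∀ i, LocallyCompactSpace (G i)]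
    [∀ i, SigmaCompactSpace (G i)] (Γ : Subgroup (∀ i, G i)) [DiscreteTopology Γ]
    [CompactSpace ((∀ i, G i) ⧸ Γ)] (hirr : ∀ i, DenseRange fun γ : Γ => (γ : ∀ i, G i) i)
    {X : Type*} [MetricSpace X] [ProperSpace X] (hX : IsCAT0 X) (φ : Γ →* (X ≃ᵢ X))
    (hind : IsIndecomposable φ.range) (hunb : IsUnbounded (φ.range : Set (X ≃ᵢ X))) :
    ∃ i, Tendsto φ (comap (fun γ : Γ => (γ : ∀ i, G i) i) (𝓝 1)) (𝓝 1) := by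
  obtain ⟨U, hU, hUΓ⟩ : ∃ U ∈ 𝓝 (1 : ∀ i, G i), ∀ γ ∈ Γ, γ ∈ U → γ = 1 := by
    have h1 : ({1} : Set Γ) ∈ 𝓝 (1 : Γ) := mem_nhds_discrete.2 rfl
    rw [nhds_subtype_eq_comap] at h1
    obtain ⟨U, hU, h⟩ := h1
    exact ⟨U, hU, fun γ hγ hγU => congrArg Subtype.val (h (a := ⟨γ, hγ⟩) hγU)⟩
  obtain ⟨W, hW, hWU⟩ := exists_nhds_one_split hU
  have hW' := hW
  rw [nhds_pi, Filter.mem_pi'] at hW'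
  obtain ⟨I, t, ht, htW⟩ := hW'
  choose N hNn hNc hNt hNs using fun i => exists_compact_normal_secondCountable (ht i)
  have hNcl : ∀ i, IsClosed (N i : Set (G i)) := fun i => (hNc i).isClosed
  let π : (∀ i, G i) →* ∀ i, G i ⧸ N i := MonoidHom.piMap fun i => QuotientGroup.mk' (N i)
  have hπ : ∀ g i, π g i = QuotientGroup.mk (g i) := fun _ _ => rfl
  have hπc : Continuous π := continuous_pi fun i =>
    QuotientGroup.continuous_mk.comp (continuous_apply i)
  have hπs : Function.Surjective π := fun q =>
    ⟨fun i => (q i).out, funext fun i => Quotient.out_eq _⟩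
  have hπo : IsOpenMap π := IsOpenMap.piMap (f := fun i => (QuotientGroup.mk : G i → G i ⧸ N i))
    (fun i => QuotientGroup.isOpenMap_coe)
    (Eventually.of_forall fun i => QuotientGroup.mk_surjective)
  have hker : (π.ker : Set (∀ i, G i)) ⊆ W := fun g hg => htW fun i _ => by
    refine hNt i ((QuotientGroup.eq_one_iff _).1 ?_)
    exact congrFun (show π g = 1 from hg) i
  obtain ⟨hinj, hdisc, hcpt⟩ := discrete_and_cocompact_map Γ hπc hπo hπs hW
    (fun x hx y hy hxy => hUΓ _ hxy (hWU x hx y hy)) hker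
  have hbij : Function.Bijective (π.subgroupMap Γ) :=
    ⟨fun γ δ h => hinj (congrArg Subtype.val h), π.subgroupMap_surjective Γ⟩
  set E : Γ ≃* Γ.map π := MulEquiv.ofBijective _ hbij
  set φ' : Γ.map π →* (X ≃ᵢ X) := φ.comp E.symm.toMonoidHom with hφ'
  have hφE : ∀ γ, φ' (E γ) = φ γ := fun γ => by simp [hφ']
  have hrange : φ'.range = φ.range := by
    ext g
    constructor
    · rintro ⟨γ, rfl⟩
      exact ⟨E.symm γ, rfl⟩
    · rintro ⟨γ, rfl⟩
      exact ⟨E γ, hφE γ⟩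
  have hirr' : ∀ i, DenseRange fun γ : Γ.map π => (γ : ∀ i, G i ⧸ N i) i := fun i => by
    have h1 : DenseRange fun γ : Γ => (QuotientGroup.mk ((γ : ∀ i, G i) i) : G i ⧸ N i) :=
      (QuotientGroup.mk_surjective.denseRange).comp (hirr i) QuotientGroup.continuous_mk
    refine h1.mono ?_
    rintro _ ⟨γ, rfl⟩
    exact ⟨E γ, rfl⟩
  obtain ⟨i, hi⟩ := exists_tendsto_one_of_secondCountable (Γ.map π) hirr' hX φ'
    (hrange.symm ▸ hind) (hrange.symm ▸ hunb)
  refine ⟨i, ?_⟩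
  have h2 : Tendsto E (comap (fun γ : Γ => (γ : ∀ i, G i) i) (𝓝 1))
      (comap (fun γ : Γ.map π => (γ : ∀ i, G i ⧸ N i) i) (𝓝 1)) := by
    rw [tendsto_comap_iff]
    have h3 := (QuotientGroup.continuous_mk (N := N i)).tendsto 1
    exact h3.comp tendsto_comap
  exact (hi.comp h2).congr hφE

end SplitRigidity

/-! ### The extension theorem -/

open SplitRigidity in
theorem corollary4 {n : ℕ} {G : Fin n → Type*}
    [∀ i, Group (G i)] [∀ i, TopologicalSpace (G i)] [∀ i, IsTopologicalGroup (G i)]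
    [∀ i, T2Space (G i)] [∀ i, LocallyCompactSpace (G i)] [∀ i, SigmaCompactSpace (G i)]
    (Γ : Subgroup (∀ i, G i)) (hΓ : IsUniformLattice Γ) (hirr : IsIrreducible Γ)
    {X : Type*} [MetricSpace X] [ProperSpace X] (hX : IsCAT0 X)
    (H : Subgroup (X ≃ᵢ X)) (hH : IsClosed (H : Set (X ≃ᵢ X)))
    (τ : Γ →* H)
    (hind : IsIndecomposable (τ.range.map H.subtype))
    (hunb : IsUnbounded ((τ.range.map H.subtype : Subgroup (X ≃ᵢ X)) : Set (X ≃ᵢ X))) :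
    ∃ τ' : (∀ i, G i) →* H, Continuous τ' ∧ (∀ γ : Γ, τ' γ = τ γ) ∧
      ∃ (i : Fin n) (σ : G i →* H), Continuous σ ∧ ∀ g, τ' g = σ (g i) := by
  have := hΓ.discrete
  have := hΓ.cocompact
  have hrange : τ.range.map H.subtype = (H.subtype.comp τ).range := MonoidHom.map_range _ _
  rw [hrange] at hind hunb
  have hirr' : ∀ i, DenseRange fun γ : Γ => (γ : ∀ i, G i) i := fun i => by
    have h1 : Set.range (fun γ : Γ => (γ : ∀ i, G i) i) =
        (fun g : ∀ j, G j => g i) '' (Γ : Set (∀ j, G j)) := by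
      ext
      simp
    rw [DenseRange, h1]
    exact hirr i
  obtain ⟨i, hi⟩ := exists_tendsto_one Γ hirr' hX (H.subtype.comp τ) hind hunb
  obtain ⟨o, -⟩ := hunb
  -- `H` is closed in a locally compact group; its local compactness supplies the limits in the
  -- extension from the dense projection.
  have := locallyCompactSpace_isometry o
  have hloc : LocallyCompactSpace H := hH.isClosedEmbedding_subtypeVal.locallyCompactSpace
  obtain ⟨σ, hσ, hστ⟩ := exists_extension ((Pi.evalMonoidHom G i).comp Γ.subtype) (hirr' i) τ (by
    rw [tendsto_subtype_rng]
    exact hi)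
  exact ⟨σ.comp (Pi.evalMonoidHom G i), hσ.comp (continuous_apply i), hστ, i, σ, hσ,
    fun g => rfl⟩
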